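/- **Theorem 1.** Let $W=[w]$ and let $F_1,\dots,F_h\subseteq W$ ($h\ge 1$) be the facets (inclusion-maximal faces) of a simplicial complex $\mathcal{SC}$ on $W$, i.e. of a family of subsets of $W$ that is closed under taking subsets. Put $H_i=W\setminus F_i$; let $f_k$ be the number of $k$-element faces and $\tau_k$ the number of $k$-element transversals of $\mathcal H=(H_1,\dots,H_h)$, i.e. of $k$-element sets $X\subseteq W$ with $X\cap H_i\ne\emptyset$ for all $i$. A *row* is a word $r\in\{0,1,2,e_1,e_2,\dots\}^W$. It represents the family of all $X\subseteq W$ that contain no position carrying $0$, contain all positions carrying $1$, and contain at least one position of every *bubble* $B_j=\{p: r_p=e_j\}\neq\emptyset$. Let $\mathrm{Card}(r,k)$ be the number of $k$-element members of $r$. The *$e$-algorithm* starts with the single row $(2,\dots,2)$ and for $i=1,\dots,h$ replaces each current row $r$ as follows. If $H_i$ contains a position of $r$ carrying $1$, or a whole bubble of $r$, then $r$ is kept. Otherwise let $B_{j_1},\dots,B_{j_m}$ ($j_1<\dots<j_m$) be the bubbles of $r$ that meet $H_i$, and let $T$ be the set of positions of $H_i$ carrying $2$. For $l=1,\dots,m$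 there is a candidate son obtained from $r$ by writing $0$ on $B_{j_1}\cap H_i,\dots,B_{j_{l-1}}\cap H_i$ and $2$ on $B_{j_l}\setminus H_i$; if $T\ne\emptyset$ there is one more candidate son, obtained by writing $0$ on all $B_{j_l}\cap H_i$ and the new wildcard $e_i$ on $T$. In each candidate son every wildcard occurring at one position only is rewritten as $1$. Then $r$ is replaced by those candidate sons that contain a transversal of $\mathcal H$, i.e. in which no $H_j$ consists of zeros only. Let $r_1,\dots,r_R$ be the final rows. Then $r_1,\dots,r_R$ are nonempty and pairwise disjoint, and their union is the family of all transversals of $\mathcal H$, which is $\mathcal P(W)\setminus\mathcal{SC}$; for all $k$ one has $$\tau_k=\sum_{i=1}^R \mathrm{Card}(r_i,k),\qquad f_k=\binom wk-\tau_k .$$ Moreover the method can be carried out efficiently: there are a single program and an absolute constant $C$ such that, on input of the incidence vectors of $F_1,\dots,F_h$, the program outputs the final rows $r_1,\dots,r_R$ of the $e$-algorithm, all numbers $\mathrm{Card}(r_i,k)$ and all face numbers $f_k$ ($1\le k\le w$, in binary); and if $w\ge 2$ and $W\notin\mathcal{SC}$, it does so in at most $$C\cdot R\,h^2\,w^3\log^2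 w$$ steps. Here programs are first-order recursive programs over cons cells (pure Lisp), where each allocation of a cell, access to a component, test, binding, function call, and evaluation of a variable or constant costs one step (each is a constant-time operation of a random access machine), and where all arithmetic has to be done bit by bit. -/

import Mathlib

/-! ### Simplicial complexes, facets, face numbers, transversals

A simplicial complex on `W = Fin w` is a family of subsets of `W` that is closed under taking
subsets, that is, a `LowerSet (Finset (Fin w))`. -/

/-- `F` lists the facets (the inclusion-maximal faces) of the complex `S`, each exactly once. -/
def IsFacetList {w h : ℕ} (S : LowerSet (Finset (Fin w))) (F : Fin h → Finset (Fin w)) : Prop :=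
  Function.Injective F ∧ ∀ X, X ∈ Set.range F ↔ Maximal (fun Y => Y ∈ S) X

/-- `f_k`: the number of faces with exactly `k` elements. -/
noncomputable def faceNumber {w : ℕ} (S : LowerSet (Finset (Fin w))) (k : ℕ) : ℕ :=
  {X : Finset (Fin w) | X ∈ S ∧ X.card = k}.ncard

/-- `X` meets every hyperedge of the hypergraph `H`. -/
def IsTransversal {w h : ℕ} (H : Fin h → Finset (Fin w)) (X : Finset (Fin w)) : Prop :=
  ∀ i, (X ∩ H i).Nonempty

/-- `τ_k`: the number of transversals with exactly `k` elements. -/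
noncomputable def transversalNumber {w h : ℕ} (H : Fin h → Finset (Fin w)) (k : ℕ) : ℕ :=
  {X : Finset (Fin w) | IsTransversal H X ∧ X.card = k}.ncard

/-! ### Multivalued rows -/

/-- The symbols `0`, `1`, `2` and the wildcards `e_0, e_1, e_2, …`. -/
inductive Symb where
  | zero
  | one
  | two
  | e (j : ℕ)
  deriving DecidableEq

/-- A `{0,1,2,e}`-valued row of length `w`. -/
abbrev Row (w : ℕ) := Fin w → Symb

namespace Row

variable {w : ℕ}

/-- The positions that carry the wildcard `e_j`. -/
def bubble (r : Row w) (j : ℕ) : Finset (Fin w) := {p | r p = Symb.e j}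

/-- The positions that carry the symbol `2`. -/
def twos (r : Row w) : Finset (Fin w) := {p | r p = Symb.two}

/-- The sets contained in a row: `0` means absent, `1` means present, `2` is free, and every
wildcard that occurs means `at least one 1 here`. -/
def members (r : Row w) : Set (Finset (Fin w)) :=
  {X | (∀ p, r p = Symb.zero → p ∉ X) ∧ (∀ p, r p = Symb.one → p ∈ X) ∧
    ∀ j, (r.bubble j).Nonempty → (X ∩ r.bubble j).Nonempty}

/-- `Card(r,k)`: the number of `k`-element members of the row. -/
noncomputable def cardOf (r : Row w) (k : ℕ) : ℕ := {X | X ∈ r.members ∧ X.card = k}.ncard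

/-- A wildcard that occurs at one position only is written as `1`. -/
def tidy (r : Row w) : Row w := fun p =>
  match r p with
  | Symb.e j => if r.bubble j = {p} then Symb.one else Symb.e j
  | s => s

end Row

/-! ### The `e`-algorithm

The constraints `X ∩ H i ≠ ∅` are imposed one after the other on the rows obtained so far,
starting with the row `(2, …, 2)`. -/

section EAlgorithm

variable {w h : ℕ}

/-- All members of the row `r` meet `K`, because `K` holds a `1` of `r` or a whole wildcard
(the indices of the wildcards are smaller than `h`, the number of constraints). -/
def Satisfied (h : ℕ) (K : Finset (Fin w)) (r : Row w) : Prop :=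
  (∃ p ∈ K, r p = Symb.one) ∨ ∃ j, j < h ∧ (r.bubble j).Nonempty ∧ r.bubble j ⊆ K

instance (h : ℕ) (K : Finset (Fin w)) (r : Row w) : Decidable (Satisfied h K r) := by
  unfold Satisfied; infer_instance

/-- The candidate son whose members meet `K` inside the wildcard `e_j`, but not inside a wildcard
of smaller index. -/
def bubbleSon (K : Finset (Fin w)) (r : Row w) (j : ℕ) : Row w := fun p =>
  match r p with
  | Symb.e i =>
      if p ∈ K then (if i < j then Symb.zero else Symb.e i)
      else (if i = j then Symb.two else Symb.e i)
  | s => s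

/-- The candidate son whose members meet `K` outside all wildcards; `new` is the index of the new
wildcard, put on the positions of `K` that carry a `2`. -/
def twosSon (K : Finset (Fin w)) (new : ℕ) (r : Row w) : Row w := fun p =>
  if p ∈ K then
    match r p with
    | Symb.e _ => Symb.zero
    | Symb.two => Symb.e new
    | s => s
  else r p

/-- All candidate sons of `r` for the constraint `X ∩ H i ≠ ∅` (used when `r` does not yet satisfy
it). There are none if `H i` lies inside the zeros of `r`. -/
def candidateSons (H : Fin h → Finset (Fin w)) (i : Fin h) (r : Row w) : List (Row w) :=
  (((List.range h).filter fun j => (r.bubble j ∩ H i).Nonempty).map (bubbleSon (H i) r) ++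
    (if (r.twos ∩ H i).Nonempty then [twosSon (H i) i r] else [])).map Row.tidy

/-- The row contains a transversal of `H`: no hyperedge lies inside the zeros of the row. -/
def Feasible (H : Fin h → Finset (Fin w)) (r : Row w) : Prop :=
  ∀ i, ∃ p ∈ H i, r p ≠ Symb.zero

instance (H : Fin h → Finset (Fin w)) (r : Row w) : Decidable (Feasible H r) := by
  unfold Feasible; infer_instance

/-- Imposing the constraint `X ∩ H i ≠ ∅` on one row: infeasible candidate sons are discarded. -/
def impose (H : Fin h → Finset (Fin w)) (i : Fin h) (r : Row w) : List (Row w) :=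
  if Satisfied h (H i) r then [r]
  else (candidateSons H i r).filter fun s => Feasible H s

/-- The final rows of the `e`-algorithm for the hypergraph `H`. -/
def eRows (H : Fin h → Finset (Fin w)) : List (Row w) :=
  (List.finRange h).foldl (fun rows i => rows.flatMap (impose H i)) [fun _ => Symb.two]

end EAlgorithm

/-! ### Machine model

A first-order functional language (pure Lisp) over cons cells. A program is a finite list of
function bodies, functions call each other recursively, and the only data are cons cells. Every
evaluation of a constant or variable, every allocation of a cell, every access to a component of a
cell, every test, binding and function call costs one step. All of these are constant-time
operations of a random access machine. There is no arithmetic: a program has to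
compute with numbers bit by bit. -/

namespace Lisp

/-- Values: `nil` or a cell with two components. -/
inductive Val where
  | nil
  | cons (a b : Val)

/-- First component of a cell. -/
def Val.head : Val → Val
  | nil => nil
  | cons a _ => a

/-- Second component of a cell. -/
def Val.tail : Val → Val
  | nil => nil
  | cons _ b => b

/-- Expressions. `var n` is the `n`-th entry of the environment, `bind a b` evaluates `b` with the
value of `a` put in front of the environment, `call f a` calls the `f`-th function of the program
on the value of `a`. -/
inductive Expr where
  | var (n : ℕ)
  | nil
  | cons (a b : Expr)
  | head (a : Expr)
  | tail (a : Expr)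
  | ite (c a b : Expr)
  | bind (a b : Expr)
  | call (f : ℕ) (a : Expr)

/-- A program: the list of its function bodies. A body sees its argument as `var 0`. -/
abbrev Program := List Expr

/-- `Eval P env a v t`: in the program `P` and the environment `env`, the expression `a` evaluates
to `v` in exactly `t` steps. -/
inductive Eval (P : Program) : List Val → Expr → Val → ℕ → Prop
  | var {env : List Val} {n : ℕ} {v : Val} :
      env[n]? = some v → Eval P env (.var n) v 1
  | nil {env : List Val} : Eval P env .nil .nil 1
  | cons {env : List Val} {a b : Expr} {x y : Val} {s t : ℕ} :
      Eval P env a x s → Eval P env b y t → Eval P env (.cons a b) (.cons x y) (s + t + 1)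
  | head {env : List Val} {a : Expr} {x : Val} {s : ℕ} :
      Eval P env a x s → Eval P env (.head a) x.head (s + 1)
  | tail {env : List Val} {a : Expr} {x : Val} {s : ℕ} :
      Eval P env a x s → Eval P env (.tail a) x.tail (s + 1)
  | ite_cons {env : List Val} {c a b : Expr} {x y v : Val} {s t : ℕ} :
      Eval P env c (.cons x y) s → Eval P env a v t → Eval P env (.ite c a b) v (s + t + 1)
  | ite_nil {env : List Val} {c a b : Expr} {v : Val} {s t : ℕ} :
      Eval P env c .nil s → Eval P env b v t → Eval P env (.ite c a b) v (s + t + 1)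
  | bind {env : List Val} {a b : Expr} {x v : Val} {s t : ℕ} :
      Eval P env a x s → Eval P (x :: env) b v t → Eval P env (.bind a b) v (s + t + 1)
  | call {env : List Val} {f : ℕ} {a body : Expr} {x v : Val} {s t : ℕ} :
      P[f]? = some body → Eval P env a x s → Eval P [x] body v t →
        Eval P env (.call f a) v (s + t + 1)

/-- `P` (with function `0` as main function) halts on `input` with `output` after `t` steps. -/
def Computes (P : Program) (input output : Val) (t : ℕ) : Prop :=
  Eval P [input] (.call 0 (.var 0)) output t

/-! Encodings of the data -/

/-- Booleans. -/
def encBool : Bool → Val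
  | false => .nil
  | true => .cons .nil .nil

/-- Lists. -/
def encList {α : Type*} (enc : α → Val) : List α → Val
  | [] => .nil
  | a :: l => .cons (enc a) (encList enc l)

/-- Natural numbers, in binary, least significant bit first. -/
def encNat (n : ℕ) : Val := encList encBool n.bits

/-- Symbols of a row. -/
def encSymb : Symb → Val
  | .zero => .nil
  | .one => .cons .nil .nil
  | .two => .cons .nil (.cons .nil .nil)
  | .e j => .cons (.cons .nil .nil) (encNat j)

/-- Rows, as the list of their symbols. -/
def encRow {w : ℕ} (r : Row w) : Val := encList encSymb (List.ofFn r)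

/-- Subsets of `Fin w`, as characteristic vectors. -/
def encSet {w : ℕ} (X : Finset (Fin w)) : Val :=
  encList encBool (List.ofFn fun p => decide (p ∈ X))

/-- Sequences of values. -/
def encFamily {h : ℕ} {α : Type*} (enc : α → Val) (F : Fin h → α) : Val :=
  encList enc (List.ofFn F)

end Lisp

/-- What a run of the method on the facets of a complex on `Fin w` delivers: the final rows, for
each final row `r` the numbers `Card(r,1), …, Card(r,w)`, and the face numbers `f_1, …, f_w`. -/
noncomputable def encResult {w : ℕ} (S : LowerSet (Finset (Fin w))) (rows : List (Row w)) :
    Lisp.Val :=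
  .cons (Lisp.encList Lisp.encRow rows)
    (.cons
      (Lisp.encList (fun r : Row w =>
        Lisp.encFamily Lisp.encNat fun k : Fin w => r.cardOf (k + 1)) rows)
      (Lisp.encFamily Lisp.encNat fun k : Fin w => faceNumber S (k + 1)))

/-! ### The combinatorics of the `e`-algorithm -/

namespace Row

variable {w : ℕ}

/-! Correctness rests on a classification. Let `r` be a row that does not satisfy the constraint for
`K = H i`. Then no `1` of `r` lies in `K`, and every wildcard of `r` has a position outside `K`. A
member `X` of `r` that meets `K` either meets some wildcard inside `K`, and then there is a least
such index `j`, or it meets `K` only in positions carrying `2`. The candidate sons describe exactly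
these classes (`mem_members_bubbleSon`, `mem_members_twosSon`), so the sons are pairwise disjoint
and together catch every member that meets `K`. The new wildcard must be fresh; this is guaranteed
by `Pending`, which keeps the wildcard indices in the rows below the indices of the constraints
still to come. The largest member of a row is its support, so a row contains a transversal if and
only if no hyperedge consists of zeros (`feasible_iff`), and dropping the other sons loses no
transversal. Since a set fails to meet `W \ F_i` exactly when it lies in `F_i`, the transversals are
the non-faces, and counting gives the formulas for the face numbers.

The running time depends on the final number `R` of rows because no intermediate stage has more: a
feasible row contains a transversal, which must survive in some son, so the number of rows never
decreases (`length_le_length_imposeAll`). Each of the `h` stages thus treats at most `R` rows. One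
row costs `O(h w^3)` per stage (`cost_imposeRow`): testing the constraint takes `h` scans with
comparisons of indices of at most `w` bits, and sons are tidied and tested for feasibility. The
indices are that short because distinct facets give `h ≤ 2^w`. The numbers `Card(r,k)` come from
multiplying the generating polynomial of the row, position by position. A `2` contributes the factor
`1 + x`, a `1` the factor `x`, and a bubble is handled by a recursion that adds its positions one at
a time (`cnt_membersWithin_insert`). The binomial coefficients are the numbers of the row `(2, …,
2)`. In all this gives `O(R h^2 w^3)`; the logarithmic factor of the statement only absorbs a
constant.

To make the step count provable, the program is written in a small language `Code` of total
functions with recursion along lists. A compiler into the machine language is verified together with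
the exact number of steps (`eval_compile`). What remains for each routine is an equation for its
value `sem` and an inequality for its `cost`, the latter usually from an invariant of the state of
one recursion (`cost_recur_le`). -/

theorem mem_bubble {r : Row w} {j : ℕ} {p : Fin w} : p ∈ r.bubble j ↔ r p = Symb.e j := by
  simp [bubble]

theorem mem_twos {r : Row w} {p : Fin w} : p ∈ r.twos ↔ r p = Symb.two := by
  simp [twos]

theorem mem_members {r : Row w} {X : Finset (Fin w)} : X ∈ r.members ↔
    (∀ p, r p = Symb.zero → p ∉ X) ∧ (∀ p, r p = Symb.one → p ∈ X) ∧
      ∀ p j, r p = Symb.e j → ∃ q ∈ X, r q = Symb.e j := by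
  simp only [members, Set.mem_ofPred_eq, Finset.Nonempty, Finset.mem_inter, mem_bubble]
  constructor
  · rintro ⟨h0, h1, h2⟩
    exact ⟨h0, h1, fun p j h => h2 j ⟨p, h⟩⟩
  · rintro ⟨h0, h1, h2⟩
    exact ⟨h0, h1, fun j ⟨p, h⟩ => h2 p j h⟩

/-- The positions that do not carry `0` form a member of the row. -/
theorem support_mem_members (r : Row w) :
    (Finset.univ.filter fun p => r p ≠ Symb.zero) ∈ r.members := by
  rw [mem_members]
  refine ⟨fun p h => by simp [h], fun p h => by simp [h], fun p j h => ⟨p, by simp [h], h⟩⟩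

theorem tidy_eq_e {r : Row w} {p : Fin w} {j : ℕ} (h : r.tidy p = Symb.e j) :
    r p = Symb.e j := by
  unfold tidy at h
  split at h
  · split at h
    · cases h
    · simp_all
  · simp_all

/-- A wildcard with a single position demands that this position be present, which is just what `1`
demands; all other wildcards keep all their positions. -/
theorem members_tidy (r : Row w) : r.tidy.members = r.members := by
  ext X
  simp only [mem_members]
  have hz : ∀ p, r.tidy p = Symb.zero ↔ r p = Symb.zero := by
    intro p; unfold tidy; split
    · split <;> simp_all
    · rfl
  have ho : ∀ p, r.tidy p = Symb.one ↔ r p = Symb.one ∨ ∃ j, r p = Symb.e j ∧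
      r.bubble j = {p} := by
    intro p; unfold tidy; split
    · split <;> simp_all
    · next h => simp only [iff_self_or, forall_exists_index, and_imp]; exact fun j hj => (h j hj).elim
  have he : ∀ p j, r.tidy p = Symb.e j ↔ r p = Symb.e j ∧ r.bubble j ≠ {p} := by
    intro p j; unfold tidy; split
    · next i hi =>
      rw [hi]; split
      · simp only [reduceCtorEq, Symb.e.injEq, ne_eq, false_iff, not_and, not_not]
        rintro rfl; assumption
      · simp only [Symb.e.injEq, ne_eq, iff_self_and]
        rintro rfl; assumption
    · next h => simp only [ne_eq, iff_self_and]; exact fun hj => (h j hj).elim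
  simp only [hz, ho, he]
  constructor
  · rintro ⟨h0, h1, h2⟩
    refine ⟨h0, fun p hp => h1 p (.inl hp), fun p j hp => ?_⟩
    by_cases hb : r.bubble j = {p}
    · exact ⟨p, h1 p (.inr ⟨j, hp, hb⟩), hp⟩
    · obtain ⟨q, hq, hq'⟩ := h2 p j ⟨hp, hb⟩
      exact ⟨q, hq, hq'.1⟩
  · rintro ⟨h0, h1, h2⟩
    refine ⟨h0, ?_, ?_⟩
    · rintro p (hp | ⟨j, hp, hb⟩)
      · exact h1 p hp
      · obtain ⟨q, hq, hq'⟩ := h2 p j hp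
        rw [← mem_bubble, hb, Finset.mem_singleton] at hq'
        exact hq' ▸ hq
    · rintro p j ⟨hp, hb⟩
      obtain ⟨q, hq, hq'⟩ := h2 p j hp
      refine ⟨q, hq, hq', fun hb' => hb ?_⟩
      have : p ∈ r.bubble j := mem_bubble.2 hp
      rw [hb', Finset.mem_singleton] at this
      rw [hb', this]

/-- All wildcards of the row have an index below `m`. -/
def WildcardsLT (r : Row w) (m : ℕ) : Prop := ∀ p j, r p = Symb.e j → j < m

theorem WildcardsLT.mono {r : Row w} {m n : ℕ} (h : r.WildcardsLT m) (hmn : m ≤ n) :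
    r.WildcardsLT n := fun p j hp => (h p j hp).trans_le hmn

end Row

/-! ### Imposing one constraint on one row -/

section

open Row

variable {w h : ℕ}

/-- By `hK` each wildcard keeps a position outside `K`. So writing zeros on its part inside `K` does
not erase its condition but moves it to the remaining positions, where it still follows from, and
implies, the old one for sets avoiding the zeros. -/
theorem mem_members_bubbleSon {K : Finset (Fin w)} {r : Row w} {j : ℕ}
    (hK : ∀ p i, r p = Symb.e i → ∃ q, q ∉ K ∧ r q = Symb.e i)
    (hj : ∃ p ∈ K, r p = Symb.e j) {X : Finset (Fin w)} :
    X ∈ (bubbleSon K r j).members ↔ X ∈ r.members ∧ (∃ p ∈ X, p ∈ K ∧ r p = Symb.e j) ∧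
      ∀ i < j, ∀ p ∈ X, p ∈ K → r p ≠ Symb.e i := by
  have hz : ∀ p, bubbleSon K r j p = Symb.zero ↔
      r p = Symb.zero ∨ p ∈ K ∧ ∃ i < j, r p = Symb.e i := by
    intro p; unfold bubbleSon; split
    · split <;> split <;> simp_all
    · next hs => simp only [iff_self_or]; rintro ⟨-, i, -, hi⟩; exact (hs i hi).elim
  have ho : ∀ p, bubbleSon K r j p = Symb.one ↔ r p = Symb.one := by
    intro p; unfold bubbleSon; split
    · split <;> split <;> simp_all
    · rfl
  have he : ∀ p i, bubbleSon K r j p = Symb.e i ↔ r p = Symb.e i ∧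
      ((p ∈ K ∧ j ≤ i) ∨ (p ∉ K ∧ i ≠ j)) := by
    intro p i; unfold bubbleSon; split
    · next l hl =>
      rw [hl]
      split <;> split <;> simp only [reduceCtorEq, Symb.e.injEq, false_iff, true_and, false_and,
        or_false, false_or, not_and, *, not_true_eq_false, not_false_eq_true] <;>
        omega
    · next hs => simp only [iff_self_and]; exact fun hi => (hs i hi).elim
  simp only [mem_members, hz, ho, he]
  constructor
  · rintro ⟨h0, h1, h2⟩
    have hlt : ∀ i < j, ∀ p ∈ X, p ∈ K → r p ≠ Symb.e i :=
      fun i hi p hp hpK hr => h0 p (.inr ⟨hpK, i, hi, hr⟩) hp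
    -- In the son the wildcard `j` survives only inside `K`, because it became `2` outside. Its
    -- condition therefore yields an element of `X` in `K`.
    obtain ⟨p, hpK, hp⟩ := hj
    obtain ⟨q, hq, hq1, hq2⟩ := h2 p j ⟨hp, .inl ⟨hpK, le_rfl⟩⟩
    have hqK : q ∈ K := by
      rcases hq2 with h | h
      · exact h.1
      · exact (h.2 rfl).elim
    refine ⟨⟨fun p hp => h0 p (.inl hp), h1, fun p' i hp' => ?_⟩, ⟨q, hq, hqK, hq1⟩, hlt⟩
    by_cases hij : i = j
    · subst hij; exact ⟨q, hq, hq1⟩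
    · obtain ⟨q', hq'K, hq'⟩ := hK p' i hp'
      obtain ⟨x, hx, hx1, -⟩ := h2 q' i ⟨hq', .inr ⟨hq'K, hij⟩⟩
      exact ⟨x, hx, hx1⟩
  · rintro ⟨⟨h0, h1, h2⟩, ⟨q, hq, hqK, hqj⟩, hlt⟩
    refine ⟨?_, h1, ?_⟩
    · rintro p (hp | ⟨hpK, i, hi, hp⟩) hpX
      · exact h0 p hp hpX
      · exact hlt i hi p hpX hpK hp
    · rintro p i ⟨hp, hc⟩
      by_cases hij : i = j
      · subst hij; exact ⟨q, hq, hqj, .inl ⟨hqK, le_rfl⟩⟩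
      · obtain ⟨x, hx, hx1⟩ := h2 p i hp
        refine ⟨x, hx, hx1, ?_⟩
        by_cases hxK : x ∈ K
        · exact .inl ⟨hxK, not_lt.1 fun hlt' => hlt i hlt' x hx hxK hx1⟩
        · exact .inr ⟨hxK, hij⟩

/-- The bound `hm` makes the index `m` fresh, so the new bubble is exactly the set of positions of
`K` with `2`. A member of `r` that meets `K` but no wildcard inside `K` must do so at a `2`, since
`K` has no `1`. -/
theorem mem_members_twosSon {K : Finset (Fin w)} {r : Row w} {m : ℕ}
    (hK : ∀ p i, r p = Symb.e i → ∃ q, q ∉ K ∧ r q = Symb.e i)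
    (ho : ∀ p ∈ K, r p ≠ Symb.one) (hm : r.WildcardsLT m)
    (hT : ∃ p ∈ K, r p = Symb.two) {X : Finset (Fin w)} :
    X ∈ (twosSon K m r).members ↔ X ∈ r.members ∧ (∃ p ∈ X, p ∈ K) ∧
      ∀ i, ∀ p ∈ X, p ∈ K → r p ≠ Symb.e i := by
  have hz : ∀ p, twosSon K m r p = Symb.zero ↔
      r p = Symb.zero ∨ p ∈ K ∧ ∃ i, r p = Symb.e i := by
    intro p; unfold twosSon; split
    · cases hp : r p <;> simp_all
    · simp_all
  have ho' : ∀ p, twosSon K m r p = Symb.one ↔ r p = Symb.one := by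
    intro p; unfold twosSon; split
    · cases hp : r p <;> simp_all
    · rfl
  have he : ∀ p i, twosSon K m r p = Symb.e i ↔
      (p ∈ K ∧ r p = Symb.two ∧ m = i) ∨ (p ∉ K ∧ r p = Symb.e i) := by
    intro p i; unfold twosSon; split
    · cases hp : r p <;> simp_all
    · simp_all
  simp only [mem_members, hz, ho', he]
  constructor
  · rintro ⟨h0, h1, h2⟩
    obtain ⟨p, hpK, hp⟩ := hT
    obtain ⟨q, hq, hq1⟩ := h2 p m (.inl ⟨hpK, hp, rfl⟩)
    refine ⟨⟨fun p hp => h0 p (.inl hp), h1, fun p i hp => ?_⟩, ⟨q, hq, ?_⟩,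
      fun i p hp hpK hr => h0 p (.inr ⟨hpK, i, hr⟩) hp⟩
    · obtain ⟨q', hq'K, hq'⟩ := hK p i hp
      obtain ⟨x, hx, hx1⟩ := h2 q' i (.inr ⟨hq'K, hq'⟩)
      rcases hx1 with hx1 | hx1
      · exact absurd (hm p i hp) (by omega)
      · exact ⟨x, hx, hx1.2⟩
    · rcases hq1 with hq1 | hq1
      · exact hq1.1
      · exact absurd (hm q m hq1.2) (lt_irrefl m)
  · rintro ⟨⟨h0, h1, h2⟩, ⟨q, hq, hqK⟩, hlt⟩
    refine ⟨?_, h1, ?_⟩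
    · rintro p (hp | ⟨hpK, i, hp⟩) hpX
      · exact h0 p hp hpX
      · exact hlt i p hpX hpK hp
    · rintro p i (⟨hpK, hp, rfl⟩ | ⟨hpK, hp⟩)
      · refine ⟨q, hq, .inl ⟨hqK, ?_, rfl⟩⟩
        cases hr : r q with
        | zero => exact (h0 q hr hq).elim
        | one => exact (ho q hqK hr).elim
        | two => rfl
        | e j => exact (hlt j q hq hqK hr).elim
      · obtain ⟨x, hx, hx1⟩ := h2 p i hp
        exact ⟨x, hx, .inr ⟨fun hxK => hlt i x hx hxK hx1, hx1⟩⟩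

/-- Being a transversal is inherited by supersets, so only the largest member of the row, its
support, has to be tested. -/
theorem feasible_iff {H : Fin h → Finset (Fin w)} {r : Row w} :
    Feasible H r ↔ ∃ X ∈ r.members, IsTransversal H X := by
  constructor
  · intro hf
    refine ⟨_, r.support_mem_members, fun i => ?_⟩
    obtain ⟨p, hp, hr⟩ := hf i
    exact ⟨p, by simp [hp, hr]⟩
  · rintro ⟨X, hX, hT⟩ i
    obtain ⟨p, hp⟩ := hT i
    rw [Finset.mem_inter] at hp
    exact ⟨p, hp.2, fun hr => (mem_members.1 hX).1 p hr hp.1⟩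

/-- The consequences of a constraint not being satisfied by a row. -/
theorem exists_not_mem_of_not_satisfied {K : Finset (Fin w)} {r : Row w}
    (hr : r.WildcardsLT h) (hs : ¬ Satisfied h K r) :
    (∀ p ∈ K, r p ≠ Symb.one) ∧ ∀ p i, r p = Symb.e i → ∃ q, q ∉ K ∧ r q = Symb.e i := by
  unfold Satisfied at hs
  push Not at hs
  refine ⟨hs.1, fun p i hp => ?_⟩
  obtain ⟨q, hq, hqK⟩ := Finset.not_subset.1 (hs.2 i (hr p i hp) ⟨p, mem_bubble.2 hp⟩)
  exact ⟨q, hqK, mem_bubble.1 hq⟩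

theorem mem_candidateSons {H : Fin h → Finset (Fin w)} {i : Fin h} {r s : Row w} :
    s ∈ candidateSons H i r ↔
      (∃ j < h, (∃ p ∈ H i, r p = Symb.e j) ∧ s = (bubbleSon (H i) r j).tidy) ∨
        ((∃ p ∈ H i, r p = Symb.two) ∧ s = (twosSon (H i) i r).tidy) := by
  have h1 : ∀ j, (r.bubble j ∩ H i).Nonempty ↔ ∃ p ∈ H i, r p = Symb.e j := fun j => by
    simp only [Finset.Nonempty, Finset.mem_inter, mem_bubble, and_comm]
  have h2 : (r.twos ∩ H i).Nonempty ↔ ∃ p ∈ H i, r p = Symb.two := by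
    simp only [Finset.Nonempty, Finset.mem_inter, mem_twos, and_comm]
  simp only [candidateSons, h1, h2, List.map_append, List.map_map, List.mem_append, List.mem_map,
    List.mem_filter, List.mem_range, decide_eq_true_eq, Function.comp]
  refine or_congr ⟨?_, ?_⟩ ⟨?_, ?_⟩
  · rintro ⟨j, ⟨hj, hp⟩, rfl⟩; exact ⟨j, hj, hp, rfl⟩
  · rintro ⟨j, hj, hp, rfl⟩; exact ⟨j, ⟨hj, hp⟩, rfl⟩
  · rintro ⟨a, ha, rfl⟩
    split at ha
    · rw [List.mem_singleton] at ha; subst ha; exact ⟨by assumption, rfl⟩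
    · cases ha
  · rintro ⟨hp, rfl⟩; rw [if_pos hp]; exact ⟨_, List.mem_singleton_self _, rfl⟩

/-- The son that receives `X` is found from the places where `X` meets the constraint. It is
feasible because it contains the transversal `X`, and so it is not filtered out. -/
theorem exists_mem_impose {H : Fin h → Finset (Fin w)} {i : Fin h} {r : Row w}
    (hr : r.WildcardsLT i) {X : Finset (Fin w)} (hX : X ∈ r.members) (hT : IsTransversal H X) :
    ∃ s ∈ impose H i r, X ∈ s.members := by
  unfold impose
  split
  · exact ⟨r, List.mem_singleton_self _, hX⟩
  next hs =>
  obtain ⟨ho, hK⟩ := exists_not_mem_of_not_satisfied (hr.mono i.2.le) hs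
  suffices ∃ s ∈ candidateSons H i r, X ∈ s.members by
    obtain ⟨s, hs, hXs⟩ := this
    exact ⟨s, List.mem_filter.2 ⟨hs, by simpa using feasible_iff.2 ⟨X, hXs, hT⟩⟩, hXs⟩
  simp only [mem_candidateSons]
  obtain ⟨q, hq⟩ := hT i
  rw [Finset.mem_inter] at hq
  by_cases hb : ∃ j, ∃ p ∈ X, p ∈ H i ∧ r p = Symb.e j
  · classical
    -- The least index of a wildcard that `X` meets inside `H i` selects the son; minimality is the
    -- condition that no earlier wildcard is met there.
    obtain ⟨p, hpX, hpK, hp⟩ := Nat.find_spec hb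
    refine ⟨_, .inl ⟨Nat.find hb, (hr _ _ hp).trans i.2, ⟨p, hpK, hp⟩, rfl⟩, ?_⟩
    rw [members_tidy, mem_members_bubbleSon hK ⟨p, hpK, hp⟩]
    exact ⟨hX, ⟨p, hpX, hpK, hp⟩, fun k hk x hx hxK hxk => Nat.find_min hb hk ⟨x, hx, hxK, hxk⟩⟩
  · have hno : ∀ j, ∀ p ∈ X, p ∈ H i → r p ≠ Symb.e j :=
      fun j p hp hpK hj => hb ⟨j, p, hp, hpK, hj⟩
    have hT : ∃ p ∈ H i, r p = Symb.two := by
      refine ⟨q, hq.2, ?_⟩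
      cases hrq : r q with
      | zero => exact ((mem_members.1 hX).1 q hrq hq.1).elim
      | one => exact (ho q hq.2 hrq).elim
      | two => rfl
      | e j => exact (hno j q hq.1 hq.2 hrq).elim
    refine ⟨_, .inr ⟨hT, rfl⟩, ?_⟩
    rw [members_tidy, mem_members_twosSon hK ho hr hT]
    exact ⟨hX, ⟨q, hq⟩, hno⟩

theorem of_mem_impose {H : Fin h → Finset (Fin w)} {i : Fin h} {r s : Row w}
    (hr : r.WildcardsLT i) (hs : s ∈ impose H i r) {X : Finset (Fin w)} (hX : X ∈ s.members) :
    X ∈ r.members ∧ (X ∩ H i).Nonempty := by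
  unfold impose at hs
  split at hs
  · next hsat =>
    rw [List.mem_singleton] at hs
    subst hs
    refine ⟨hX, ?_⟩
    rcases hsat with ⟨p, hp, h1⟩ | ⟨j, -, ⟨p, hp⟩, hsub⟩
    · exact ⟨p, Finset.mem_inter.2 ⟨(mem_members.1 hX).2.1 p h1, hp⟩⟩
    · obtain ⟨q, hq, hqj⟩ := (mem_members.1 hX).2.2 p j (mem_bubble.1 hp)
      exact ⟨q, Finset.mem_inter.2 ⟨hq, hsub (mem_bubble.2 hqj)⟩⟩
  · next hsat =>
    obtain ⟨ho, hK⟩ := exists_not_mem_of_not_satisfied (hr.mono i.2.le) hsat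
    rcases mem_candidateSons.1 (List.mem_filter.1 hs).1 with ⟨j, -, hj, rfl⟩ | ⟨hT, rfl⟩
    · rw [members_tidy, mem_members_bubbleSon hK hj] at hX
      obtain ⟨h1, ⟨p, hp, hpK, -⟩, -⟩ := hX
      exact ⟨h1, p, Finset.mem_inter.2 ⟨hp, hpK⟩⟩
    · rw [members_tidy, mem_members_twosSon hK ho hr hT] at hX
      obtain ⟨h1, ⟨p, hp, hpK⟩, -⟩ := hX
      exact ⟨h1, p, Finset.mem_inter.2 ⟨hp, hpK⟩⟩

/-- Only the index `i` can be new. Hence the wildcard introduced at the next constraint is fresh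
again. -/
theorem wildcardsLT_of_mem_impose {H : Fin h → Finset (Fin w)} {i : Fin h} {r s : Row w}
    (hr : r.WildcardsLT i) (hs : s ∈ impose H i r) : s.WildcardsLT (i + 1) := by
  unfold impose at hs
  split at hs
  · rw [List.mem_singleton] at hs
    exact hs ▸ hr.mono (Nat.le_succ _)
  · rcases mem_candidateSons.1 (List.mem_filter.1 hs).1 with ⟨j, -, -, rfl⟩ | ⟨-, rfl⟩
    · intro p k hk
      have hk := tidy_eq_e hk
      refine Nat.lt_succ_of_lt (hr p k ?_)
      unfold bubbleSon at hk
      split at hk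
      · split at hk <;> split at hk <;> simp_all
      · exact hk
    · intro p k hk
      have hk := tidy_eq_e hk
      unfold twosSon at hk
      split at hk
      · split at hk <;> simp_all
      · exact Nat.lt_succ_of_lt (hr p k hk)

/-- For two wildcard sons, a common member would meet the smaller wildcard inside `H i` by the first
son and avoid it there by the second. The son with the new wildcard avoids all old wildcards inside
`H i`, so it is disjoint from the rest. -/
theorem pairwise_impose {H : Fin h → Finset (Fin w)} {i : Fin h} {r : Row w}
    (hr : r.WildcardsLT i) :
    (impose H i r).Pairwise fun s t => Disjoint s.members t.members := by
  unfold impose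
  split
  · exact List.pairwise_singleton _ _
  next hsat =>
  obtain ⟨ho, hK⟩ := exists_not_mem_of_not_satisfied (hr.mono i.2.le) hsat
  refine List.Pairwise.filter _ ?_
  unfold candidateSons
  rw [List.pairwise_map, List.pairwise_append]
  have hmem : ∀ j, (r.bubble j ∩ H i).Nonempty → ∃ p ∈ H i, r p = Symb.e j := by
    rintro j ⟨p, hp⟩
    rw [Finset.mem_inter, mem_bubble] at hp
    exact ⟨p, hp.2, hp.1⟩
  refine ⟨?_, ?_, ?_⟩
  · rw [List.pairwise_map]
    refine (List.Pairwise.filter _ List.pairwise_lt_range).imp_of_mem ?_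
    intro j k hj hk hjk
    simp only [List.mem_filter, decide_eq_true_eq] at hj hk
    rw [members_tidy, members_tidy, Set.disjoint_left]
    intro X hX hX'
    rw [mem_members_bubbleSon hK (hmem _ hj.2)] at hX
    rw [mem_members_bubbleSon hK (hmem _ hk.2)] at hX'
    obtain ⟨p, hp, hpK, hpj⟩ := hX.2.1
    exact hX'.2.2 j hjk p hp hpK hpj
  · split
    · exact List.pairwise_singleton _ _
    · exact List.Pairwise.nil
  · intro s hs t ht
    simp only [List.mem_map, List.mem_filter, decide_eq_true_eq] at hs
    obtain ⟨j, ⟨-, hj⟩, rfl⟩ := hs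
    split at ht
    · next hT =>
      rw [List.mem_singleton] at ht
      subst ht
      have hT : ∃ p ∈ H i, r p = Symb.two := by
        obtain ⟨p, hp⟩ := hT
        rw [Finset.mem_inter, mem_twos] at hp
        exact ⟨p, hp.2, hp.1⟩
      rw [members_tidy, members_tidy, Set.disjoint_left]
      intro X hX hX'
      rw [mem_members_bubbleSon hK (hmem _ hj)] at hX
      rw [mem_members_twosSon hK ho hr hT] at hX'
      obtain ⟨p, hp, hpK, hpj⟩ := hX.2.1
      exact hX'.2.2 j p hp hpK hpj
    · cases ht

theorem feasible_of_mem_impose {H : Fin h → Finset (Fin w)} {i : Fin h} {r s : Row w}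
    (hr : Feasible H r) (hs : s ∈ impose H i r) : Feasible H s := by
  unfold impose at hs
  split at hs
  · rw [List.mem_singleton] at hs; exact hs ▸ hr
  · simpa using (List.mem_filter.1 hs).2

/-! ### Iteration over the constraints -/

/-- The rows after the constraints in the list `l` were imposed on `rows`. -/
def imposeAll (H : Fin h → Finset (Fin w)) (l : List (Fin h)) (rows : List (Row w)) :
    List (Row w) := l.foldl (fun rows i => rows.flatMap (impose H i)) rows

/-- The constraints in `l` are sorted, and the wildcards in `rows` precede them. -/
def Pending (l : List (Fin h)) (rows : List (Row w)) : Prop :=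
  l.Pairwise (· < ·) ∧ ∀ r ∈ rows, ∀ i ∈ l, r.WildcardsLT (i : Fin h)

theorem Pending.head {l : List (Fin h)} {i : Fin h} {rows : List (Row w)}
    (hp : Pending (i :: l) rows) : ∀ r ∈ rows, r.WildcardsLT i :=
  fun r hr => hp.2 r hr i List.mem_cons_self

theorem Pending.flatMap {H : Fin h → Finset (Fin w)} {l : List (Fin h)} {i : Fin h}
    {rows : List (Row w)} (hp : Pending (i :: l) rows) :
    Pending l (rows.flatMap (impose H i)) := by
  refine ⟨(List.pairwise_cons.1 hp.1).2, fun s hs k hk => ?_⟩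
  obtain ⟨r, hr, hs⟩ := List.mem_flatMap.1 hs
  exact (wildcardsLT_of_mem_impose (hp.head r hr) hs).mono
    ((List.pairwise_cons.1 hp.1).1 k hk)

theorem exists_mem_imposeAll {H : Fin h → Finset (Fin w)} {X : Finset (Fin w)}
    (hT : IsTransversal H X) : ∀ (l : List (Fin h)) (rows : List (Row w)), Pending l rows →
      (∃ r ∈ rows, X ∈ r.members) → ∃ r ∈ imposeAll H l rows, X ∈ r.members
  | [], _, _, h => h
  | i :: l, rows, hp, ⟨r, hr, hX⟩ => by
    obtain ⟨s, hs, hXs⟩ := exists_mem_impose (hp.head r hr) hX hT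
    exact exists_mem_imposeAll hT l _ hp.flatMap ⟨s, List.mem_flatMap.2 ⟨r, hr, hs⟩, hXs⟩

theorem of_mem_imposeAll {H : Fin h → Finset (Fin w)} {X : Finset (Fin w)} :
    ∀ (l : List (Fin h)) (rows : List (Row w)), Pending l rows →
      (∃ r ∈ imposeAll H l rows, X ∈ r.members) →
        (∃ r ∈ rows, X ∈ r.members) ∧ ∀ i ∈ l, (X ∩ H i).Nonempty
  | [], _, _, h => ⟨h, by simp⟩
  | i :: l, rows, hp, h => by
    obtain ⟨⟨s, hs, hX⟩, hl⟩ := of_mem_imposeAll l _ hp.flatMap h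
    obtain ⟨r, hr, hs⟩ := List.mem_flatMap.1 hs
    obtain ⟨h1, h2⟩ := of_mem_impose (hp.head r hr) hs hX
    exact ⟨⟨r, hr, h1⟩, by simpa using ⟨h2, hl⟩⟩

theorem pairwise_imposeAll {H : Fin h → Finset (Fin w)} :
    ∀ (l : List (Fin h)) (rows : List (Row w)), Pending l rows →
      (rows.Pairwise fun s t => Disjoint s.members t.members) →
        (imposeAll H l rows).Pairwise fun s t => Disjoint s.members t.members
  | [], _, _, h => h
  | i :: l, rows, hp, h => by
    refine pairwise_imposeAll l _ hp.flatMap ?_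
    rw [List.pairwise_flatMap]
    refine ⟨fun r hr => pairwise_impose (hp.head r hr), h.imp_of_mem ?_⟩
    intro r t hr ht hrt s hs s' hs'
    rw [Set.disjoint_left] at hrt ⊢
    exact fun X hX hX' => hrt (of_mem_impose (hp.head r hr) hs hX).1
      (of_mem_impose (hp.head t ht) hs' hX').1

theorem wildcardsLT_of_mem_imposeAll {H : Fin h → Finset (Fin w)} :
    ∀ (l : List (Fin h)) (rows : List (Row w)), Pending l rows →
      (∀ r ∈ rows, r.WildcardsLT h) → ∀ r ∈ imposeAll H l rows, r.WildcardsLT h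
  | [], _, _, h => h
  | i :: l, rows, hp, _ => by
    refine wildcardsLT_of_mem_imposeAll l _ hp.flatMap fun s hs => ?_
    obtain ⟨r, hr, hs⟩ := List.mem_flatMap.1 hs
    exact (wildcardsLT_of_mem_impose (hp.head r hr) hs).mono i.2

/-- A feasible row contains a transversal, and this transversal lies in some son; so every row has
at least one successor. -/
theorem length_le_length_flatMap_impose {H : Fin h → Finset (Fin w)} {i : Fin h}
    {rows : List (Row w)} (hi : ∀ r ∈ rows, r.WildcardsLT i)
    (hf : ∀ r ∈ rows, Feasible H r) : rows.length ≤ (rows.flatMap (impose H i)).length := by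
  induction rows with
  | nil => simp
  | cons r rows ih =>
    obtain ⟨X, hX, hT⟩ := feasible_iff.1 (hf r List.mem_cons_self)
    obtain ⟨s, hs, -⟩ := exists_mem_impose (hi r List.mem_cons_self) hX hT
    have h1 : 0 < (impose H i r).length := List.length_pos_of_mem hs
    have h2 := ih (fun r hr => hi r (List.mem_cons_of_mem _ hr))
      (fun r hr => hf r (List.mem_cons_of_mem _ hr))
    simp only [List.length_cons, List.flatMap_cons, List.length_append]
    omega

theorem feasible_flatMap_impose {H : Fin h → Finset (Fin w)} {i : Fin h}
    {rows : List (Row w)} (hf : ∀ r ∈ rows, Feasible H r) :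
    ∀ r ∈ rows.flatMap (impose H i), Feasible H r := by
  intro s hs
  obtain ⟨r, hr, hs⟩ := List.mem_flatMap.1 hs
  exact feasible_of_mem_impose (hf r hr) hs

/-- No row gets lost: imposing constraints does not make the number of rows smaller. -/
theorem length_le_length_imposeAll {H : Fin h → Finset (Fin w)} :
    ∀ (l : List (Fin h)) (rows : List (Row w)), Pending l rows →
      (∀ r ∈ rows, Feasible H r) → rows.length ≤ (imposeAll H l rows).length
  | [], _, _, _ => le_rfl
  | _ :: l, _, hp, hf => (length_le_length_flatMap_impose hp.head hf).trans
      (length_le_length_imposeAll l _ hp.flatMap (feasible_flatMap_impose hf))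

theorem pending_init : Pending (List.finRange h) [fun _ : Fin w => Symb.two] :=
  ⟨List.pairwise_lt_finRange h, by simp [WildcardsLT]⟩

theorem eRows_eq (H : Fin h → Finset (Fin w)) :
    eRows H = imposeAll H (List.finRange h) [fun _ => Symb.two] := rfl

theorem exists_mem_eRows_iff {H : Fin h → Finset (Fin w)} {X : Finset (Fin w)} :
    (∃ r ∈ eRows H, X ∈ r.members) ↔ IsTransversal H X := by
  constructor
  · exact fun hX i => (of_mem_imposeAll _ _ pending_init hX).2 i (List.mem_finRange i)
  · exact fun hT => exists_mem_imposeAll hT _ _ pending_init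
      ⟨_, List.mem_singleton_self _, by simp [mem_members]⟩

theorem pairwise_eRows (H : Fin h → Finset (Fin w)) :
    (eRows H).Pairwise fun s t => Disjoint s.members t.members :=
  pairwise_imposeAll _ _ pending_init (List.pairwise_singleton _ _)

theorem wildcardsLT_of_mem_eRows {H : Fin h → Finset (Fin w)} :
    ∀ r ∈ eRows H, r.WildcardsLT h :=
  wildcardsLT_of_mem_imposeAll _ _ pending_init (by simp [WildcardsLT])

/-! ### Face numbers and transversal numbers -/

/-- Every face lies in a facet because there are only finitely many sets, so `X` is a face if and
only if `X ⊆ F i` for some `i`, that is, if and only if `X` misses some `H i`. -/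
theorem isTransversal_iff_not_mem {S : LowerSet (Finset (Fin w))} {F H : Fin h → Finset (Fin w)}
    (hF : IsFacetList S F) (hH : ∀ i, H i = Finset.univ \ F i) (X : Finset (Fin w)) :
    IsTransversal H X ↔ X ∉ S := by
  have key : X ∈ S ↔ ∃ i, X ⊆ F i := by
    constructor
    · intro hX
      obtain ⟨Y, hXY, hY⟩ := Set.Finite.exists_le_maximal (s := {Y | Y ∈ S})
        (Set.toFinite _) hX
      obtain ⟨i, rfl⟩ := (hF.2 Y).2 hY
      exact ⟨i, hXY⟩
    · rintro ⟨i, hi⟩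
      exact S.lower hi ((hF.2 (F i)).1 ⟨i, rfl⟩).1
  rw [key, not_exists]
  refine forall_congr' fun i => ?_
  rw [hH, Finset.not_subset]
  simp [Finset.Nonempty]

theorem transversalNumber_eq_sum (H : Fin h → Finset (Fin w)) (k : ℕ) :
    transversalNumber H k = ((eRows H).map fun r => r.cardOf k).sum := by
  classical
  have key : ∀ rows : List (Row w), (rows.Pairwise fun s t => Disjoint s.members t.members) →
      {X : Finset (Fin w) | (∃ r ∈ rows, X ∈ r.members) ∧ X.card = k}.ncard =
        (rows.map fun r => r.cardOf k).sum := by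
    intro rows
    induction rows with
    | nil => simp
    | cons r rows ih =>
      intro hp
      rw [List.pairwise_cons] at hp
      rw [List.map_cons, List.sum_cons, ← ih hp.2, Row.cardOf,
        ← Set.ncard_union_eq ?_ (Set.toFinite _) (Set.toFinite _)]
      · congr 1
        ext X
        simp only [List.mem_cons, exists_eq_or_imp, Set.mem_ofPred_eq, Set.mem_union]
        tauto
      · rw [Set.disjoint_left]
        rintro X ⟨hX, -⟩ ⟨⟨s, hs, hXs⟩, -⟩
        exact Set.disjoint_left.1 (hp.1 s hs) hX hXs
  rw [← key _ (pairwise_eRows H), transversalNumber]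
  simp only [exists_mem_eRows_iff]

theorem faceNumber_add_transversalNumber {S : LowerSet (Finset (Fin w))}
    {H : Fin h → Finset (Fin w)} (hS : ∀ X, IsTransversal H X ↔ X ∉ S) (k : ℕ) :
    faceNumber S k + transversalNumber H k = w.choose k := by
  classical
  have h1 : ((Finset.univ : Finset (Fin w)).powersetCard k).card = w.choose k := by simp
  rw [← h1, ← Set.ncard_coe_finset, faceNumber, transversalNumber,
    ← Set.ncard_union_eq ?_ (Set.toFinite _) (Set.toFinite _)]
  · congr 1
    ext X
    simp only [hS, Set.mem_union, Set.mem_ofPred_eq, Finset.mem_coe,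
      Finset.mem_powersetCard_univ]
    tauto
  · rw [Set.disjoint_left]
    rintro X ⟨hX, -⟩ ⟨hX', -⟩
    exact (hS X).1 hX' hX

end

namespace Lisp

theorem Val.head_cons (a b : Val) : (Val.cons a b).head = a := rfl

theorem Val.tail_cons (a b : Val) : (Val.cons a b).tail = b := rfl

/-! ### A point-free language with a verified cost semantics

A `Code` denotes a total function on values. Its only form of iteration is recursion along the
spine of a list, with a state that is passed downwards. -/

inductive Code where
  | id
  | nil
  | cons (a b : Code)
  | head (a : Code)
  | tail (a : Code)
  | ite (c a b : Code)
  | comp (g f : Code)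
  | recur (base pre post : Code)

/-- Recursion along a list: the state `s` becomes `pre (a, s)` for the tail, and the result `r`
of the tail becomes `post (a, (s, r))`. -/
def recVal (base pre post : Val → Val) : Val → Val → Val
  | .nil, s => base s
  | .cons a l, s => post (.cons a (.cons s (recVal base pre post l (pre (.cons a s)))))

/-- The number of steps of `recVal`, from the number of steps of its parts. -/
def recCost (base pre post : Val → Val) (cb cp cq : Val → ℕ) : Val → Val → ℕ
  | .nil, s => cb s + 6
  | .cons a l, s => cp (.cons a s) + recCost base pre post cb cp cq l (pre (.cons a s)) +
      cq (.cons a (.cons s (recVal base pre post l (pre (.cons a s))))) + 26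

namespace Code

/-- The function denoted by a code. -/
def sem : Code → Val → Val
  | id, v => v
  | nil, _ => .nil
  | cons a b, v => .cons (a.sem v) (b.sem v)
  | head a, v => (a.sem v).head
  | tail a, v => (a.sem v).tail
  | ite c a b, v => match c.sem v with
    | .nil => b.sem v
    | .cons _ _ => a.sem v
  | comp g f, v => g.sem (f.sem v)
  | recur b p q, v => recVal b.sem p.sem q.sem v.head v.tail

/-- The number of steps that the compiled code takes. -/
def cost : Code → Val → ℕ
  | id, _ => 1
  | nil, _ => 1
  | cons a b, v => a.cost v + b.cost v + 1
  | head a, v => a.cost v + 1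
  | tail a, v => a.cost v + 1
  | ite c a b, v => c.cost v + (match c.sem v with
    | .nil => b.cost v
    | .cons _ _ => a.cost v) + 1
  | comp g f, v => f.cost v + g.cost (f.sem v) + 1
  | recur b p q, v => recCost b.sem p.sem q.sem b.cost p.cost q.cost v.head v.tail + 2

/-- The body of the function with index `f` for a recursion, from the compiled parts. -/
def recBody (f : ℕ) (b p q : Expr) : Expr :=
  .ite (.head (.var 0))
    (.bind (.cons (.head (.head (.var 0))) (.tail (.var 0)))
      (.bind p
        (.bind (.call f (.cons (.tail (.head (.var 2))) (.var 0)))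
          (.bind (.cons (.head (.var 2)) (.cons (.tail (.var 2)) (.var 0))) q))))
    (.bind (.tail (.var 0)) b)

/-- The compiler: the expression for a code (which refers to its input as `var 0`) and the
functions it calls, when these are placed at index `n` of the program. -/
def compile : Code → ℕ → Expr × List Expr
  | id, _ => (.var 0, [])
  | nil, _ => (.nil, [])
  | cons a b, n =>
    let x := a.compile n
    let y := b.compile (n + x.2.length)
    (.cons x.1 y.1, x.2 ++ y.2)
  | head a, n => (.head (a.compile n).1, (a.compile n).2)
  | tail a, n => (.tail (a.compile n).1, (a.compile n).2)
  | ite c a b, n =>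
    let z := c.compile n
    let x := a.compile (n + z.2.length)
    let y := b.compile (n + z.2.length + x.2.length)
    (.ite z.1 x.1 y.1, z.2 ++ (x.2 ++ y.2))
  | comp g f, n =>
    let x := f.compile n
    let y := g.compile (n + x.2.length)
    (.bind x.1 y.1, x.2 ++ y.2)
  | recur b p q, n =>
    let z := b.compile (n + 1)
    let x := p.compile (n + 1 + z.2.length)
    let y := q.compile (n + 1 + z.2.length + x.2.length)
    (.call n (.var 0), recBody n z.1 x.1 y.1 :: (z.2 ++ (x.2 ++ y.2)))

/-- The functions `l` stand in the program from index `n` on. -/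
def PlacedAt (P : Program) (n : ℕ) (l : List Expr) : Prop :=
  ∀ i b, l[i]? = some b → P[n + i]? = some b

theorem PlacedAt.left {P : Program} {n : ℕ} {l m : List Expr} (h : PlacedAt P n (l ++ m)) :
    PlacedAt P n l := fun i b hb => h i b (by
  rw [List.getElem?_append_left (List.getElem?_eq_some_iff.1 hb).1, hb])

theorem PlacedAt.right {P : Program} {n : ℕ} {l m : List Expr} (h : PlacedAt P n (l ++ m)) :
    PlacedAt P (n + l.length) m := fun i b hb => by
  rw [Nat.add_assoc]
  exact h _ b (by rw [List.getElem?_append_right (by omega), Nat.add_sub_cancel_left, hb])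

theorem PlacedAt.tail {P : Program} {n : ℕ} {a : Expr} {l : List Expr}
    (h : PlacedAt P n (a :: l)) : PlacedAt P (n + 1) l := fun i b hb => by
  rw [Nat.add_assoc, Nat.add_comm 1]
  exact h _ b (by simpa using hb)

theorem eval_of_eq {P : Program} {env : List Val} {e : Expr} {v v' : Val} {t t' : ℕ}
    (h : Eval P env e v t) (hv : v = v') (ht : t = t') : Eval P env e v' t' := by
  subst hv ht; exact h

/-- The compiled code computes the function denoted by the code in the announced time. -/
theorem eval_compile (P : Program) (c : Code) : ∀ (n : ℕ) (v : Val) (ρ : List Val),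
    PlacedAt P n (c.compile n).2 → Eval P (v :: ρ) (c.compile n).1 (c.sem v) (c.cost v) := by
  induction c with
  | id => intro n v ρ _; exact .var rfl
  | nil => intro n v ρ _; exact .nil
  | cons a b iha ihb => intro n v ρ h; exact .cons (iha _ _ _ h.left) (ihb _ _ _ h.right)
  | head a ih => intro n v ρ h; exact .head (ih _ _ _ h)
  | tail a ih => intro n v ρ h; exact .tail (ih _ _ _ h)
  | ite c a b ihc iha ihb =>
    intro n v ρ h
    have hc := ihc _ v ρ h.left
    have ha := iha _ v ρ h.right.left
    have hb := ihb _ v ρ h.right.right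
    simp only [sem, cost]
    cases hv : c.sem v with
    | nil => rw [hv] at hc; exact .ite_nil hc hb
    | cons x y => rw [hv] at hc; exact .ite_cons hc ha
  | comp g f ihg ihf =>
    intro n v ρ h; exact .bind (ihf _ _ _ h.left) (ihg _ _ _ h.right)
  | recur b p q ihb ihp ihq =>
    intro n v ρ h
    have hb := fun v ρ => ihb _ v ρ h.tail.left
    have hp := fun v ρ => ihp _ v ρ h.tail.right.left
    have hq := fun v ρ => ihq _ v ρ h.tail.right.right
    -- The argument `v` is left arbitrary, with only its components prescribed: the outermost call
    -- receives the input itself, which may be `nil` instead of a cell.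
    have key : ∀ l s, ∀ v : Val, v.head = l → v.tail = s →
        Eval P [v] (recBody n (b.compile (n + 1)).1
          (p.compile (n + 1 + (b.compile (n + 1)).2.length)).1
          (q.compile (n + 1 + (b.compile (n + 1)).2.length +
            (p.compile (n + 1 + (b.compile (n + 1)).2.length)).2.length)).1)
          (recVal b.sem p.sem q.sem l s)
          (recCost b.sem p.sem q.sem b.cost p.cost q.cost l s) := by
      intro l
      induction l with
      | nil =>
        intro s v hl hs
        subst hs
        have e1 : Eval P [v] (.head (.var 0)) .nil 2 := hl ▸ .head (.var rfl)
        exact eval_of_eq (.ite_nil e1 (.bind (.tail (.var rfl)) (hb _ _))) rfl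
          (by simp only [recCost]; omega)
      | cons a l _ ih =>
        intro s v hl hs
        subst hs
        have e1 : Eval P [v] (.head (.var 0)) (.cons a l) 2 := hl ▸ .head (.var rfl)
        have e2 : Eval P [v] (.cons (.head (.head (.var 0))) (.tail (.var 0)))
            (.cons a v.tail) 6 :=
          .cons (x := a) (.head (x := .cons a l) e1) (.tail (.var rfl))
        have e3 : ∀ ρ x y, Eval P (x :: y :: v :: ρ)
            (.cons (.tail (.head (.var 2))) (.var 0)) (.cons l x) 5 := fun ρ x y =>
          .cons (x := l) (.tail (x := .cons a l)
            (hl ▸ (.head (.var rfl) : Eval P (x :: y :: v :: ρ) (.head (.var 2)) v.head 2)))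
            (.var rfl)
        have e4 := ih (p.sem (.cons a v.tail)) (.cons l (p.sem (.cons a v.tail))) rfl rfl
        refine eval_of_eq (.ite_cons e1 (.bind e2 (.bind (hp _ _)
          (.bind (.call (h 0 _ rfl) (e3 _ _ _) e4)
            (.bind (.cons (.head (.var rfl)) (.cons (.tail (.var rfl)) (.var rfl)))
              (hq _ _)))))) rfl ?_
        -- The 26 steps of glue in `recBody`: 2, 6, 5 and 7 for the test, the argument of `p`, the
        -- argument of the call and the argument of `q`, plus one each for the test, the four
        -- bindings and the call.
        simp only [recCost, Val.head, Val.tail]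
        omega
    exact eval_of_eq (.call (h 0 _ rfl) (.var rfl) (key _ _ v rfl rfl)) rfl
      (by simp only [cost]; omega)

/-- The program for a code. -/
def program (c : Code) : Program := (c.compile 1).1 :: (c.compile 1).2

theorem computes_program (c : Code) (v : Val) :
    Computes c.program v (c.sem v) (c.cost v + 2) := by
  have h : PlacedAt c.program 1 (c.compile 1).2 := fun i b hb => by
    rw [Nat.add_comm]; simpa [program] using hb
  refine eval_of_eq (.call (P := c.program) (body := (c.compile 1).1) rfl (.var rfl)
    (eval_compile _ c 1 v [] h)) rfl (by omega)

/-! ### Equations for recursions, and bounds for their cost -/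

theorem recur_nil (b p q : Code) (s : Val) :
    (recur b p q).sem (.cons .nil s) = b.sem s := rfl

theorem recur_cons (b p q : Code) (a l s : Val) : (recur b p q).sem (.cons (.cons a l) s) =
    q.sem (.cons a (.cons s ((recur b p q).sem (.cons l (p.sem (.cons a s)))))) := rfl

theorem cost_recur_nil (b p q : Code) (s : Val) :
    (recur b p q).cost (.cons .nil s) = b.cost s + 8 := rfl

theorem cost_recur_cons (b p q : Code) (a l s : Val) :
    (recur b p q).cost (.cons (.cons a l) s) = p.cost (.cons a s) +
      (recur b p q).cost (.cons l (p.sem (.cons a s))) +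
      q.cost (.cons a (.cons s ((recur b p q).sem (.cons l (p.sem (.cons a s)))))) + 26 := by
  simp only [cost, Val.head, Val.tail, recCost, sem]; omega

/-- The cost of a recursion, for an invariant `I` of the state and bounds for the steps. -/
theorem cost_recur_le_sum {α : Type*} (enc : α → Val) {b p q : Code} (I : List α → Val → Prop)
    (D : ℕ) (B : α → ℕ) (hb : ∀ s, I [] s → b.cost s ≤ D)
    (hs : ∀ a l s, I (a :: l) s → I l (p.sem (.cons (enc a) s)) ∧
      p.cost (.cons (enc a) s) + q.cost (.cons (enc a) (.cons s
        ((recur b p q).sem (.cons (encList enc l) (p.sem (.cons (enc a) s)))))) ≤ B a) :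
    ∀ l s, I l s → (recur b p q).cost (.cons (encList enc l) s) ≤
      D + 8 + (l.map fun a => B a + 26).sum := by
  intro l
  induction l with
  | nil => intro s h; simpa [encList, cost_recur_nil] using hb s h
  | cons a l ih =>
    intro s h
    have h1 := hs a l s h
    have h2 := ih _ h1.1
    simp only [encList, cost_recur_cons, List.map_cons, List.sum_cons]
    omega

theorem cost_recur_le {α : Type*} (enc : α → Val) {b p q : Code} (I : List α → Val → Prop)
    (D B : ℕ) (hb : ∀ s, I [] s → b.cost s ≤ D)
    (hs : ∀ a l s, I (a :: l) s → I l (p.sem (.cons (enc a) s)) ∧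
      p.cost (.cons (enc a) s) + q.cost (.cons (enc a) (.cons s
        ((recur b p q).sem (.cons (encList enc l) (p.sem (.cons (enc a) s)))))) ≤ B)
    (l : List α) (s : Val) (h : I l s) :
    (recur b p q).cost (.cons (encList enc l) s) ≤ D + 8 + l.length * (B + 26) := by
  simpa using cost_recur_le_sum enc I D (fun _ => B) hb hs l s h

/-- No recursion occurs in the code. -/
def flat : Code → Bool
  | id | nil => true
  | cons a b => a.flat && b.flat
  | head a | tail a => a.flat
  | ite c a b => c.flat && (a.flat && b.flat)
  | comp g f => g.flat && f.flat
  | recur _ _ _ => false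

/-- The number of nodes of the code. -/
def nodes : Code → ℕ
  | id | nil => 1
  | cons a b => a.nodes + b.nodes + 1
  | head a | tail a => a.nodes + 1
  | ite c a b => c.nodes + (a.nodes + b.nodes) + 1
  | comp g f => f.nodes + g.nodes + 1
  | recur b p q => b.nodes + p.nodes + q.nodes + 1

/-- Without recursion each node of the code is evaluated at most once, whatever the input. -/
theorem cost_le_nodes (c : Code) (hc : c.flat = true) : ∀ v, c.cost v ≤ c.nodes := by
  induction c with
  | id => intro v; exact le_rfl
  | nil => intro v; exact le_rfl
  | cons a b iha ihb =>
    intro v; simp only [flat, Bool.and_eq_true] at hc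
    have := iha hc.1 v; have := ihb hc.2 v; simp only [cost, nodes]; omega
  | head a ih => intro v; have := ih hc v; simp only [cost, nodes]; omega
  | tail a ih => intro v; have := ih hc v; simp only [cost, nodes]; omega
  | ite c a b ihc iha ihb =>
    intro v; simp only [flat, Bool.and_eq_true] at hc
    have := ihc hc.1 v; have := iha hc.2.1 v; have := ihb hc.2.2 v
    simp only [cost, nodes]
    split <;> omega
  | comp g f ihg ihf =>
    intro v; simp only [flat, Bool.and_eq_true] at hc
    have := ihg hc.1 (f.sem v); have := ihf hc.2 v; simp only [cost, nodes]; omega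
  | recur => simp [flat] at hc

end Code

end Lisp

/-! ### Binary digits of encoded numbers -/

namespace Lisp

theorem encList_map {α β : Type*} (enc : β → Val) (f : α → β) (l : List α) :
    encList enc (l.map f) = encList (fun a => enc (f a)) l := by
  induction l with
  | nil => rfl
  | cons a l ih => simp [encList, ih]

theorem encNat_zero : encNat 0 = .nil := by simp [encNat, encList]

theorem encNat_of_ne_zero {n : ℕ} (hn : n ≠ 0) :
    encNat n = .cons (encBool n.bodd) (encNat n.div2) := by
  conv_lhs => rw [← Nat.bit_bodd_div2 n]
  rw [encNat, Nat.bits_append_bit]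
  · rfl
  · intro h0
    by_contra hb
    apply hn
    rw [← Nat.bit_bodd_div2 n, h0]
    simp at hb
    simp [hb]

theorem head_encNat (n : ℕ) : (encNat n).head = encBool n.bodd := by
  by_cases hn : n = 0
  · subst hn; simp [encNat, encList, Val.head, encBool]
  · rw [encNat_of_ne_zero hn]; rfl

theorem tail_encNat (n : ℕ) : (encNat n).tail = encNat n.div2 := by
  by_cases hn : n = 0
  · subst hn; simp [encNat, encList, Val.tail]
  · rw [encNat_of_ne_zero hn]; rfl

theorem eq_bodd_add_two_mul_div2 (n : ℕ) : n = n.bodd.toNat + 2 * n.div2 :=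
  (Nat.bodd_add_div2 n).symm

/-- Induction along the binary digits. -/
theorem binary_induction {motive : ℕ → Prop} (zero : motive 0)
    (step : ∀ n, n ≠ 0 → motive n.div2 → motive n) (n : ℕ) : motive n := by
  induction n using Nat.strong_induction_on with
  | _ n ih =>
    by_cases hn : n = 0
    · exact hn ▸ zero
    · refine step n hn (ih _ ?_)
      have := eq_bodd_add_two_mul_div2 n
      omega

namespace Code

/-- For a recursion with nonrecursive parts, the cost of one round is bounded by a numeral, which
`decide` verifies from the node count. -/
theorem cost_add_cost_le (p : Code) (hp : p.flat = true) (q : Code) (hq : q.flat = true) {B : ℕ}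
    (hB : p.nodes + q.nodes ≤ B) (v v' : Val) : p.cost v + q.cost v' ≤ B :=
  (Nat.add_le_add (cost_le_nodes p hp v) (cost_le_nodes q hq v')).trans hB

/-! ### Conditions and arithmetic, bit by bit -/

/-- The constant `true`. -/
def tt : Code := cons nil nil

def not (a : Code) : Code := ite a nil tt

def and (a b : Code) : Code := ite a b nil

def or (a b : Code) : Code := ite a tt b

def xor (a b : Code) : Code := ite a (not b) b

/-- The carry of a full adder and, with the first argument negated, the borrow of a full subtracter.
-/
def maj (a b c : Code) : Code := ite a (or b c) (and b c)

/-- The number with lowest bit `b` and higher part `n`. -/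
def bit (b n : Code) : Code := ite b (cons tt n) (ite n (cons nil n) nil)

theorem sem_tt (v : Val) : tt.sem v = encBool true := rfl

section bool

variable {a b c : Code} {v : Val} {x y z : Bool}

theorem sem_ite (ha : a.sem v = encBool x) :
    (ite a b c).sem v = if x then b.sem v else c.sem v := by
  cases x <;> simp [sem, ha, encBool]

theorem cost_ite (ha : a.sem v = encBool x) :
    (ite a b c).cost v = a.cost v + (if x then b.cost v else c.cost v) + 1 := by
  cases x <;> simp [cost, ha, encBool]

theorem sem_not (ha : a.sem v = encBool x) : (not a).sem v = encBool (!x) := by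
  cases x <;> simp [not, sem, ha, encBool, tt]

theorem sem_and (ha : a.sem v = encBool x) (hb : b.sem v = encBool y) :
    (and a b).sem v = encBool (x && y) := by
  cases x <;> simp [and, sem, ha, encBool, hb]

theorem sem_or (ha : a.sem v = encBool x) (hb : b.sem v = encBool y) :
    (or a b).sem v = encBool (x || y) := by
  cases x <;> simp [or, sem, ha, encBool, hb, tt]

theorem sem_xor (ha : a.sem v = encBool x) (hb : b.sem v = encBool y) :
    (xor a b).sem v = encBool (x ^^ y) := by
  cases x <;> cases y <;> simp [xor, sem, ha, encBool, hb, tt, not]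

theorem sem_maj (ha : a.sem v = encBool x) (hb : b.sem v = encBool y)
    (hc : c.sem v = encBool z) :
    (maj a b c).sem v = encBool (if x then y || z else y && z) := by
  cases x <;> cases y <;> cases z <;> simp [maj, sem, ha, encBool, hb, hc, tt, or, and]

/-- Encoded numbers have no leading zeros, so a lowest bit `0` over the higher part `0` must produce
`nil`; this is why `bit` tests `n` in that case. -/
theorem sem_bit {n : ℕ} (ha : a.sem v = encBool x) (hb : b.sem v = encNat n) :
    (bit a b).sem v = encNat (x.toNat + 2 * n) := by
  cases x
  · rcases eq_or_ne n 0 with rfl | hn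
    · simp [bit, sem, ha, hb, encBool, encNat_zero]
    · rw [encNat_of_ne_zero (n := false.toNat + 2 * n) (by simp; omega)]
      have h := encNat_of_ne_zero hn
      simp [bit, sem, ha, hb, encBool, Nat.div2_val]
      rw [h]
  · rw [encNat_of_ne_zero (n := true.toNat + 2 * n) (by simp)]
    simp [bit, sem, ha, hb, encBool, Nat.div2_val, tt]
    congr 1; try omega

end bool

/-- `(y, c) ↦ y + c` for a carry bit `c`. -/
def succ : Code :=
  recur (ite id (cons tt nil) nil) (and (head id) (tail id))
    (bit (xor (head id) (head (tail id))) (tail (tail id)))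

theorem sem_succ (y : ℕ) : ∀ c : Bool,
    succ.sem (.cons (encNat y) (encBool c)) = encNat (y + c.toNat) := by
  induction y using binary_induction with
  | zero =>
    intro c
    rw [encNat_zero, succ, recur_nil]
    cases c
    · simp [sem, encBool, encNat_zero]
    · rw [encNat_of_ne_zero (by simp)]
      simp [sem, encBool, tt, encNat_zero]
  | step n hn ih =>
    intro c
    rw [encNat_of_ne_zero hn, succ, recur_cons,
      sem_and (x := n.bodd) (y := c) rfl rfl, ← succ, ih]
    rw [sem_bit (sem_xor (x := n.bodd) (y := c) rfl rfl) rfl]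
    congr 1
    have := eq_bodd_add_two_mul_div2 n
    rcases h : n.bodd <;> cases c <;> simp [h] at this ⊢ <;> omega

theorem cost_succ : ∃ C, ∀ (y : ℕ) (s : Val),
    succ.cost (.cons (encNat y) s) ≤ C * (y.size + 1) := by
  refine ⟨100, fun y s => ?_⟩
  refine (cost_recur_le encBool (fun _ _ => True) 10 50 (fun s _ => ?_) (fun a l s _ =>
    ⟨trivial, ?_⟩) y.bits s trivial).trans ?_
  · exact (cost_le_nodes _ rfl _).trans (by decide)
  · exact cost_add_cost_le _ rfl _ rfl (by decide) _ _
  · rw [Nat.size_eq_bits_len]; omega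

/-- `(x, (y, c)) ↦ x + y + c` for a carry bit `c`. -/
def add : Code :=
  recur succ
    (cons (tail (head (tail id))) (maj (head id) (head (head (tail id))) (tail (tail id))))
    (bit (xor (head id) (xor (head (head (head (tail id)))) (tail (head (tail id)))))
      (tail (tail id)))

/-- The recursion runs over the digits of `x`. Missing digits of a shorter `y` read as `nil`, which
is the bit `0`; when `x` is exhausted, `succ` adds the pending carry to the rest of `y`. -/
theorem sem_add (x : ℕ) : ∀ (y : ℕ) (c : Bool),
    add.sem (.cons (encNat x) (.cons (encNat y) (encBool c))) = encNat (x + y + c.toNat) := by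
  induction x using binary_induction with
  | zero =>
    intro y c
    rw [encNat_zero, add, recur_nil, sem_succ, Nat.zero_add]
  | step n hn ih =>
    intro y c
    have h1 : ∀ a : Val, (cons (tail (head (tail id))) (maj (head id)
        (head (head (tail id))) (tail (tail id)))).sem
        (.cons (encBool n.bodd) (.cons (encNat y) (encBool c))) =
        .cons (encNat y.div2) (encBool (if n.bodd then y.bodd || c else y.bodd && c)) := by
      intro _
      rw [← sem_maj (v := .cons (encBool n.bodd) (.cons (encNat y) (encBool c)))
        (a := head id) (b := head (head (tail id))) (c := tail (tail id)) rfl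
        (head_encNat y) rfl, ← tail_encNat]
      rfl
    have h2 : ∀ r : Val, (xor (head id) (xor (head (head (head (tail id))))
        (tail (head (tail id))))).sem (.cons (encBool n.bodd)
          (.cons (.cons (encNat y) (encBool c)) r)) = encBool (n.bodd ^^ (y.bodd ^^ c)) :=
      fun r => sem_xor rfl (sem_xor (head_encNat y) rfl)
    rw [encNat_of_ne_zero hn, add, recur_cons, h1 .nil, ← add, ih, sem_bit (h2 _) rfl]
    congr 1
    have e1 := eq_bodd_add_two_mul_div2 n
    have e2 := eq_bodd_add_two_mul_div2 y
    rcases h : n.bodd <;> rcases h' : y.bodd <;> cases c <;> simp [h, h'] at e1 e2 ⊢ <;> omega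

theorem cost_add : ∃ C, ∀ (x y : ℕ) (c : Val),
    add.cost (.cons (encNat x) (.cons (encNat y) c)) ≤ C * (x.size + y.size + 1) := by
  obtain ⟨C, hC⟩ := cost_succ
  refine ⟨C + 200, fun x y c => ?_⟩
  refine (cost_recur_le encBool (fun _ s => ∃ z c, s = .cons (encNat z) c ∧ z.size ≤ y.size)
    (C * (y.size + 1)) 150 ?_ ?_ x.bits _ ⟨y, c, rfl, le_rfl⟩).trans ?_
  · rintro s ⟨z, c, rfl, hz⟩
    exact (hC z c).trans (Nat.mul_le_mul_left _ (by omega))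
  · rintro a l s ⟨z, c, rfl, hz⟩
    refine ⟨⟨z.div2, _, congrArg (Val.cons · _) (tail_encNat z), le_trans ?_ hz⟩, ?_⟩
    · exact Nat.size_le_size (by rw [Nat.div2_val]; omega)
    · exact cost_add_cost_le _ rfl _ rfl (by decide) _ _
  · rw [Nat.size_eq_bits_len x]; nlinarith

/-- `(x, (y, c)) ↦ x - y - c` for a borrow bit `c`. -/
def sub : Code :=
  recur nil
    (cons (tail (head (tail id))) (maj (not (head id)) (head (head (tail id))) (tail (tail id))))
    (bit (xor (head id) (xor (head (head (head (tail id)))) (tail (head (tail id)))))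
      (tail (tail id)))

/-- The recursion may stop with `x`: the hypothesis passes to the higher digits together with the
borrow, and at `x = 0` it leaves neither digits of `y` nor a borrow. -/
theorem sem_sub (x : ℕ) : ∀ (y : ℕ) (c : Bool), y + c.toNat ≤ x →
    sub.sem (.cons (encNat x) (.cons (encNat y) (encBool c))) = encNat (x - y - c.toNat) := by
  induction x using binary_induction with
  | zero =>
    intro y c h
    rw [encNat_zero, sub, recur_nil, Nat.zero_sub, Nat.zero_sub, encNat_zero]
    rfl
  | step n hn ih =>
    intro y c h
    have h1 : ∀ a : Val, (cons (tail (head (tail id))) (maj (not (head id))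
        (head (head (tail id))) (tail (tail id)))).sem
        (.cons (encBool n.bodd) (.cons (encNat y) (encBool c))) =
        .cons (encNat y.div2) (encBool (if !n.bodd then y.bodd || c else y.bodd && c)) := by
      intro _
      rw [← sem_maj (v := .cons (encBool n.bodd) (.cons (encNat y) (encBool c)))
        (a := not (head id)) (b := head (head (tail id))) (c := tail (tail id)) (sem_not rfl)
        (head_encNat y) rfl, ← tail_encNat]
      rfl
    have h2 : ∀ r : Val, (xor (head id) (xor (head (head (head (tail id))))
        (tail (head (tail id))))).sem (.cons (encBool n.bodd)
          (.cons (.cons (encNat y) (encBool c)) r)) = encBool (n.bodd ^^ (y.bodd ^^ c)) :=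
      fun r => sem_xor rfl (sem_xor (head_encNat y) rfl)
    have e1 := eq_bodd_add_two_mul_div2 n
    have e2 := eq_bodd_add_two_mul_div2 y
    rw [encNat_of_ne_zero hn, sub, recur_cons, h1 .nil, ← sub, ih, sem_bit (h2 _) rfl]
    · congr 1
      rcases hb : n.bodd <;> rcases hb' : y.bodd <;> cases c <;> simp [hb, hb'] at e1 e2 h ⊢ <;> omega
    · rcases hb : n.bodd <;> rcases hb' : y.bodd <;> cases c <;> simp [hb, hb'] at e1 e2 h ⊢ <;> omega

theorem cost_sub : ∃ C, ∀ (x : ℕ) (s : Val),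
    sub.cost (.cons (encNat x) s) ≤ C * (x.size + 1) := by
  refine ⟨200, fun x s => ?_⟩
  refine (cost_recur_le encBool (fun _ _ => True) 5 150 (fun s _ => ?_) (fun a l s _ =>
    ⟨trivial, ?_⟩) x.bits s trivial).trans ?_
  · exact (cost_le_nodes _ rfl _).trans (by decide)
  · exact cost_add_cost_le _ rfl _ rfl (by decide) _ _
  · rw [Nat.size_eq_bits_len]; omega

/-- The results of comparing two numbers. -/
def encOrdering : Ordering → Val
  | .eq => .nil
  | .lt => .cons .nil .nil
  | .gt => .cons .nil (.cons .nil .nil)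

/-- `(x, y) ↦ compare x y`. -/
def cmp : Code :=
  recur (ite id tt nil) (tail (tail id))
    (ite (tail (tail id)) (tail (tail id))
      (ite (head id) (ite (head (head (tail id))) nil (cons nil tt))
        (ite (head (head (tail id))) tt nil)))

/-- The comparison of the higher digits comes back first and decides; only when they are equal do
the lowest bits matter. -/
theorem sem_cmp (x : ℕ) : ∀ y : ℕ,
    cmp.sem (.cons (encNat x) (encNat y)) = encOrdering (compare x y) := by
  induction x using binary_induction with
  | zero =>
    intro y
    rw [encNat_zero, cmp, recur_nil]
    rcases eq_or_ne y 0 with rfl | hy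
    · rw [encNat_zero]; rfl
    · rw [encNat_of_ne_zero hy, compare_lt_iff_lt.2 (Nat.pos_of_ne_zero hy)]; rfl
  | step n hn ih =>
    intro y
    have e1 := eq_bodd_add_two_mul_div2 n
    have e2 := eq_bodd_add_two_mul_div2 y
    have h1 : (tail (tail id)).sem (.cons (encBool n.bodd) (encNat y)) = encNat y.div2 :=
      tail_encNat y
    rw [encNat_of_ne_zero hn, cmp, recur_cons, h1, ← cmp, ih]
    rcases lt_trichotomy n.div2 y.div2 with h | h | h
    · rw [compare_lt_iff_lt.2 h, compare_lt_iff_lt.2]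
      · rfl
      · have := Bool.toNat_le n.bodd; omega
    · rw [compare_eq_iff_eq.2 h]
      simp only [sem, Val.head_cons, Val.tail_cons, encOrdering, head_encNat]
      rcases h1 : n.bodd <;> rcases h2 : y.bodd <;> simp [h1, h2] at e1 e2
      · rw [compare_eq_iff_eq.2 (by omega)]; rfl
      · rw [compare_lt_iff_lt.2 (by omega)]; rfl
      · rw [compare_gt_iff_gt.2 (by omega)]; rfl
      · rw [compare_eq_iff_eq.2 (by omega)]; rfl
    · rw [compare_gt_iff_gt.2 h, compare_gt_iff_gt.2]
      · rfl
      · have := Bool.toNat_le y.bodd; omega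

theorem cost_cmp : ∃ C, ∀ (x : ℕ) (s : Val),
    cmp.cost (.cons (encNat x) s) ≤ C * (x.size + 1) := by
  refine ⟨200, fun x s => ?_⟩
  refine (cost_recur_le encBool (fun _ _ => True) 10 150 (fun s _ => ?_) (fun a l s _ =>
    ⟨trivial, ?_⟩) x.bits s trivial).trans ?_
  · exact (cost_le_nodes _ rfl _).trans (by decide)
  · exact cost_add_cost_le _ rfl _ rfl (by decide) _ _
  · rw [Nat.size_eq_bits_len]; omega

end Code

end Lisp

namespace Lisp

/-! ### Codes for rows -/

section encodings

variable {w h : ℕ}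

/-- The symbols of a row at the positions in a list. -/
def rowOn (r : Row w) (L : List (Fin w)) : Val := encList (fun p => encSymb (r p)) L

/-- The incidence bits of a set at the positions in a list. -/
def setOn (F : Finset (Fin w)) (L : List (Fin w)) : Val :=
  encList (fun p => encBool (decide (p ∈ F))) L

theorem encRow_eq (r : Row w) : encRow r = rowOn r (List.finRange w) := by
  rw [encRow, List.ofFn_eq_map, encList_map]; rfl

theorem encSet_eq (F : Finset (Fin w)) : encSet F = setOn F (List.finRange w) := by
  rw [encSet, List.ofFn_eq_map, encList_map]; rfl

theorem rowOn_cons (r : Row w) (p : Fin w) (L : List (Fin w)) :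
    rowOn r (p :: L) = .cons (encSymb (r p)) (rowOn r L) := rfl

theorem setOn_cons (F : Finset (Fin w)) (p : Fin w) (L : List (Fin w)) :
    setOn F (p :: L) = .cons (encBool (decide (p ∈ F))) (setOn F L) := rfl

/-- A facet together with its index. -/
def encFacet (F : Fin h → Finset (Fin w)) (i : Fin h) : Val := .cons (encNat i) (encSet (F i))

theorem encList_congr {α : Type*} {enc enc' : α → Val} {l : List α}
    (h : ∀ a ∈ l, enc a = enc' a) : encList enc l = encList enc' l := by
  induction l with
  | nil => rfl
  | cons a l ih =>
    simp only [encList]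
    rw [h a List.mem_cons_self, ih fun b hb => h b (List.mem_cons_of_mem _ hb)]

end encodings

namespace Code

theorem cost_ite_le (c a b : Code) (v : Val) :
    (ite c a b).cost v ≤ c.cost v + a.cost v + b.cost v + 1 := by
  simp only [cost]; split <;> omega

theorem cost_and_le (a b : Code) (v : Val) : (and a b).cost v ≤ a.cost v + b.cost v + 2 :=
  cost_ite_le a b nil v

theorem cost_not_le (a : Code) (v : Val) : (not a).cost v ≤ a.cost v + 5 :=
  cost_ite_le a nil tt v

/-! #### Tests and maps along a row and a set -/

/-- Does the test `t` succeed somewhere? The input is `(row, (set, x))`, and `t` is applied to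
`(symbol, ((set, x), _))` where `set` starts at the position of the symbol. -/
def any (t : Code) : Code :=
  recur nil (cons (tail (head (tail id))) (tail (tail id))) (ite t tt (tail (tail id)))

theorem sem_any {t : Code} {w : ℕ} {r : Row w} {F : Finset (Fin w)} {x : Val} {T : Fin w → Bool}
    (ht : ∀ p l s, t.sem (.cons (encSymb (r p))
      (.cons (.cons (.cons (encBool (decide (p ∈ F))) l) x) s)) = encBool (T p))
    (L : List (Fin w)) :
    (any t).sem (.cons (rowOn r L) (.cons (setOn F L) x)) = encBool (L.any T) := by
  induction L with
  | nil => rfl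
  | cons p L ih =>
    rw [rowOn_cons, setOn_cons, any, recur_cons, ← any]
    rw [sem_ite (ht p _ _)]
    change (if T p = true then encBool true else
      (any t).sem (.cons (rowOn r L) (.cons (setOn F L) x))) = _
    rw [ih, List.any_cons]
    cases T p <;> rfl

theorem cost_any {t : Code} {w : ℕ} {r : Row w} {F : Finset (Fin w)} {x : Val} {B : ℕ}
    (ht : ∀ p l s, t.cost (.cons (encSymb (r p))
      (.cons (.cons (.cons (encBool (decide (p ∈ F))) l) x) s)) ≤ B) (L : List (Fin w)) :
    (any t).cost (.cons (rowOn r L) (.cons (setOn F L) x)) ≤ (L.length + 1) * (B + 50) := by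
  refine (cost_recur_le (fun p => encSymb (r p)) (fun l s => s = .cons (setOn F l) x)
    1 (B + 24) (fun s _ => le_rfl) ?_ L _ rfl).trans ?_
  · rintro p l s rfl
    refine ⟨rfl, ?_⟩
    have h1 := ht p (setOn F l) ((any t).sem (.cons (rowOn r l) (.cons (setOn F l) x)))
    have h2 := cost_le_nodes (cons (tail (head (tail id))) (tail (tail id))) rfl
      (.cons (encSymb (r p)) (.cons (setOn F (p :: l)) x))
    have h3 : ∀ v, (ite t tt (tail (tail id))).cost v ≤ t.cost v + 7 := fun v =>
      cost_ite_le t tt (tail (tail id)) v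
    refine (Nat.add_le_add h2 ((h3 _).trans (Nat.add_le_add_right h1 _))).trans ?_
    simp only [nodes]; omega
  · nlinarith

/-- Apply `f` to every symbol. The input is as for `any`. -/
def mapRow (f : Code) : Code :=
  recur nil (cons (tail (head (tail id))) (tail (tail id))) (cons f (tail (tail id)))

theorem sem_mapRow {f : Code} {w : ℕ} {r s : Row w} {F : Finset (Fin w)} {x : Val}
    (hf : ∀ p l z, f.sem (.cons (encSymb (r p))
      (.cons (.cons (.cons (encBool (decide (p ∈ F))) l) x) z)) = encSymb (s p))
    (L : List (Fin w)) :
    (mapRow f).sem (.cons (rowOn r L) (.cons (setOn F L) x)) = rowOn s L := by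
  induction L with
  | nil => rfl
  | cons p L ih =>
    rw [rowOn_cons, setOn_cons, mapRow, recur_cons, ← mapRow, rowOn_cons, ← hf p, ← ih]
    rfl

theorem cost_mapRow {f : Code} {w : ℕ} {r : Row w} {F : Finset (Fin w)} {x : Val} {B : ℕ}
    (hf : ∀ p l s, f.cost (.cons (encSymb (r p))
      (.cons (.cons (.cons (encBool (decide (p ∈ F))) l) x) s)) ≤ B) (L : List (Fin w)) :
    (mapRow f).cost (.cons (rowOn r L) (.cons (setOn F L) x)) ≤ (L.length + 1) * (B + 50) := by
  refine (cost_recur_le (fun p => encSymb (r p)) (fun l s => s = .cons (setOn F l) x)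
    1 (B + 24) (fun s _ => le_rfl) ?_ L _ rfl).trans ?_
  · rintro p l s rfl
    refine ⟨rfl, ?_⟩
    have h1 := hf p (setOn F l) ((mapRow f).sem (.cons (rowOn r l) (.cons (setOn F l) x)))
    have h2 := cost_le_nodes (cons (tail (head (tail id))) (tail (tail id))) rfl
      (.cons (encSymb (r p)) (.cons (setOn F (p :: l)) x))
    have h3 : ∀ v, (cons f (tail (tail id))).cost v = f.cost v + 4 := fun v => rfl
    refine (Nat.add_le_add h2 ((h3 _).le.trans (Nat.add_le_add_right h1 _))).trans ?_
    simp only [nodes]; omega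
  · nlinarith

/-- Is the symbol `a` the wildcard with index `j`? -/
def isWild (a j : Code) : Code := and (head a) (not (comp cmp (cons j (tail a))))

/-- Equality is the only comparison result encoded by `nil`, so negating the result of `cmp` tests
whether the indices agree. The symbols `0`, `1`, `2` are excluded beforehand, since only a wildcard
has a nonempty first component. -/
theorem sem_isWild {a b : Code} {v : Val} {s : Symb} {j : ℕ} (ha : a.sem v = encSymb s)
    (hb : b.sem v = encNat j) : (isWild a b).sem v = encBool (decide (s = Symb.e j)) := by
  cases s with
  | e i =>
    simp only [isWild, and, not, sem, ha, hb, encSymb, Val.head_cons, Val.tail_cons, sem_cmp]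
    rcases lt_trichotomy j i with h | h | h
    · rw [compare_lt_iff_lt.2 h, decide_eq_false (by simpa using h.ne')]; rfl
    · subst h; rw [compare_eq_iff_eq.2 rfl, decide_eq_true rfl]; rfl
    · rw [compare_gt_iff_gt.2 h, decide_eq_false (by simpa using h.ne)]; rfl
  | _ => simp [isWild, and, sem, ha, encSymb, Val.head, encBool]

/-- The symbol at the current position. -/
def symbol : Code := head id

/-- The bit of the set at the current position. -/
def bitHere : Code := head (head (head (tail id)))

/-- The parameter `x`. -/
def param : Code := tail (head (tail id))

section here

variable {s : Symb} {b : Bool} {l x z : Val}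

end here

/-- `(r, (F, j))`: does the wildcard `j` occur outside the set? -/
def meets : Code := any (and (isWild symbol param) (not bitHere))

/-- `(r, (F, j))`: does the wildcard `j` occur inside the set? -/
def leaves : Code := any (and (isWild symbol param) bitHere)

/-- `(r, (F, _))`: does a `1` occur outside the set? -/
def meetsOne : Code := any (and (ite symbol (not (or (head symbol) (tail symbol))) nil)
  (not bitHere))

/-- `(r, (F, _))`: does a `2` occur outside the set? -/
def meetsTwo : Code := any (and (ite (head symbol) nil (ite (tail symbol) tt nil)) (not bitHere))

/-- `(r, (F, _))`: does something else than `0` occur outside the set? -/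
def meetsNonzero : Code := any (and (ite symbol tt nil) (not bitHere))

section

variable {w : ℕ} (r : Row w) (F : Finset (Fin w))

theorem sem_any_finRange {t : Code} {x : Val} {T : Fin w → Bool}
    (ht : ∀ p l s, t.sem (.cons (encSymb (r p))
      (.cons (.cons (.cons (encBool (decide (p ∈ F))) l) x) s)) = encBool (T p)) :
    (any t).sem (.cons (encRow r) (.cons (encSet F) x)) = encBool (decide (∃ p, T p = true)) := by
  rw [encRow_eq, encSet_eq, sem_any ht]
  congr 1
  rw [Bool.eq_iff_iff]
  simp

/-- The program holds the facet `F`, not the hyperedge. Positions of the hyperedge are those with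
incidence bit `0`, hence the condition `p ∉ F`. -/
theorem sem_meets (j : ℕ) : meets.sem (.cons (encRow r) (.cons (encSet F) (encNat j))) =
    encBool (decide (∃ p, p ∉ F ∧ r p = Symb.e j)) := by
  rw [meets, sem_any_finRange r F fun p l s => sem_and (sem_isWild (s := r p) rfl (j := j) rfl)
    (sem_not (x := decide (p ∈ F)) rfl)]
  simp [and_comm]

theorem sem_leaves (j : ℕ) : leaves.sem (.cons (encRow r) (.cons (encSet F) (encNat j))) =
    encBool (decide (∃ p, p ∈ F ∧ r p = Symb.e j)) := by
  rw [leaves, sem_any_finRange r F fun p l s => sem_and (sem_isWild (s := r p) rfl (j := j) rfl)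
    (y := decide (p ∈ F)) rfl]
  simp [and_comm]

theorem sem_meetsOne (x : Val) : meetsOne.sem (.cons (encRow r) (.cons (encSet F) x)) =
    encBool (decide (∃ p, p ∉ F ∧ r p = Symb.one)) := by
  rw [meetsOne, sem_any_finRange r F fun p l s => sem_and (x := decide (r p = Symb.one)) ?_
    (sem_not (x := decide (p ∈ F)) rfl)]
  · simp [and_comm]
  · cases h : r p <;> rfl

theorem sem_meetsTwo (x : Val) : meetsTwo.sem (.cons (encRow r) (.cons (encSet F) x)) =
    encBool (decide (∃ p, p ∉ F ∧ r p = Symb.two)) := by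
  rw [meetsTwo, sem_any_finRange r F fun p l s => sem_and (x := decide (r p = Symb.two)) ?_
    (sem_not (x := decide (p ∈ F)) rfl)]
  · simp [and_comm]
  · cases h : r p <;> rfl

theorem sem_meetsNonzero (x : Val) : meetsNonzero.sem (.cons (encRow r) (.cons (encSet F) x)) =
    encBool (decide (∃ p, p ∉ F ∧ r p ≠ Symb.zero)) := by
  rw [meetsNonzero, sem_any_finRange r F fun p l s => sem_and (x := decide (r p ≠ Symb.zero)) ?_
    (sem_not (x := decide (p ∈ F)) rfl)]
  · simp [and_comm]
  · cases h : r p <;> rfl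

end

theorem cost_isWild : ∃ C, ∀ (a b : Code) (v : Val) (j : ℕ), a.flat → b.flat →
    b.sem v = encNat j → (isWild a b).cost v ≤ 2 * a.nodes + b.nodes + C * (j.size + 1) := by
  obtain ⟨C, hC⟩ := cost_cmp
  refine ⟨C + 20, fun a b v j ha hb hj => ?_⟩
  have h := hC j (a.sem v).tail
  have ha := cost_le_nodes a ha v
  have hb := cost_le_nodes b hb v
  have h1 := cost_and_le (head a) (not (comp cmp (cons b (tail a)))) v
  have h2 := cost_not_le (comp cmp (cons b (tail a))) v
  simp only [cost, sem, hj] at h1 h2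
  change (and _ _).cost v ≤ _
  nlinarith

/-- One scan compares `w` indices with `j`, and each comparison is paid for by the at most `w` bits
of `j`. -/
theorem cost_any_isWild (t : Code) (ht : t.flat) : ∃ C, ∀ {w : ℕ} (r : Row w)
    (F : Finset (Fin w)) (j : ℕ), j.size ≤ w →
      (any (and (isWild symbol param) t)).cost (.cons (encRow r) (.cons (encSet F) (encNat j))) ≤
        C * (w + 1) ^ 2 := by
  obtain ⟨C, hC⟩ := cost_isWild
  refine ⟨C + t.nodes + 100, fun {w} r F j hj => ?_⟩
  rw [encRow_eq, encSet_eq]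
  refine (cost_any (B := C * (w + 1) + t.nodes + 30) (fun p l s => ?_) _).trans ?_
  · refine (cost_and_le _ _ _).trans ?_
    refine (Nat.add_le_add_right (Nat.add_le_add (hC symbol param _ j rfl rfl rfl)
      (cost_le_nodes t ht _)) _).trans ?_
    have : C * (j.size + 1) ≤ C * (w + 1) := Nat.mul_le_mul_left _ (by omega)
    simp only [symbol, param, nodes]
    omega
  · rw [List.length_finRange]
    have := Nat.mul_le_mul_left (t.nodes + 80) (Nat.le_self_pow two_ne_zero (w + 1))
    nlinarith

theorem cost_meets : ∃ C, ∀ {w : ℕ} (r : Row w) (F : Finset (Fin w)) (j : ℕ), j.size ≤ w →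
    meets.cost (.cons (encRow r) (.cons (encSet F) (encNat j))) ≤ C * (w + 1) ^ 2 :=
  cost_any_isWild _ rfl

theorem cost_leaves : ∃ C, ∀ {w : ℕ} (r : Row w) (F : Finset (Fin w)) (j : ℕ), j.size ≤ w →
    leaves.cost (.cons (encRow r) (.cons (encSet F) (encNat j))) ≤ C * (w + 1) ^ 2 :=
  cost_any_isWild _ rfl

theorem cost_any_of_flat (t : Code) (ht : t.flat) : ∃ C, ∀ {w : ℕ} (r : Row w)
    (F : Finset (Fin w)) (x : Val),
      (any t).cost (.cons (encRow r) (.cons (encSet F) x)) ≤ C * (w + 1) := by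
  refine ⟨t.nodes + 50, fun {w} r F x => ?_⟩
  rw [encRow_eq, encSet_eq]
  refine (cost_any (fun p l s => cost_le_nodes t ht _) _).trans ?_
  rw [List.length_finRange, Nat.mul_comm]

theorem cost_meetsOne : ∃ C, ∀ {w : ℕ} (r : Row w) (F : Finset (Fin w)) (x : Val),
    meetsOne.cost (.cons (encRow r) (.cons (encSet F) x)) ≤ C * (w + 1) :=
  cost_any_of_flat _ rfl

theorem cost_meetsTwo : ∃ C, ∀ {w : ℕ} (r : Row w) (F : Finset (Fin w)) (x : Val),
    meetsTwo.cost (.cons (encRow r) (.cons (encSet F) x)) ≤ C * (w + 1) :=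
  cost_any_of_flat _ rfl

theorem cost_meetsNonzero : ∃ C, ∀ {w : ℕ} (r : Row w) (F : Finset (Fin w)) (x : Val),
    meetsNonzero.cost (.cons (encRow r) (.cons (encSet F) x)) ≤ C * (w + 1) :=
  cost_any_of_flat _ rfl

/-! #### The candidate sons of a row -/

/-- `(r, (F, j)) ↦ bubbleSon (univ \ F) r j`. -/
def wildSon : Code :=
  mapRow (ite (head symbol)
    (ite bitHere (ite (comp cmp (cons param (tail symbol))) symbol (cons nil tt))
      (ite (tail (comp cmp (cons param (tail symbol)))) nil symbol)) symbol)

theorem sem_wildSon {w : ℕ} (r : Row w) {F K : Finset (Fin w)} (hK : ∀ p, p ∈ K ↔ p ∉ F)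
    (j : ℕ) : wildSon.sem (.cons (encRow r) (.cons (encSet F) (encNat j))) =
      encRow (bubbleSon K r j) := by
  rw [encRow_eq, encRow_eq, encSet_eq, wildSon]
  refine sem_mapRow (fun p l z => ?_) _
  cases hr : r p with
  | e i =>
    -- Here `j` is compared with `i`, so `gt` means `i < j`. It is the only result with a nonempty
    -- tail, which is what the code tests before writing `0`; `eq` is the `nil` that leads to `2`.
    have e1 : (comp cmp (cons param (tail symbol))).sem (.cons (encSymb (Symb.e i))
        (.cons (.cons (.cons (encBool (decide (p ∈ F))) l) (encNat j)) z)) =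
        encOrdering (compare j i) := sem_cmp j i
    have e2 : bubbleSon K r j p = if p ∈ F then (if i = j then Symb.two else Symb.e i)
        else (if i < j then Symb.zero else Symb.e i) := by
      unfold bubbleSon
      rw [hr]
      by_cases hp : p ∈ F <;> simp [hK, hp]
    rw [e2]
    generalize hv : (Val.cons (encSymb (Symb.e i))
        (.cons (.cons (.cons (encBool (decide (p ∈ F))) l) (encNat j)) z)) = v at e1
    have e3 : (head symbol).sem v = encBool true := by subst hv; rfl
    have e4 : bitHere.sem v = encBool (decide (p ∈ F)) := by subst hv; rfl
    have e5 : symbol.sem v = encSymb (Symb.e i) := by subst hv; rfl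
    generalize comp cmp (cons param (tail symbol)) = o at e1 ⊢
    rw [sem_ite e3, if_pos rfl, sem_ite e4]
    simp only [sem, e1, e5, decide_eq_true_eq]
    by_cases hp : p ∈ F
    · rw [if_pos hp, if_pos hp]
      rcases lt_trichotomy j i with h | h | h
      · rw [compare_lt_iff_lt.2 h, if_neg h.ne']; rfl
      · subst h; rw [compare_eq_iff_eq.2 rfl, if_pos rfl]; rfl
      · rw [compare_gt_iff_gt.2 h, if_neg h.ne]; rfl
    · rw [if_neg hp, if_neg hp]
      rcases lt_trichotomy j i with h | h | h
      · rw [compare_lt_iff_lt.2 h, if_neg h.not_gt]; rfl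
      · subst h; rw [compare_eq_iff_eq.2 rfl, if_neg (lt_irrefl _)]; rfl
      · rw [compare_gt_iff_gt.2 h, if_pos h]; rfl
  | _ =>
    unfold bubbleSon
    rw [hr]
    rfl

theorem cost_wildSon : ∃ C, ∀ {w : ℕ} (r : Row w) (F : Finset (Fin w)) (j : ℕ), j.size ≤ w →
    wildSon.cost (.cons (encRow r) (.cons (encSet F) (encNat j))) ≤ C * (w + 1) ^ 2 := by
  obtain ⟨C, hC⟩ := cost_cmp
  refine ⟨2 * C + 200, fun {w} r F j hj => ?_⟩
  rw [encRow_eq, encSet_eq]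
  refine (cost_mapRow (B := 2 * C * (w + 1) + 100) (fun p l s => ?_) _).trans ?_
  · generalize hv : (Val.cons (encSymb (r p))
        (.cons (.cons (.cons (encBool (decide (p ∈ F))) l) (encNat j)) s)) = v
    have e1 : (comp cmp (cons param (tail symbol))).cost v ≤ C * (w + 1) + 10 := by
      subst hv
      have h1 := hC j (encSymb (r p)).tail
      have h2 : C * (j.size + 1) ≤ C * (w + 1) := Nat.mul_le_mul_left _ (by omega)
      change _ + cmp.cost (.cons (encNat j) (encSymb (r p)).tail) + 1 ≤ _
      have h3 : (cons param (tail symbol)).cost (.cons (encSymb (r p))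
          (.cons (.cons (.cons (encBool (decide (p ∈ F))) l) (encNat j)) s)) ≤ 9 :=
        (cost_le_nodes _ rfl _).trans (by decide)
      omega
    have e2 : symbol.cost v ≤ 2 := cost_le_nodes symbol rfl v
    have e3 : bitHere.cost v ≤ 5 := cost_le_nodes bitHere rfl v
    have e4 : (cons nil tt).cost v ≤ 5 := cost_le_nodes (cons nil tt) rfl v
    refine (cost_ite_le _ _ _ v).trans ?_
    have h1 := cost_ite_le bitHere (ite (comp cmp (cons param (tail symbol))) symbol (cons nil tt))
      (ite (tail (comp cmp (cons param (tail symbol)))) nil symbol) v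
    have h2 := cost_ite_le (comp cmp (cons param (tail symbol))) symbol (cons nil tt) v
    have h3 := cost_ite_le (tail (comp cmp (cons param (tail symbol)))) nil symbol v
    have h4 : (tail (comp cmp (cons param (tail symbol)))).cost v =
      (comp cmp (cons param (tail symbol))).cost v + 1 := rfl
    have h5 : (head symbol).cost v = symbol.cost v + 1 := rfl
    have h6 : nil.cost v = 1 := rfl
    rw [Nat.mul_assoc]
    omega
  · rw [List.length_finRange]; nlinarith

/-- `(r, (F, i)) ↦ twosSon (univ \ F) i r`. -/
def newSon : Code :=
  mapRow (ite bitHere symbol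
    (ite (head symbol) nil (ite (tail symbol) (cons tt param) symbol)))

theorem sem_newSon {w : ℕ} (r : Row w) {F K : Finset (Fin w)} (hK : ∀ p, p ∈ K ↔ p ∉ F)
    (i : ℕ) : newSon.sem (.cons (encRow r) (.cons (encSet F) (encNat i))) =
      encRow (twosSon K i r) := by
  rw [encRow_eq, encRow_eq, encSet_eq, newSon]
  refine sem_mapRow (fun p l z => ?_) _
  unfold twosSon
  by_cases hp : p ∈ F
  · rw [if_neg (by simp [hK, hp]), decide_eq_true hp]; rfl
  · rw [if_pos (by simp [hK, hp]), decide_eq_false hp]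
    cases r p <;> rfl

theorem cost_newSon : ∃ C, ∀ {w : ℕ} (r : Row w) (F : Finset (Fin w)) (x : Val),
    newSon.cost (.cons (encRow r) (.cons (encSet F) x)) ≤ C * (w + 1) := by
  refine ⟨200, fun {w} r F x => ?_⟩
  rw [encRow_eq, encSet_eq]
  refine (cost_mapRow (B := 100) (fun p l s => (cost_le_nodes _ rfl _).trans (by decide)) _).trans ?_
  rw [List.length_finRange]; omega

/-- `(r, j) ↦` the list of the positions that carry the wildcard `j` (as a list of blanks). -/
def occ : Code :=
  recur nil (tail id) (ite (isWild symbol (head (tail id))) (cons nil (tail (tail id)))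
    (tail (tail id)))

/-- A list, as far as its length is concerned. -/
def blanks {α : Type*} (l : List α) : Val := encList (fun _ => .nil) l

theorem sem_occ {w : ℕ} (r : Row w) (j : ℕ) (L : List (Fin w)) :
    occ.sem (.cons (rowOn r L) (encNat j)) =
      blanks (L.filter fun p => decide (r p = Symb.e j)) := by
  induction L with
  | nil => rfl
  | cons p L ih =>
    have e1 : (tail id).sem (.cons (encSymb (r p)) (encNat j)) = encNat j := rfl
    rw [rowOn_cons, occ, recur_cons, ← occ, e1, ih,
      sem_ite (sem_isWild (s := r p) rfl (j := j) rfl), List.filter_cons]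
    split <;> rfl

theorem cost_occ : ∃ C, ∀ {w : ℕ} (r : Row w) (j : ℕ), j.size ≤ w →
    occ.cost (.cons (encRow r) (encNat j)) ≤ C * (w + 1) ^ 2 := by
  obtain ⟨C, hC⟩ := cost_isWild
  refine ⟨C + 100, fun {w} r j hj => ?_⟩
  rw [encRow_eq]
  refine (cost_recur_le (fun p => encSymb (r p)) (fun _ s => s = encNat j) 1
    (C * (w + 1) + 40) (fun s _ => le_rfl) ?_ (List.finRange w) _ rfl).trans ?_
  · rintro p l s rfl
    refine ⟨rfl, ?_⟩
    have h1 := hC symbol (head (tail id)) (.cons (encSymb (r p)) (.cons (encNat j)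
      (occ.sem (.cons (rowOn r l) (encNat j))))) j rfl rfl rfl
    have h2 := cost_ite_le (isWild symbol (head (tail id))) (cons nil (tail (tail id)))
      (tail (tail id)) (.cons (encSymb (r p)) (.cons (encNat j)
      (occ.sem (.cons (rowOn r l) (encNat j)))))
    have h3 : C * (j.size + 1) ≤ C * (w + 1) := Nat.mul_le_mul_left _ (by omega)
    simp only [symbol, nodes] at h1
    refine (Nat.add_le_add_left h2 _).trans ?_
    simp only [cost, symbol] at h1 ⊢
    omega
  · rw [List.length_finRange]; nlinarith

/-- The step of `tidy`: applied to `(symbol, (row, _))`. -/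
def tidySymbol : Code :=
  ite (head symbol) (ite (tail (comp occ (cons (head (tail id)) (tail symbol)))) symbol tt) symbol

/-- `(r, r) ↦ r.tidy`. -/
def tidy : Code := recur nil (tail id) (cons tidySymbol (tail (tail id)))

/-- The position `p` itself occurs in the list of positions of its wildcard, so the list is
nonempty, and the bubble is a singleton if and only if the tail of the list is empty. -/
theorem sem_tidySymbol {w : ℕ} (r : Row w) (p : Fin w) (z : Val) :
    tidySymbol.sem (.cons (encSymb (r p)) (.cons (encRow r) z)) = encSymb (r.tidy p) := by
  unfold Row.tidy
  cases hr : r p with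
  | e j =>
    have e1 : (comp occ (cons (head (tail id)) (tail symbol))).sem
        (.cons (encSymb (Symb.e j)) (.cons (encRow r) z)) =
        blanks ((List.finRange w).filter fun p => decide (r p = Symb.e j)) := by
      rw [encRow_eq]; exact sem_occ r j _
    have e2 : ((List.finRange w).filter fun p => decide (r p = Symb.e j)).length =
        (r.bubble j).card := by
      rw [← List.toFinset_card_of_nodup ((List.nodup_finRange w).filter _)]
      congr 1
      ext q
      simp [Row.bubble]
    have e3 : r.bubble j = {p} ↔ (r.bubble j).card = 1 := by
      have : p ∈ r.bubble j := Row.mem_bubble.2 hr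
      rw [Finset.card_eq_one]
      exact ⟨fun h => ⟨p, h⟩, fun ⟨a, ha⟩ => by
        rw [ha, Finset.mem_singleton] at this; rw [ha, this]⟩
    have e4 : 0 < (r.bubble j).card := Finset.card_pos.2 ⟨p, Row.mem_bubble.2 hr⟩
    rw [tidySymbol, sem_ite (x := true) rfl, if_pos rfl]
    simp only [sem] at e1 ⊢
    rw [e1]
    simp only [e3, ← e2] at e4 ⊢
    generalize (List.finRange w).filter (fun p => decide (r p = Symb.e j)) = l at e4 ⊢
    rcases l with _ | ⟨a, _ | ⟨b, l⟩⟩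
    · simp at e4
    · rfl
    · rw [if_neg (by simp)]; rfl
  | _ => rfl

theorem sem_tidy {w : ℕ} (r : Row w) :
    tidy.sem (.cons (encRow r) (encRow r)) = encRow r.tidy := by
  have key : ∀ L, tidy.sem (.cons (rowOn r L) (encRow r)) = rowOn r.tidy L := by
    intro L
    induction L with
    | nil => rfl
    | cons p L ih =>
      have e1 : (tail id).sem (.cons (encSymb (r p)) (encRow r)) = encRow r := rfl
      rw [rowOn_cons, rowOn_cons, tidy, recur_cons, ← tidy, e1, ih, ← sem_tidySymbol]
      rfl
  rw [encRow_eq r.tidy, ← key, ← encRow_eq]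

/-- Each of the `w` positions may trigger a scan of the whole row for its wildcard, with comparisons
of at most `w` bits; hence the cube. -/
theorem cost_tidy : ∃ C, ∀ {w : ℕ} (r : Row w), (∀ p j, r p = Symb.e j → j.size ≤ w) →
    tidy.cost (.cons (encRow r) (encRow r)) ≤ C * (w + 1) ^ 3 := by
  obtain ⟨C, hC⟩ := cost_occ
  refine ⟨C + 100, fun {w} r hr => ?_⟩
  have key : ∀ p z, tidySymbol.cost (.cons (encSymb (r p)) (.cons (encRow r) z)) ≤
      C * (w + 1) ^ 2 + 30 := by
    intro p z
    cases hp : r p with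
    | e j =>
      have h1 := hC r j (hr p j hp)
      have h2 := cost_ite_le (tail (comp occ (cons (head (tail id)) (tail symbol)))) symbol tt
        (.cons (encSymb (Symb.e j)) (.cons (encRow r) z))
      rw [tidySymbol, cost_ite (x := true) rfl, if_pos rfl]
      simp only [cost, sem, symbol, tt, Val.head_cons, Val.tail_cons, encSymb] at h2 ⊢
      omega
    | _ => exact (Nat.le_of_ble_eq_true rfl : _ ≤ 30).trans (Nat.le_add_left _ _)
  have h := cost_recur_le (p := tail id) (q := cons tidySymbol (tail (tail id)))
    (fun p => encSymb (r p)) (fun _ s => s = encRow r) 1 (C * (w + 1) ^ 2 + 40)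
    (b := nil) (fun s _ => le_rfl) (by
      rintro p l s rfl
      refine ⟨rfl, ?_⟩
      have := key p (tidy.sem (.cons (rowOn r l) (encRow r)))
      change 2 + (tidySymbol.cost (.cons (encSymb (r p)) (.cons (encRow r)
        (tidy.sem (.cons (rowOn r l) (encRow r))))) + 3 + 1) ≤ _
      omega) (List.finRange w) _ rfl
  rw [List.length_finRange] at h
  have h' : tidy.cost (.cons (encRow r) (encRow r)) ≤ 1 + 8 + w * (C * (w + 1) ^ 2 + 40 + 26) := by
    conv_lhs => rw [encRow_eq]
    rw [← encRow_eq]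
    rw [encRow_eq] at h ⊢
    exact h
  refine h'.trans ?_
  have : w * (C * (w + 1) ^ 2) + C * (w + 1) ^ 2 = C * (w + 1) ^ 3 := by ring
  have : 100 * (w + 1) ≤ 100 * (w + 1) ^ 3 := Nat.mul_le_mul_left _ (Nat.le_self_pow (by omega) _)
  nlinarith

end Code

end Lisp

/-! ### Size of the wildcard indices and number of wildcards of a row -/

section

open Row

variable {w : ℕ}

theorem Row.WildcardsLT.bubbleSon {r : Row w} {m : ℕ} (hr : r.WildcardsLT m) (K : Finset (Fin w))
    (j : ℕ) : (bubbleSon K r j).WildcardsLT m := by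
  intro p k hk
  refine hr p k ?_
  unfold _root_.bubbleSon at hk
  split at hk
  · split at hk <;> split at hk <;> simp_all
  · exact hk

theorem Row.WildcardsLT.twosSon {r : Row w} {m i : ℕ} (hr : r.WildcardsLT m)
    (K : Finset (Fin w)) (hi : i < m) : (twosSon K i r).WildcardsLT m := by
  intro p k hk
  unfold _root_.twosSon at hk
  split at hk
  · split at hk <;> simp_all
  · exact hr p k hk

theorem Row.WildcardsLT.size_le {r : Row w} {m : ℕ} (hr : r.WildcardsLT m) (hm : m ≤ 2 ^ w)
    (p : Fin w) (j : ℕ) (hp : r p = Symb.e j) : j.size ≤ w :=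
  Nat.size_le.2 ((hr p j hp).trans_le hm)

/-- A row has at most `w` wildcards. -/
theorem countP_wildcards_le (r : Row w) {h : ℕ} (P : Fin h → Bool)
    (hP : ∀ j, P j = true → ∃ p, r p = Symb.e j) : (List.finRange h).countP P ≤ w := by
  classical
  rw [List.countP_eq_length_filter]
  have hn : (((List.finRange h).filter P).map Fin.val).Nodup :=
    ((List.nodup_finRange h).filter _).map Fin.val_injective
  have h1 := List.toFinset_card_of_nodup hn
  rw [List.length_map] at h1
  rw [← h1]
  -- The indices in question all occur as symbols, so they lie in an image of the set of `w`
  -- positions. The value `0` for other symbols can only enlarge this image.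
  refine (Finset.card_le_card (t := Finset.univ.image fun p => match r p with
    | Symb.e j => j
    | _ => 0) ?_).trans (Finset.card_image_le.trans (by simp))
  intro j hj
  simp only [List.mem_toFinset, List.mem_map, List.mem_filter] at hj
  obtain ⟨i, ⟨-, hi⟩, rfl⟩ := hj
  obtain ⟨p, hp⟩ := hP i hi
  exact Finset.mem_image.2 ⟨p, Finset.mem_univ _, by rw [hp]⟩

theorem pow_mul_pow_le {N n : ℕ} (hN : 1 ≤ N) (hn : 1 ≤ n) {a b c d : ℕ} (hac : a ≤ c)
    (hbd : b ≤ d) : N ^ a * n ^ b ≤ N ^ c * n ^ d :=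
  Nat.mul_le_mul (Nat.pow_le_pow_right hN hac) (Nat.pow_le_pow_right hn hbd)

end

/-! ### Testing a row against the constraints, and its feasible sons -/

namespace Lisp

namespace Code

variable {w h : ℕ}

/-- `(facets, r)`: does every complement of a facet contain a position not carrying `0`? -/
def feas : Code :=
  recur tt (tail id)
    (and (comp meetsNonzero (cons (head (tail id)) (cons (tail (head id)) nil))) (tail (tail id)))

theorem sem_feas (F : Fin h → Finset (Fin w)) (r : Row w) (l : List (Fin h)) :
    feas.sem (.cons (encList (encFacet F) l) (encRow r)) =
      encBool (decide (∀ i ∈ l, ∃ p, p ∉ F i ∧ r p ≠ Symb.zero)) := by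
  induction l with
  | nil => simp [encList, feas, recur_nil, sem_tt]
  | cons i l ih =>
    have e1 : (tail id).sem (.cons (encFacet F i) (encRow r)) = encRow r := rfl
    rw [encList, feas, recur_cons, ← feas, e1, ih]
    refine Eq.trans (sem_and (sem_meetsNonzero r (F i) .nil) rfl) ?_
    simp

theorem cost_feas : ∃ C, ∀ {w h : ℕ} (F : Fin h → Finset (Fin w)) (r : Row w) (l : List (Fin h)),
    feas.cost (.cons (encList (encFacet F) l) (encRow r)) ≤ C * ((l.length + 1) * (w + 1)) := by
  obtain ⟨C, hC⟩ := cost_meetsNonzero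
  refine ⟨C + 100, fun {w h} F r l => ?_⟩
  refine (cost_recur_le (encFacet F) (fun _ s => s = encRow r) 3 (C * (w + 1) + 30)
    (fun s _ => le_rfl) ?_ l _ rfl).trans ?_
  · rintro i l s rfl
    refine ⟨rfl, ?_⟩
    refine (Nat.add_le_add_left (cost_and_le _ _ _) _).trans ?_
    have := hC r (F i) .nil
    change 2 + (_ + meetsNonzero.cost (.cons (encRow r) (.cons (encSet (F i)) .nil)) + 1 + 3 + 2)
      ≤ _
    have h1 : ∀ v, (cons (head (tail id)) (cons (tail (head id)) nil)).cost v = 9 := fun _ => rfl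
    rw [h1]
    omega
  · nlinarith

/-- `(facets, (r, F))`: does the row satisfy the constraint for the complement of `F`? -/
def satisfied : Code :=
  recur (comp meetsOne (cons (head id) (cons (tail id) nil))) (tail id)
    (or (and (comp meets (cons (head (head (tail id))) (cons (tail (head (tail id)))
        (head (head id)))))
      (not (comp leaves (cons (head (head (tail id))) (cons (tail (head (tail id)))
        (head (head id))))))) (tail (tail id)))

theorem sem_satisfied_list (F : Fin h → Finset (Fin w)) (r : Row w) (K : Finset (Fin w))
    (l : List (Fin h)) :
    satisfied.sem (.cons (encList (encFacet F) l) (.cons (encRow r) (encSet K))) =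
      encBool (decide ((∃ p, p ∉ K ∧ r p = Symb.one) ∨ ∃ j ∈ l,
        (∃ p, p ∉ K ∧ r p = Symb.e j) ∧ ¬ ∃ p, p ∈ K ∧ r p = Symb.e j)) := by
  induction l with
  | nil =>
    refine Eq.trans (sem_meetsOne r K .nil) ?_
    simp
  | cons i l ih =>
    have e1 : (tail id).sem (.cons (encFacet F i) (.cons (encRow r) (encSet K))) =
      .cons (encRow r) (encSet K) := rfl
    rw [encList, satisfied, recur_cons, ← satisfied, e1, ih]
    refine Eq.trans (sem_or (sem_and (sem_meets r K i) (sem_not (sem_leaves r K i))) rfl) ?_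
    congr 1
    rw [Bool.eq_iff_iff]
    simp only [Bool.or_eq_true, Bool.and_eq_true, decide_eq_true_eq, Bool.not_eq_true',
      decide_eq_false_iff_not, List.mem_cons, exists_eq_or_imp]
    exact or_left_comm

/-- The facets are numbered by the same indices `j < h` as the wildcards, so a recursion over the
numbered facets runs through all wildcards that can occur. A bubble lies in `K` when it occurs
outside the facet and not inside it. -/
theorem sem_satisfied (F : Fin h → Finset (Fin w)) (r : Row w) {F' K : Finset (Fin w)}
    (hK : ∀ p, p ∈ K ↔ p ∉ F') :
    satisfied.sem (.cons (encList (encFacet F) (List.finRange h))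
      (.cons (encRow r) (encSet F'))) = encBool (decide (Satisfied h K r)) := by
  rw [sem_satisfied_list]
  congr 1
  rw [Bool.eq_iff_iff, decide_eq_true_eq, decide_eq_true_eq, Satisfied]
  refine or_congr (by simp only [hK]) ⟨?_, ?_⟩
  · rintro ⟨j, -, ⟨p, -, hp⟩, hj⟩
    refine ⟨j, j.2, ⟨p, Row.mem_bubble.2 hp⟩, fun q hq => (hK q).2 fun hqF => hj ⟨q, hqF, ?_⟩⟩
    exact Row.mem_bubble.1 hq
  · rintro ⟨j, hj, ⟨p, hp⟩, hsub⟩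
    refine ⟨⟨j, hj⟩, List.mem_finRange _, ⟨p, (hK p).1 (hsub hp), Row.mem_bubble.1 hp⟩, ?_⟩
    rintro ⟨q, hqF, hq⟩
    exact (hK q).1 (hsub (Row.mem_bubble.2 hq)) hqF

theorem cost_satisfied : ∃ C, ∀ {w h : ℕ} (F : Fin h → Finset (Fin w)) (r : Row w)
    (K : Finset (Fin w)), h ≤ 2 ^ w → ∀ l : List (Fin h),
      satisfied.cost (.cons (encList (encFacet F) l) (.cons (encRow r) (encSet K))) ≤
        C * ((l.length + 1) * (w + 1) ^ 2) := by
  obtain ⟨C₁, h₁⟩ := cost_meetsOne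
  obtain ⟨C₂, h₂⟩ := cost_meets
  obtain ⟨C₃, h₃⟩ := cost_leaves
  refine ⟨C₁ + C₂ + C₃ + 200, fun {w h} F r K hh l => ?_⟩
  refine (cost_recur_le (encFacet F) (fun _ s => s = .cons (encRow r) (encSet K))
    (C₁ * (w + 1) + 20) (C₂ * (w + 1) ^ 2 + C₃ * (w + 1) ^ 2 + 100) ?_ ?_ l _ rfl).trans ?_
  · rintro s rfl
    have := h₁ r K .nil
    change 7 + meetsOne.cost (.cons (encRow r) (.cons (encSet K) .nil)) + 1 ≤ _
    omega
  · rintro i l s rfl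
    refine ⟨rfl, ?_⟩
    have hi : (i : ℕ).size ≤ w := Nat.size_le.2 (i.2.trans_le hh)
    have e2 := h₂ r K i hi
    have e3 := h₃ r K i hi
    refine (Nat.add_le_add_left (cost_ite_le _ _ _ _) _).trans ?_
    refine (Nat.add_le_add_left (Nat.add_le_add_right (Nat.add_le_add_right (Nat.add_le_add_right
      (cost_and_le _ _ _) _) _) _) _).trans ?_
    refine (Nat.add_le_add_left (Nat.add_le_add_right (Nat.add_le_add_right (Nat.add_le_add_right
      (Nat.add_le_add_right (Nat.add_le_add_left (cost_not_le _ _) _) _) _) _) _) _).trans ?_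
    change 2 + (13 + meets.cost (.cons (encRow r) (.cons (encSet K) (encNat i))) + 1 +
      (13 + leaves.cost (.cons (encRow r) (.cons (encSet K) (encNat i))) + 1 + 5) + 2 +
      3 + 3 + 1) ≤ _
    omega
  · have h1 : (w + 1) ≤ (w + 1) ^ 2 := Nat.le_self_pow two_ne_zero _
    have h2 : 1 ≤ (w + 1) ^ 2 := Nat.one_le_pow _ _ (by omega)
    generalize (w + 1) ^ 2 = n at *
    have h3 : C₁ * (w + 1) ≤ C₁ * n := Nat.mul_le_mul_left _ h1
    have h4 : l.length * 1 ≤ l.length * n := Nat.mul_le_mul_left _ h2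
    have h5 : 0 ≤ C₁ * (l.length * n) := Nat.zero_le _
    have h6 : 0 ≤ (C₂ + C₃) * n := Nat.zero_le _
    linarith

/-- The step of `push`: `(s, (facets, rest))` becomes `s :: rest` if `s` is feasible. -/
def pushIfFeas : Code :=
  ite (comp feas (cons (head (tail id)) (head id))) (cons (head id) (tail (tail id)))
    (tail (tail id))

/-- `(s, (facets, rest))`: put the tidied row `s` in front if it is feasible. -/
def push : Code := comp pushIfFeas (cons (comp tidy (cons (head id) (head id))) (tail id))

theorem sem_push {F H : Fin h → Finset (Fin w)} (hH : ∀ i p, p ∈ H i ↔ p ∉ F i) (s : Row w)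
    (rest : List (Row w)) :
    push.sem (.cons (encRow s) (.cons (encList (encFacet F) (List.finRange h))
      (encList encRow rest))) =
      encList encRow (([s].map Row.tidy).filter (fun t => Feasible H t) ++ rest) := by
  have e1 : ∀ x, (cons (comp tidy (cons (head id) (head id))) (tail id)).sem
      (.cons (encRow s) x) = .cons (encRow s.tidy) x := fun x =>
    congrArg (Val.cons · x) (sem_tidy s)
  have e2 : decide (∀ i ∈ List.finRange h, ∃ p, p ∉ F i ∧ s.tidy p ≠ Symb.zero) =
      decide (Feasible H s.tidy) := by simp [Feasible, hH]
  change pushIfFeas.sem ((cons _ _).sem _) = _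
  rw [e1]
  refine Eq.trans (sem_ite ((sem_feas F s.tidy (List.finRange h)).trans (congrArg _ e2))) ?_
  by_cases hf : Feasible H s.tidy
  · simp only [hf, decide_true, if_true, List.map_cons, List.map_nil, List.filter_cons,
      List.filter_nil, List.cons_append, List.nil_append]
    rfl
  · simp only [hf, decide_false, if_false, List.map_cons, List.map_nil, List.filter_cons,
      List.filter_nil, List.nil_append, Bool.false_eq_true]
    rfl

theorem cost_push : ∃ C, ∀ {w h : ℕ} (F : Fin h → Finset (Fin w)) (s : Row w) (x : Val),
    (∀ p j, s p = Symb.e j → j.size ≤ w) →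
      push.cost (.cons (encRow s) (.cons (encList (encFacet F) (List.finRange h)) x)) ≤
        C * ((w + 1) ^ 3 + (h + 1) * (w + 1)) := by
  obtain ⟨C₁, h₁⟩ := cost_tidy
  obtain ⟨C₂, h₂⟩ := cost_feas
  refine ⟨C₁ + C₂ + 100, fun {w h} F s x hs => ?_⟩
  have e1 := h₁ s hs
  have e2 := h₂ F s.tidy (List.finRange h)
  rw [List.length_finRange] at e2
  have e3 := cost_ite_le (comp feas (cons (head (tail id)) (head id)))
    (cons (head id) (tail (tail id))) (tail (tail id))
    (.cons (encRow s.tidy) (.cons (encList (encFacet F) (List.finRange h)) x))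
  have e4 : (cons (comp tidy (cons (head id) (head id))) (tail id)).sem
      (.cons (encRow s) (.cons (encList (encFacet F) (List.finRange h)) x)) =
      .cons (encRow s.tidy) (.cons (encList (encFacet F) (List.finRange h)) x) :=
    congrArg (Val.cons · _) (sem_tidy s)
  change (5 + tidy.cost (.cons (encRow s) (encRow s)) + 1 + 2 + 1) +
    pushIfFeas.cost ((cons _ _).sem _) + 1 ≤ _
  rw [e4]
  change pushIfFeas.cost _ ≤ (6 + feas.cost (.cons (encList (encFacet F) (List.finRange h))
    (encRow s.tidy)) + 1) + 6 + 3 + 1 at e3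
  have e5 : 1 ≤ (w + 1) ^ 3 := Nat.one_le_pow _ _ (by omega)
  generalize (w + 1) ^ 3 = n at *
  generalize (h + 1) * (w + 1) = m at *
  have e6 : 0 ≤ C₂ * n := Nat.zero_le _
  have e7 : 0 ≤ C₁ * m := Nat.zero_le _
  linarith

/-- The last candidate son: applied to `(r, (F, (i, facets)))`. -/
def sonsBase : Code :=
  ite (comp meetsTwo (cons (head id) (cons (head (tail id)) nil)))
    (comp push (cons (comp newSon (cons (head id) (cons (head (tail id))
      (head (tail (tail id)))))) (cons (tail (tail (tail id))) nil))) nil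

/-- The candidate son for a wildcard: applied to `((j, _), ((r, (F, (i, facets))), rest))`. -/
def sonsStep : Code :=
  ite (comp meets (cons (head (head (tail id))) (cons (head (tail (head (tail id))))
      (head (head id)))))
    (comp push (cons (comp wildSon (cons (head (head (tail id)))
      (cons (head (tail (head (tail id)))) (head (head id)))))
      (cons (tail (tail (tail (head (tail id))))) (tail (tail id))))) (tail (tail id))

/-- `(facets, (r, (F, (i, facets))))`: the feasible candidate sons. -/
def sons : Code := recur sonsBase (tail id) sonsStep

/-- The son with the new wildcard is the last in the list and therefore the base of the recursion;
each wildcard that meets `H i` then puts its son in front, which reproduces the increasing order of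
the indices. -/
theorem sem_sons_list {F H : Fin h → Finset (Fin w)} (hH : ∀ i p, p ∈ H i ↔ p ∉ F i) (r : Row w)
    (i : Fin h) (l : List (Fin h)) :
    sons.sem (.cons (encList (encFacet F) l) (.cons (encRow r) (.cons (encSet (F i))
      (.cons (encNat i) (encList (encFacet F) (List.finRange h)))))) =
      encList encRow (((((l.map Fin.val).filter fun j => (r.bubble j ∩ H i).Nonempty).map
        (bubbleSon (H i) r) ++ (if (r.twos ∩ H i).Nonempty then [twosSon (H i) i r] else [])).map
          Row.tidy).filter fun s => Feasible H s) := by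
  induction l with
  | nil =>
    have e1 : decide (∃ p, p ∉ F i ∧ r p = Symb.two) = decide (r.twos ∩ H i).Nonempty := by
      simp only [Finset.Nonempty, Finset.mem_inter, Row.mem_twos, hH, and_comm]
    refine Eq.trans (sem_ite ((sem_meetsTwo r (F i) .nil).trans (congrArg _ e1))) ?_
    simp only [List.map_nil, List.filter_nil, List.nil_append, decide_eq_true_eq]
    split
    · refine Eq.trans ?_ ((sem_push hH (twosSon (H i) i r) []).trans (by rw [List.append_nil]))
      rw [← sem_newSon r (hH i)]
      rfl
    · rfl
  | cons j l ih =>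
    have e1 : decide (∃ p, p ∉ F i ∧ r p = Symb.e j) = decide (r.bubble j ∩ H i).Nonempty := by
      simp only [Finset.Nonempty, Finset.mem_inter, Row.mem_bubble, hH, and_comm]
    have e2 : ∀ S, (tail id).sem (.cons (encFacet F j) S) = S := fun _ => rfl
    rw [encList, sons, recur_cons, ← sons, e2, ih]
    refine Eq.trans (sem_ite ((sem_meets r (F i) j).trans (congrArg _ e1))) ?_
    simp only [List.map_cons, List.filter_cons, decide_eq_true_eq]
    split
    · have e3 : ∀ (s : Row w) (L : List (Row w)), (s.tidy :: L).filter (fun t => Feasible H t) =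
          ([s].map Row.tidy).filter (fun t => Feasible H t) ++
            L.filter (fun t => Feasible H t) := fun s L => by
        rw [← List.filter_append]; rfl
      rw [List.map_cons, List.cons_append, List.map_cons, e3]
      refine Eq.trans ?_ (sem_push hH (bubbleSon (H i) r j) _)
      rw [← sem_wildSon r (hH i)]
      rfl
    · rfl

theorem sum_map_add_ite {α : Type*} (l : List α) (P : α → Bool) (a b : ℕ) :
    (l.map fun j => a + if P j then b else 0).sum = l.length * a + l.countP P * b := by
  induction l with
  | nil => simp
  | cons j l ih =>
    rw [List.map_cons, List.sum_cons, ih, List.length_cons, List.countP_cons]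
    split <;> ring

/-- Every index costs a scan, but only an index that meets the hyperedge costs the construction of a
son. The bound therefore sums different costs over the list instead of using a uniform one. -/
theorem cost_sons : ∃ C, ∀ {w h : ℕ} {F : Fin h → Finset (Fin w)} (r : Row w) (i : Fin h),
    h ≤ 2 ^ w → r.WildcardsLT h →
      sons.cost (.cons (encList (encFacet F) (List.finRange h)) (.cons (encRow r)
        (.cons (encSet (F i)) (.cons (encNat i) (encList (encFacet F) (List.finRange h)))))) ≤
        C * ((h + 1) * (w + 1) ^ 3) := by
  obtain ⟨C₁, h₁⟩ := cost_meetsTwo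
  obtain ⟨C₂, h₂⟩ := cost_newSon
  obtain ⟨C₃, h₃⟩ := cost_push
  obtain ⟨C₄, h₄⟩ := cost_meets
  obtain ⟨C₅, h₅⟩ := cost_wildSon
  refine ⟨C₁ + C₂ + C₃ + C₃ + C₃ + C₃ + C₄ + C₅ + 200, fun {w h F} r i hh hr => ?_⟩
  let K : Finset (Fin w) := Finset.univ \ F i
  have hK : ∀ p, p ∈ K ↔ p ∉ F i := by simp [K]
  let P : Fin h → Bool := fun j => decide (∃ p, p ∉ F i ∧ r p = Symb.e j)
  -- The number `c` of wildcard sons is at most `w` and at most `h`, and both bounds are used: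
  -- tidying costs `c (w + 1)^3`, which is estimated by `c ≤ h`, and the feasibility tests cost `c
  -- (h + 1)(w + 1)`, estimated by `c ≤ w`.
  have hP : (List.finRange h).countP P ≤ w :=
    countP_wildcards_le r P fun j hj => (of_decide_eq_true hj).imp fun _ hp => hp.2
  have hP' : (List.finRange h).countP P ≤ h := by
    exact List.countP_le_length.trans (List.length_finRange (n := h)).le
  have key := cost_recur_le_sum (b := sonsBase) (p := tail id) (q := sonsStep) (encFacet F)
    (fun _ s => s = .cons (encRow r)
      (.cons (encSet (F i)) (.cons (encNat i) (encList (encFacet F) (List.finRange h)))))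
    (C₁ * (w + 1) + C₂ * (w + 1) + C₃ * ((w + 1) ^ 3 + (h + 1) * (w + 1)) + 50)
    (fun j => C₄ * (w + 1) ^ 2 + 70 + if P j then
      C₅ * (w + 1) ^ 2 + C₃ * ((w + 1) ^ 3 + (h + 1) * (w + 1)) else 0) ?_ ?_
    (List.finRange h) _ rfl
  · refine key.trans ?_
    have e1 : ∀ j, C₄ * (w + 1) ^ 2 + 70 + (if P j = true then
        C₅ * (w + 1) ^ 2 + C₃ * ((w + 1) ^ 3 + (h + 1) * (w + 1)) else 0) + 26 =
        C₄ * (w + 1) ^ 2 + 96 + (if P j = true then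
        C₅ * (w + 1) ^ 2 + C₃ * ((w + 1) ^ 3 + (h + 1) * (w + 1)) else 0) := fun j => by omega
    simp only [e1]
    rw [sum_map_add_ite, List.length_finRange]
    generalize (List.finRange h).countP P = c at hP hP'
    have m : ∀ {a b c d : ℕ}, a ≤ c → b ≤ d →
        (h + 1) ^ a * (w + 1) ^ b ≤ (h + 1) ^ c * (w + 1) ^ d := fun ha hb =>
      pow_mul_pow_le (Nat.le_add_left _ _) (Nat.le_add_left _ _) ha hb
    have m1 : (w + 1) ≤ (h + 1) * (w + 1) ^ 3 := by
      simpa using m (a := 0) (b := 1) (c := 1) (d := 3) (by omega) (by omega)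
    have m2 : (w + 1) ^ 3 ≤ (h + 1) * (w + 1) ^ 3 := Nat.le_mul_of_pos_left _ (Nat.succ_pos _)
    have m3 : (h + 1) * (w + 1) ≤ (h + 1) * (w + 1) ^ 3 := by
      simpa using m (a := 1) (b := 1) (c := 1) (d := 3) (by omega) (by omega)
    have m4 : (h + 1) * (w + 1) ^ 2 ≤ (h + 1) * (w + 1) ^ 3 := by
      simpa using m (a := 1) (b := 2) (c := 1) (d := 3) (by omega) (by omega)
    have m5 : h * (w + 1) ^ 2 ≤ (h + 1) * (w + 1) ^ 2 := Nat.mul_le_mul_right _ (by omega)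
    have m6 : c * (w + 1) ^ 2 ≤ (h + 1) * (w + 1) ^ 2 := Nat.mul_le_mul_right _ (by omega)
    have m7 : c * (w + 1) ^ 3 ≤ (h + 1) * (w + 1) ^ 3 := Nat.mul_le_mul_right _ (by omega)
    have m8 : c * ((h + 1) * (w + 1)) ≤ (w + 1) * ((h + 1) * (w + 1)) :=
      Nat.mul_le_mul_right _ (by omega)
    have m9 : (w + 1) * ((h + 1) * (w + 1)) = (h + 1) * (w + 1) ^ 2 := by ring
    have m10 : h + 1 ≤ (h + 1) * (w + 1) ^ 3 := Nat.le_mul_of_pos_right _ (by positivity)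
    have p1 := Nat.mul_le_mul_left C₁ m1
    have p2 := Nat.mul_le_mul_left C₂ m1
    have p3 := Nat.mul_le_mul_left C₃ m2
    have p3' := Nat.mul_le_mul_left C₃ m3
    have p4 := Nat.mul_le_mul_left C₄ (m5.trans m4)
    have p5 := Nat.mul_le_mul_left C₅ (m6.trans m4)
    have p6 := Nat.mul_le_mul_left C₃ m7
    have p7 := Nat.mul_le_mul_left C₃ (m8.trans (m9.le.trans m4))
    have e2 : h * (C₄ * (w + 1) ^ 2 + 96) = C₄ * (h * (w + 1) ^ 2) + h * 96 := by ring
    have e3 : c * (C₅ * (w + 1) ^ 2 + C₃ * ((w + 1) ^ 3 + (h + 1) * (w + 1))) =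
      C₅ * (c * (w + 1) ^ 2) + C₃ * (c * (w + 1) ^ 3) + C₃ * (c * ((h + 1) * (w + 1))) := by ring
    rw [e2, e3]
    simp only [Nat.add_mul _ _ ((h + 1) * (w + 1) ^ 3), Nat.mul_add C₃ ((w + 1) ^ 3)]
    omega
  · rintro s rfl
    have e1 := h₁ r (F i) .nil
    have e2 := h₂ r (F i) (encNat i)
    have e3 := h₃ F (twosSon K i r) .nil ((hr.twosSon K i.2).size_le hh)
    rw [← sem_newSon r hK] at e3
    refine (cost_ite_le _ _ _ _).trans ?_
    change (8 + meetsTwo.cost (.cons (encRow r) (.cons (encSet (F i)) .nil)) + 1) +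
      (((11 + newSon.cost (.cons (encRow r) (.cons (encSet (F i)) (encNat i))) + 1) + 6 + 1) +
      push.cost (.cons (newSon.sem (.cons (encRow r) (.cons (encSet (F i)) (encNat i))))
        (.cons (encList (encFacet F) (List.finRange h)) .nil)) + 1) + 1 + 1 ≤ _
    omega
  · rintro j l s rfl
    refine ⟨rfl, ?_⟩
    have hj : (j : ℕ).size ≤ w := Nat.size_le.2 (j.2.trans_le hh)
    have e1 := h₄ r (F i) j hj
    have e2 := h₅ r (F i) j hj
    have e3 := fun x => h₃ F (bubbleSon K r j) x ((hr.bubbleSon K j).size_le hh)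
    rw [← sem_wildSon r hK] at e3
    have e4 : ∀ x, sonsStep.cost (.cons (encFacet F j) (.cons (.cons (encRow r)
        (.cons (encSet (F i)) (.cons (encNat i) (encList (encFacet F) (List.finRange h))))) x)) =
        _ := fun x => cost_ite (x := P j) (sem_meets r (F i) j)
    refine (Nat.add_le_add_left (e4 _).le _).trans ?_
    split
    · change 2 + ((14 + meets.cost (.cons (encRow r) (.cons (encSet (F i)) (encNat j))) + 1) +
        (((14 + wildSon.cost (.cons (encRow r) (.cons (encSet (F i)) (encNat j))) + 1) + 10 + 1) +
        push.cost (.cons (wildSon.sem (.cons (encRow r) (.cons (encSet (F i)) (encNat j))))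
          (.cons (encList (encFacet F) (List.finRange h)) _)) + 1) + 1) ≤ _
      refine (Nat.add_le_add_left (Nat.add_le_add_right (Nat.add_le_add_left
        (Nat.add_le_add_right (Nat.add_le_add_left (e3 _) _) _) _) _) _).trans ?_
      omega
    · change 2 + ((14 + meets.cost (.cons (encRow r) (.cons (encSet (F i)) (encNat j))) + 1) +
        3 + 1) ≤ _
      omega

end Code

end Lisp

theorem List.map_val_finRange (h : ℕ) : (List.finRange h).map Fin.val = List.range h := by
  simp

theorem length_candidateSons_le {w h : ℕ} (H : Fin h → Finset (Fin w)) (i : Fin h) (r : Row w) :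
    (candidateSons H i r).length ≤ h + 1 := by
  unfold candidateSons
  rw [List.length_map, List.length_append, List.length_map]
  refine Nat.add_le_add ((List.length_filter_le _ _).trans (by simp)) ?_
  split <;> simp

/-- The bound is needed for appending the successors of one row to those of the others. -/
theorem length_impose_le {w h : ℕ} (H : Fin h → Finset (Fin w)) (i : Fin h) (r : Row w) :
    (impose H i r).length ≤ h + 1 := by
  unfold impose
  split
  · simp
  · exact (List.length_filter_le _ _).trans (length_candidateSons_le H i r)

/-! ### The program for the `e`-algorithm -/

namespace Lisp

namespace Code

variable {w h : ℕ}

/-- `(r, (facet, facets))`: impose a constraint on a row. -/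
def imposeRow : Code :=
  ite (comp satisfied (cons (tail (tail id)) (cons (head id) (tail (head (tail id))))))
    (cons (head id) nil)
    (comp sons (cons (tail (tail id)) (cons (head id) (cons (tail (head (tail id)))
      (cons (head (head (tail id))) (tail (tail id)))))))

theorem sem_imposeRow {F H : Fin h → Finset (Fin w)} (hH : ∀ i p, p ∈ H i ↔ p ∉ F i) (r : Row w)
    (i : Fin h) : imposeRow.sem (.cons (encRow r)
      (.cons (encFacet F i) (encList (encFacet F) (List.finRange h)))) =
        encList encRow (impose H i r) := by
  refine Eq.trans (sem_ite (sem_satisfied F r (hH i))) ?_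
  unfold impose
  simp only [decide_eq_true_eq]
  split
  · rfl
  · refine Eq.trans (sem_sons_list hH r i (List.finRange h)) ?_
    rw [List.map_val_finRange]
    rfl

theorem cost_imposeRow : ∃ C, ∀ {w h : ℕ} {F : Fin h → Finset (Fin w)} (r : Row w) (i : Fin h),
    h ≤ 2 ^ w → r.WildcardsLT h → imposeRow.cost (.cons (encRow r)
      (.cons (encFacet F i) (encList (encFacet F) (List.finRange h)))) ≤
        C * ((h + 1) * (w + 1) ^ 3) := by
  obtain ⟨C₁, h₁⟩ := cost_satisfied
  obtain ⟨C₂, h₂⟩ := cost_sons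
  refine ⟨C₁ + C₂ + 100, fun {w h F} r i hh hr => ?_⟩
  have e1 := h₁ F r (F i) hh (List.finRange h)
  have e2 := h₂ (F := F) r i hh hr
  rw [List.length_finRange] at e1
  have m1 : (h + 1) * (w + 1) ^ 2 ≤ (h + 1) * (w + 1) ^ 3 :=
    Nat.mul_le_mul_left _ (Nat.pow_le_pow_right (Nat.succ_pos _) (by omega))
  have m2 : 1 ≤ (h + 1) * (w + 1) ^ 3 := Nat.succ_le_of_lt (by positivity)
  have m3 := Nat.mul_le_mul_left C₁ m1
  refine (cost_ite_le _ _ _ _).trans ?_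
  have k : (cons (tail (tail id)) (cons (head id) (cons (tail (head (tail id)))
      (cons (head (head (tail id))) (tail (tail id)))))).cost (.cons (encRow r)
      (.cons (encFacet F i) (encList (encFacet F) (List.finRange h)))) = 20 := rfl
  change (_ + satisfied.cost (.cons (encList (encFacet F) (List.finRange h))
      (.cons (encRow r) (encSet (F i)))) + 1) + 4 + (_ + sons.cost (.cons
      (encList (encFacet F) (List.finRange h)) (.cons (encRow r) (.cons (encSet (F i))
      (.cons (encNat i) (encList (encFacet F) (List.finRange h)))))) + 1) + 1 ≤ _
  have k' : (cons (tail (tail id)) (cons (head id) (tail (head (tail id))))).cost (.cons (encRow r)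
      (.cons (encFacet F i) (encList (encFacet F) (List.finRange h)))) = 11 := rfl
  rw [k, k', Nat.add_mul, Nat.add_mul]
  omega

/-- `(x, y) ↦ x ++ y`. -/
def append : Code := recur id (tail id) (cons (head id) (tail (tail id)))

theorem sem_append {α : Type*} (enc : α → Val) (l m : List α) :
    append.sem (.cons (encList enc l) (encList enc m)) = encList enc (l ++ m) := by
  induction l with
  | nil => rfl
  | cons a l ih => exact congrArg (Val.cons (enc a)) ih

theorem cost_append {α : Type*} (enc : α → Val) (l : List α) (x : Val) :
    append.cost (.cons (encList enc l) x) ≤ 100 * (l.length + 1) := by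
  refine (cost_recur_le enc (fun _ _ => True) 1 10 (fun s _ => le_rfl)
    (fun a l s _ => ⟨trivial, ?_⟩) l x trivial).trans (by omega)
  exact cost_add_cost_le _ rfl _ rfl (by decide) _ _

/-- `(rows, (facet, facets))`: impose a constraint on all rows. -/
def imposeRows : Code :=
  recur nil (tail id) (comp append (cons (comp imposeRow (cons (head id) (head (tail id))))
    (tail (tail id))))

theorem sem_imposeRows {F H : Fin h → Finset (Fin w)} (hH : ∀ i p, p ∈ H i ↔ p ∉ F i)
    (i : Fin h) (rows : List (Row w)) : imposeRows.sem (.cons (encList encRow rows)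
      (.cons (encFacet F i) (encList (encFacet F) (List.finRange h)))) =
        encList encRow (rows.flatMap (impose H i)) := by
  induction rows with
  | nil => rfl
  | cons r rows ih =>
    rw [List.flatMap_cons, ← sem_append, ← ih, ← sem_imposeRow hH]
    rfl

theorem cost_imposeRows : ∃ C, ∀ {w h : ℕ} {F H : Fin h → Finset (Fin w)}
    (_ : ∀ i p, p ∈ H i ↔ p ∉ F i) (i : Fin h), h ≤ 2 ^ w → ∀ rows : List (Row w),
      (∀ r ∈ rows, r.WildcardsLT h) → imposeRows.cost (.cons (encList encRow rows)
        (.cons (encFacet F i) (encList (encFacet F) (List.finRange h)))) ≤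
          C * ((rows.length + 1) * ((h + 1) * (w + 1) ^ 3)) := by
  obtain ⟨C, hC⟩ := cost_imposeRow
  refine ⟨C + 400, fun {w h F H} hH i hh rows hrows => ?_⟩
  refine (cost_recur_le encRow (fun rows s => s = .cons (encFacet F i)
      (encList (encFacet F) (List.finRange h)) ∧ ∀ r ∈ rows, r.WildcardsLT h)
    1 (C * ((h + 1) * (w + 1) ^ 3) + 100 * (h + 2) + 50) ?_ ?_ rows _ ⟨rfl, hrows⟩).trans ?_
  · rintro s -; exact le_rfl
  · rintro r rows s ⟨rfl, hr⟩
    refine ⟨⟨rfl, fun r' hr' => hr r' (List.mem_cons_of_mem _ hr')⟩, ?_⟩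
    have e1 := hC (F := F) r i hh (hr r List.mem_cons_self)
    have e2 := fun x => cost_append encRow (impose H i r) x
    rw [← sem_imposeRow hH] at e2
    have e3 := length_impose_le H i r
    change 2 + ((6 + imposeRow.cost (.cons (encRow r) (.cons (encFacet F i)
      (encList (encFacet F) (List.finRange h)))) + 1 + 3 + 1) +
      append.cost (.cons (imposeRow.sem (.cons (encRow r) (.cons (encFacet F i)
      (encList (encFacet F) (List.finRange h))))) _) + 1) ≤ _
    refine (Nat.add_le_add_left (Nat.add_le_add_right (Nat.add_le_add_left (e2 _) _) _) _).trans ?_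
    omega
  · have m2 : (h + 1) ≤ (h + 1) * (w + 1) ^ 3 := Nat.le_mul_of_pos_right _ (by positivity)
    generalize (h + 1) * (w + 1) ^ 3 = M at *
    have m3 : rows.length * (h + 1) ≤ rows.length * M := Nat.mul_le_mul_left _ m2
    have m4 : rows.length ≤ rows.length * M := Nat.le_mul_of_pos_right _ (by omega)
    have e1 : rows.length * (C * M + 100 * (h + 2) + 50 + 26) =
      C * (rows.length * M) + 100 * (rows.length * (h + 1)) + 176 * rows.length := by ring
    have e2 : (C + 400) * ((rows.length + 1) * M) =
      C * (rows.length * M) + C * M + 400 * (rows.length * M) + 400 * M := by ring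
    rw [e1, e2]
    omega

/-- `(facets, (rows, facets))`: impose all constraints on all rows. -/
def imposeLoop : Code :=
  recur (head id) (cons (comp imposeRows (cons (head (tail id)) (cons (head id)
    (tail (tail id))))) (tail (tail id))) (tail (tail id))

theorem sem_imposeLoop {F H : Fin h → Finset (Fin w)} (hH : ∀ i p, p ∈ H i ↔ p ∉ F i)
    (l : List (Fin h)) : ∀ rows : List (Row w),
      imposeLoop.sem (.cons (encList (encFacet F) l) (.cons (encList encRow rows)
        (encList (encFacet F) (List.finRange h)))) = encList encRow (imposeAll H l rows) := by
  induction l with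
  | nil => intro rows; rfl
  | cons i l ih =>
    intro rows
    refine Eq.trans ?_ (ih (rows.flatMap (impose H i)))
    rw [← sem_imposeRows hH]
    rfl

/-- The invariant records that continuing from the current rows ends with at most the final number
of rows. Since rows stay feasible and do not get lost, the current number of rows is bounded by the
same quantity, uniformly in all rounds. -/
theorem cost_imposeLoop : ∃ C, ∀ {w h : ℕ} {F H : Fin h → Finset (Fin w)}
    (_ : ∀ i p, p ∈ H i ↔ p ∉ F i) (_ : h ≤ 2 ^ w) (l : List (Fin h)) (rows : List (Row w)),
      Pending l rows → (∀ r ∈ rows, r.WildcardsLT h) → (∀ r ∈ rows, Feasible H r) →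
        imposeLoop.cost (.cons (encList (encFacet F) l) (.cons (encList encRow rows)
          (encList (encFacet F) (List.finRange h)))) ≤
            C * ((l.length + 1) * (((imposeAll H l rows).length + 1) *
              ((h + 1) * (w + 1) ^ 3))) := by
  obtain ⟨C, hC⟩ := cost_imposeRows
  refine ⟨C + 100, fun {w h F H} hH hh l rows hp hw hf => ?_⟩
  refine (cost_recur_le (encFacet F) (fun l' s => ∃ rows' : List (Row w),
      s = .cons (encList encRow rows') (encList (encFacet F) (List.finRange h)) ∧
      Pending l' rows' ∧ (∀ r ∈ rows', r.WildcardsLT h) ∧ (∀ r ∈ rows', Feasible H r) ∧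
      (imposeAll H l' rows').length ≤ (imposeAll H l rows).length) 2
    (C * (((imposeAll H l rows).length + 1) * ((h + 1) * (w + 1) ^ 3)) + 50) ?_ ?_ l _
    ⟨rows, rfl, hp, hw, hf, le_rfl⟩).trans ?_
  · rintro s -; exact le_rfl
  · rintro i l' s ⟨rows', rfl, hp', hw', hf', hR⟩
    have hw'' : ∀ r ∈ rows'.flatMap (impose H i), r.WildcardsLT h := fun s hs => by
      obtain ⟨r, hr, hs⟩ := List.mem_flatMap.1 hs
      exact (wildcardsLT_of_mem_impose (hp'.head r hr) hs).mono i.2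
    refine ⟨⟨_, ?_, hp'.flatMap, hw'', feasible_flatMap_impose hf', hR⟩, ?_⟩
    · rw [← sem_imposeRows hH]; rfl
    · have e1 := hC hH i hh rows' hw'
      have e2 := (length_le_length_imposeAll _ _ hp' hf').trans hR
      have e3 : C * ((rows'.length + 1) * ((h + 1) * (w + 1) ^ 3)) ≤
          C * (((imposeAll H l rows).length + 1) * ((h + 1) * (w + 1) ^ 3)) :=
        Nat.mul_le_mul_left _ (Nat.mul_le_mul_right _ (Nat.succ_le_succ e2))
      change ((3 + (2 + 3 + 1) + 1) + imposeRows.cost (.cons (encList encRow rows')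
        (.cons (encFacet F i) (encList (encFacet F) (List.finRange h)))) + 1 + 3 + 1) + 3 ≤ _
      omega
  · have m2 : 1 ≤ ((imposeAll H l rows).length + 1) * ((h + 1) * (w + 1) ^ 3) :=
      Nat.succ_le_of_lt (by positivity)
    generalize ((imposeAll H l rows).length + 1) * ((h + 1) * (w + 1) ^ 3) = M at *
    have m4 : l.length ≤ l.length * M := Nat.le_mul_of_pos_right _ (by omega)
    have e1 : l.length * (C * M + 50 + 26) = C * (l.length * M) + 76 * l.length := by ring
    have e2 : (C + 100) * ((l.length + 1) * M) =
      C * (l.length * M) + C * M + 100 * (l.length * M) + 100 * M := by ring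
    rw [e1, e2]
    omega

/-- `(sets, i)`: number the sets in a list, starting with `i`. -/
def number : Code :=
  recur nil (comp succ (cons (tail id) tt)) (cons (cons (head (tail id)) (head id))
    (tail (tail id)))

/-- The list elements are taken from an interval of natural numbers so that the counter in the state
can be identified with the current element. -/
theorem sem_number_range' (g : ℕ → Val) (m : ℕ) : ∀ c : ℕ,
    number.sem (.cons (encList g (List.range' c m)) (encNat c)) =
      encList (fun i => .cons (encNat i) (g i)) (List.range' c m) := by
  induction m with
  | zero => intro c; rfl
  | succ m ih =>
    intro c
    have e1 : (comp succ (cons (tail id) tt)).sem (.cons (g c) (encNat c)) = encNat (c + 1) :=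
      sem_succ c true
    rw [List.range'_succ, encList, number, recur_cons, e1, ← number, ih]
    rfl

/-- A family on `Fin h` is extended by `nil` to all natural numbers, which permits numbering from an
arbitrary start; the values outside are never read. -/
theorem encFamily_eq_range' {α : Type*} (enc : α → Val) (F : Fin h → α) :
    ∃ g : ℕ → Val, (∀ i : Fin h, g i = enc (F i)) ∧
      encFamily enc F = encList g (List.range' 0 h) := by
  refine ⟨fun i => if hi : i < h then enc (F ⟨i, hi⟩) else .nil, fun i => by simp, ?_⟩
  rw [← List.range_eq_range', ← List.map_val_finRange, encList_map, encFamily, List.ofFn_eq_map,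
    encList_map]
  exact encList_congr fun i _ => by simp

theorem sem_number (F : Fin h → Finset (Fin w)) :
    number.sem (.cons (encFamily encSet F) .nil) = encList (encFacet F) (List.finRange h) := by
  obtain ⟨g, hg, hF⟩ := encFamily_eq_range' encSet F
  rw [hF, ← encNat_zero, sem_number_range', ← List.range_eq_range', ← List.map_val_finRange,
    encList_map]
  exact encList_congr fun i _ => by rw [hg]; rfl

theorem cost_number : ∃ C, ∀ {w h : ℕ} (F : Fin h → Finset (Fin w)), h ≤ 2 ^ w →
    number.cost (.cons (encFamily encSet F) .nil) ≤ C * ((h + 1) * (w + 1)) := by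
  obtain ⟨C, hC⟩ := cost_succ
  refine ⟨C + 100, fun {w h} F hh => ?_⟩
  obtain ⟨g, hg, hF⟩ := encFamily_eq_range' encSet F
  rw [hF]
  refine (cost_recur_le g (fun l s => ∃ c m, l = List.range' c m ∧ s = encNat c ∧ c + m = h)
    1 (C * (w + 1) + 50) ?_ ?_ _ _ ⟨0, h, rfl, encNat_zero.symm, Nat.zero_add h⟩).trans ?_
  · rintro s -; exact le_rfl
  · rintro i l s ⟨c, m, hl, rfl, hcm⟩
    cases m with
    | zero => cases hl
    | succ m =>
      rw [List.range'_succ, List.cons.injEq] at hl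
      obtain ⟨rfl, rfl⟩ := hl
      refine ⟨⟨i + 1, m, rfl, sem_succ i true, by omega⟩, ?_⟩
      have e1 := hC i (encBool true)
      have e2 : i.size ≤ w := Nat.size_le.2 (by omega)
      have e3 : C * (i.size + 1) ≤ C * (w + 1) := Nat.mul_le_mul_left _ (by omega)
      change 2 + 3 + 1 + succ.cost (.cons (encNat i) (encBool true)) + 1 + (3 + 2 + 1 + 3 + 1) ≤ _
      omega
  · rw [List.length_range']
    nlinarith

end Code

end Lisp

/-! ### Counting the members of a row -/

section

variable {w h : ℕ}

/-- The number of `k`-element members of a family. -/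
noncomputable def cnt (A : Set (Finset (Fin w))) (k : ℕ) : ℕ := {X | X ∈ A ∧ X.card = k}.ncard

theorem cardOf_eq_cnt (r : Row w) : r.cardOf = cnt r.members := rfl

theorem cnt_le (A : Set (Finset (Fin w))) (k : ℕ) : cnt A k ≤ 2 ^ w := by
  classical
  refine (Set.ncard_le_card _).trans ?_
  simp

theorem size_cnt_le (A : Set (Finset (Fin w))) (k : ℕ) : (cnt A k).size ≤ w + 1 :=
  Nat.size_le.2 ((cnt_le A k).trans_lt (Nat.pow_lt_pow_right (by omega) (by omega)))

theorem cnt_empty : cnt (∅ : Set (Finset (Fin w))) = fun _ => 0 := by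
  funext k; simp [cnt]

theorem cnt_union {A B : Set (Finset (Fin w))} (h : Disjoint A B) (k : ℕ) :
    cnt (A ∪ B) k = cnt A k + cnt B k := by
  rw [cnt, cnt, cnt, ← Set.ncard_union_eq ?_ (Set.toFinite _) (Set.toFinite _)]
  · congr 1
    ext X
    simp only [Set.mem_union, Set.mem_ofPred_eq]
    tauto
  · rw [Set.disjoint_left] at h ⊢
    exact fun X hX hX' => h hX.1 hX'.1

/-- A sequence shifted by one place. -/
def shifted (f : ℕ → ℕ) : ℕ → ℕ
  | 0 => 0
  | k + 1 => f k

/-- The members of a family are counted according to whether they contain `q`. -/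
theorem cnt_eq_add_shifted {A B C : Set (Finset (Fin w))} (q : Fin w) (hA : ∀ X ∈ A, q ∉ X)
    (hB : ∀ X ∈ B, q ∉ X) (hC : ∀ X, X ∈ C ↔ X ∈ A ∨ q ∈ X ∧ X.erase q ∈ B) (k : ℕ) :
    cnt C k = cnt A k + shifted (cnt B) k := by
  -- Removing `q` is a bijection from the members of `C` that contain `q` onto `B`, inverse to
  -- inserting `q`, and it lowers the size by one.
  have h1 : C = A ∪ (insert q) '' B := by
    ext X
    rw [hC, Set.mem_union, Set.mem_image]
    refine or_congr Iff.rfl ⟨fun ⟨h1, h2⟩ => ⟨_, h2, Finset.insert_erase h1⟩, ?_⟩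
    rintro ⟨Y, hY, rfl⟩
    exact ⟨Finset.mem_insert_self _ _, by rwa [Finset.erase_insert (hB Y hY)]⟩
  have h2 : Disjoint A ((insert q) '' B) := by
    rw [Set.disjoint_left]
    rintro X hX ⟨Y, -, rfl⟩
    exact hA _ hX (Finset.mem_insert_self _ _)
  rw [h1, cnt_union h2]
  congr 1
  have h3 : ∀ k, {X | X ∈ (insert q) '' B ∧ X.card = k} =
      (insert q) '' {X | X ∈ B ∧ X.card + 1 = k} := by
    intro k
    ext X
    simp only [Set.mem_image, Set.mem_ofPred_eq]
    constructor
    · rintro ⟨⟨Y, hY, rfl⟩, hk⟩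
      rw [Finset.card_insert_of_notMem (hB Y hY)] at hk
      exact ⟨Y, ⟨hY, hk⟩, rfl⟩
    · rintro ⟨Y, ⟨hY, hk⟩, rfl⟩
      exact ⟨⟨Y, hY, rfl⟩, by rw [Finset.card_insert_of_notMem (hB Y hY), hk]⟩
  rw [cnt, h3, Set.InjOn.ncard_image]
  · cases k with
    | zero => simp [shifted]
    | succ k => simp only [shifted, cnt, Nat.add_right_cancel_iff]
  · intro X hX Y hY hXY
    rw [← Finset.erase_insert (hB X hX.1), ← Finset.erase_insert (hB Y hY.1)]
    exact congrArg (Finset.erase · q) hXY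

/-- The sets within `D` that contain all `1`s in `D`, and otherwise only positions with `2`. -/
def plainMembers (r : Row w) (D : Finset (Fin w)) : Set (Finset (Fin w)) :=
  {X | (∀ p ∈ X, p ∈ D ∧ (r p = Symb.one ∨ r p = Symb.two)) ∧ ∀ p ∈ D, r p = Symb.one → p ∈ X}

theorem plainMembers_empty (r : Row w) : plainMembers r ∅ = {∅} := by
  ext X
  simp only [plainMembers, Set.mem_ofPred_eq, Finset.notMem_empty, false_and, Set.mem_singleton_iff,
    Finset.eq_empty_iff_forall_notMem]
  simp

theorem cnt_singleton_empty : cnt ({∅} : Set (Finset (Fin w))) = fun k => if k = 0 then 1 else 0 := by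
  funext k
  rw [cnt]
  rcases eq_or_ne k 0 with rfl | hk
  · rw [if_pos rfl, Set.ncard_eq_one]
    exact ⟨∅, by ext X; simp⟩
  · rw [if_neg hk, Set.ncard_eq_zero]
    ext X
    simp only [Set.mem_singleton_iff, Set.mem_ofPred_eq, Set.mem_empty_iff_false, iff_false]
    rintro ⟨rfl, hX⟩
    exact hk (by simpa using hX.symm)

theorem plainMembers_insert_of_ne {r : Row w} {D : Finset (Fin w)} {q : Fin w}
    (h1 : r q ≠ Symb.one) (h2 : r q ≠ Symb.two) :
    plainMembers r (insert q D) = plainMembers r D := by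
  ext X
  simp only [plainMembers, Set.mem_ofPred_eq, Finset.mem_insert]
  constructor
  · rintro ⟨ha, hb⟩
    refine ⟨fun p hp => ⟨(ha p hp).1.resolve_left ?_, (ha p hp).2⟩, fun p hp => hb p (.inr hp)⟩
    rintro rfl
    exact (ha p hp).2.elim h1 h2
  · rintro ⟨ha, hb⟩
    refine ⟨fun p hp => ⟨.inr (ha p hp).1, (ha p hp).2⟩, ?_⟩
    rintro p (rfl | hp) hr
    · exact (h1 hr).elim
    · exact hb p hp hr

/-- A free position multiplies the generating polynomial by `1 + x`. -/
theorem cnt_plainMembers_insert_two {r : Row w} {D : Finset (Fin w)} {q : Fin w} (hq : q ∉ D)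
    (h2 : r q = Symb.two) (k : ℕ) : cnt (plainMembers r (insert q D)) k =
      cnt (plainMembers r D) k + shifted (cnt (plainMembers r D)) k := by
  have hA : ∀ X ∈ plainMembers r D, q ∉ X := fun X hX hqX => hq (hX.1 q hqX).1
  refine cnt_eq_add_shifted q hA hA (fun X => ?_) k
  simp only [plainMembers, Set.mem_ofPred_eq, Finset.mem_insert, Finset.mem_erase]
  by_cases hqX : q ∈ X
  · constructor
    · rintro ⟨ha, hb⟩
      refine .inr ⟨hqX, fun p hp => ⟨(ha p hp.2).1.resolve_left hp.1, (ha p hp.2).2⟩,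
        fun p hp hr => ⟨?_, hb p (.inr hp) hr⟩⟩
      rintro rfl
      exact hq hp
    · rintro (⟨ha, hb⟩ | ⟨-, ha, hb⟩)
      · exact (hq (ha q hqX).1).elim
      · refine ⟨fun p hp => ?_, ?_⟩
        · by_cases hpq : p = q
          · exact ⟨.inl hpq, .inr (hpq ▸ h2)⟩
          · exact ⟨.inr (ha p ⟨hpq, hp⟩).1, (ha p ⟨hpq, hp⟩).2⟩
        · rintro p (rfl | hp) hr
          · exact hqX
          · exact (hb p hp hr).2
  · constructor
    · rintro ⟨ha, hb⟩
      refine .inl ⟨fun p hp => ⟨(ha p hp).1.resolve_left ?_, (ha p hp).2⟩,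
        fun p hp => hb p (.inr hp)⟩
      rintro rfl
      exact hqX hp
    · rintro (⟨ha, hb⟩ | ⟨h, -⟩)
      · refine ⟨fun p hp => ⟨.inr (ha p hp).1, (ha p hp).2⟩, ?_⟩
        rintro p (rfl | hp) hr
        · rw [h2] at hr; cases hr
        · exact hb p hp hr
      · exact (hqX h).elim

/-- A forced position multiplies the generating polynomial by `x`. The summand `0` is kept because
the program performs this shift as a shifted addition to the zero vector. -/
theorem cnt_plainMembers_insert_one {r : Row w} {D : Finset (Fin w)} {q : Fin w} (hq : q ∉ D)
    (h1 : r q = Symb.one) (k : ℕ) : cnt (plainMembers r (insert q D)) k =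
      0 + shifted (cnt (plainMembers r D)) k := by
  have hA : ∀ X ∈ plainMembers r D, q ∉ X := fun X hX hqX => hq (hX.1 q hqX).1
  rw [cnt_eq_add_shifted (A := ∅) q (fun X hX => hX.elim) hA (fun X => ?_) k, cnt_empty]
  simp only [plainMembers, Set.mem_ofPred_eq, Finset.mem_insert, Finset.mem_erase,
    Set.mem_empty_iff_false, false_or]
  constructor
  · rintro ⟨ha, hb⟩
    refine ⟨hb q (.inl rfl) h1, fun p hp => ⟨(ha p hp.2).1.resolve_left hp.1, (ha p hp.2).2⟩,
      fun p hp hr => ⟨?_, hb p (.inr hp) hr⟩⟩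
    rintro rfl
    exact hq hp
  · rintro ⟨hqX, ha, hb⟩
    refine ⟨fun p hp => ?_, ?_⟩
    · by_cases hpq : p = q
      · exact ⟨.inl hpq, .inl (hpq ▸ h1)⟩
      · exact ⟨.inr (ha p ⟨hpq, hp⟩).1, (ha p ⟨hpq, hp⟩).2⟩
    · rintro p (rfl | hp) hr
      · exact hqX
      · exact (hb p hp hr).2

/-- The sets that satisfy the conditions of the row for `0`, `1` and the wildcards below `j`, and
contain no position of the other wildcards. -/
def membersBelow (r : Row w) (j : ℕ) : Set (Finset (Fin w)) :=
  {X | (∀ p, r p = Symb.zero → p ∉ X) ∧ (∀ p, r p = Symb.one → p ∈ X) ∧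
    (∀ p ∈ X, ∀ i, r p = Symb.e i → i < j) ∧
    ∀ p i, r p = Symb.e i → i < j → ∃ q ∈ X, r q = Symb.e i}

theorem plainMembers_univ (r : Row w) : plainMembers r Finset.univ = membersBelow r 0 := by
  ext X
  simp only [plainMembers, membersBelow, Set.mem_ofPred_eq, Finset.mem_univ, true_and,
    Nat.not_lt_zero, forall_true_left, IsEmpty.forall_iff, implies_true, and_true]
  constructor
  · rintro ⟨ha, hb⟩
    refine ⟨fun p hp hpX => ?_, hb, fun p hpX i hp => ?_⟩ <;>
      rcases ha p hpX with h | h <;> rw [hp] at h <;> cases h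
  · rintro ⟨h0, h1, h2⟩
    refine ⟨fun p hp => ?_, h1⟩
    cases hr : r p with
    | zero => exact (h0 p hr hp).elim
    | one => exact .inl rfl
    | two => exact .inr rfl
    | e i => exact (h2 p hp i hr).elim

theorem membersBelow_eq_members {r : Row w} (hr : r.WildcardsLT h) :
    membersBelow r h = r.members := by
  ext X
  rw [Row.mem_members]
  constructor
  · rintro ⟨h0, h1, -, h2⟩
    exact ⟨h0, h1, fun p j hp => h2 p j hp (hr p j hp)⟩
  · rintro ⟨h0, h1, h2⟩
    exact ⟨h0, h1, fun p _ i hp => hr p i hp, fun p j hp _ => h2 p j hp⟩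

/-- The sets that satisfy the conditions for `membersBelow r (j + 1)`, where the wildcard `j` is
replaced by `0` outside `D`. -/
def membersWithin (r : Row w) (j : ℕ) (D : Finset (Fin w)) : Set (Finset (Fin w)) :=
  {X | (∀ p ∈ X, r p = Symb.e j → p ∈ D) ∧ (∃ p ∈ X, r p = Symb.e j) ∧
    (X.filter fun p => r p ≠ Symb.e j) ∈ membersBelow r j}

theorem membersWithin_empty (r : Row w) (j : ℕ) : membersWithin r j ∅ = ∅ := by
  ext X
  simp only [membersWithin, Set.mem_ofPred_eq, Set.mem_empty_iff_false, iff_false]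
  rintro ⟨h1, ⟨p, hp, hpj⟩, -⟩
  exact absurd (h1 p hp hpj) (Finset.notMem_empty p)

theorem not_mem_of_mem_membersBelow {r : Row w} {j : ℕ} {X : Finset (Fin w)}
    (hX : X ∈ membersBelow r j) {p : Fin w} (hp : r p = Symb.e j) : p ∉ X :=
  fun hpX => lt_irrefl j (hX.2.2.1 p hpX j hp)

theorem disjoint_membersWithin_membersBelow (r : Row w) (j : ℕ) (D : Finset (Fin w)) :
    Disjoint (membersWithin r j D) (membersBelow r j) := by
  rw [Set.disjoint_left]
  rintro X ⟨-, ⟨p, hp, hpj⟩, -⟩ hX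
  exact not_mem_of_mem_membersBelow hX hpj hp

/-- A set that contains the new position `q` of the bubble is free in the rest: without `q` it
either still meets the bubble, within `D`, or contains no position of it at all and belongs to
`membersBelow r j`. With generating polynomials `b` and `p` of these families, `b` becomes `b + x (b
+ p)`. -/
theorem cnt_membersWithin_insert {r : Row w} {j : ℕ} {D : Finset (Fin w)} {q : Fin w}
    (hq : q ∉ D) (hj : r q = Symb.e j) (k : ℕ) :
    cnt (membersWithin r j (insert q D)) k = cnt (membersWithin r j D) k +
      shifted (fun k => cnt (membersWithin r j D) k + cnt (membersBelow r j) k) k := by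
  have h1 : (fun k => cnt (membersWithin r j D) k + cnt (membersBelow r j) k) =
      cnt (membersWithin r j D ∪ membersBelow r j) :=
    funext fun k => (cnt_union (disjoint_membersWithin_membersBelow r j D) k).symm
  rw [h1]
  have hA : ∀ X ∈ membersWithin r j D, q ∉ X := fun X hX hqX => hq (hX.1 q hqX hj)
  refine cnt_eq_add_shifted q hA ?_ (fun X => ?_) k
  · rintro X (hX | hX)
    · exact hA X hX
    · exact not_mem_of_mem_membersBelow hX hj
  have hf : ((X.erase q).filter fun p => r p ≠ Symb.e j) = X.filter fun p => r p ≠ Symb.e j := by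
    ext p
    simp only [Finset.mem_filter, Finset.mem_erase]
    constructor
    · rintro ⟨⟨-, h1⟩, h2⟩; exact ⟨h1, h2⟩
    · rintro ⟨h1, h2⟩; exact ⟨⟨fun h => h2 (h ▸ hj), h1⟩, h2⟩
  by_cases hqX : q ∈ X
  · constructor
    · rintro ⟨ha, -, hc⟩
      refine .inr ⟨hqX, ?_⟩
      by_cases hp : ∃ p ∈ X.erase q, r p = Symb.e j
      · refine .inl ⟨fun p hp hpj => ?_, hp, by rwa [hf]⟩
        exact (Finset.mem_insert.1 (ha p (Finset.mem_of_mem_erase hp) hpj)).resolve_left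
          (Finset.ne_of_mem_erase hp)
      · push Not at hp
        refine .inr ?_
        rw [← hf, Finset.filter_true_of_mem hp] at hc
        exact hc
    · rintro (hX | ⟨-, hX | hX⟩)
      · exact (hA X hX hqX).elim
      · refine ⟨fun p hp hpj => ?_, ⟨q, hqX, hj⟩, by rw [← hf]; exact hX.2.2⟩
        by_cases hpq : p = q
        · exact hpq ▸ Finset.mem_insert_self _ _
        · exact Finset.mem_insert_of_mem (hX.1 p (Finset.mem_erase.2 ⟨hpq, hp⟩) hpj)
      · have hn : ∀ p ∈ X.erase q, r p ≠ Symb.e j :=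
          fun p hp hpj => not_mem_of_mem_membersBelow hX hpj hp
        refine ⟨fun p hp hpj => ?_, ⟨q, hqX, hj⟩, ?_⟩
        · by_cases hpq : p = q
          · exact hpq ▸ Finset.mem_insert_self _ _
          · exact (hn p (Finset.mem_erase.2 ⟨hpq, hp⟩) hpj).elim
        · rw [← hf, Finset.filter_true_of_mem hn]; exact hX
  · constructor
    · rintro ⟨ha, hb, hc⟩
      refine .inl ⟨fun p hp hpj => (Finset.mem_insert.1 (ha p hp hpj)).resolve_left ?_, hb, hc⟩
      rintro rfl
      exact hqX hp
    · rintro (⟨ha, hb, hc⟩ | ⟨h, -⟩)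
      · exact ⟨fun p hp hpj => Finset.mem_insert_of_mem (ha p hp hpj), hb, hc⟩
      · exact (hqX h).elim

/-- Once `D` holds the whole bubble, no position of it is forced to be absent, so the condition of
wildcard `j` is the ordinary one. -/
theorem membersWithin_eq_membersBelow_succ {r : Row w} {j : ℕ} {D : Finset (Fin w)}
    (hD : ∀ p, r p = Symb.e j → p ∈ D) (hj : ∃ p, r p = Symb.e j) :
    membersWithin r j D = membersBelow r (j + 1) := by
  ext X
  simp only [membersWithin, membersBelow, Set.mem_ofPred_eq, Finset.mem_filter]
  constructor
  · rintro ⟨-, ⟨q, hq, hqj⟩, h0, h1, h2, h3⟩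
    refine ⟨fun p hp hpX => h0 p hp ⟨hpX, by rw [hp]; exact Symb.noConfusion⟩,
      fun p hp => (h1 p hp).1, fun p hp i hpi => ?_, fun p i hpi hi => ?_⟩
    · by_cases hij : i = j
      · omega
      · exact Nat.lt_succ_of_lt (h2 p ⟨hp, by rw [hpi]; simpa using hij⟩ i hpi)
    · by_cases hij : i = j
      · exact ⟨q, hq, hij ▸ hqj⟩
      · obtain ⟨x, hx, hxi⟩ := h3 p i hpi (by omega)
        exact ⟨x, hx.1, hxi⟩
  · rintro ⟨h0, h1, h2, h3⟩
    obtain ⟨p, hp⟩ := hj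
    refine ⟨fun p _ => hD p, h3 p j hp (by omega), fun p hp hpX => h0 p hp hpX.1,
      fun p hp => ⟨h1 p hp, by rw [hp]; exact Symb.noConfusion⟩, fun p hp i hpi => ?_,
      fun p i hpi hi => ?_⟩
    · have := h2 p hp.1 i hpi
      refine lt_of_le_of_ne (by omega) ?_
      rintro rfl
      exact hp.2 hpi
    · obtain ⟨x, hx, hxi⟩ := h3 p i hpi (by omega)
      refine ⟨x, ⟨hx, ?_⟩, hxi⟩
      rw [hxi]
      simp only [ne_eq, Symb.e.injEq]
      omega

theorem membersBelow_succ_eq {r : Row w} {j : ℕ} (hj : ∀ p, r p ≠ Symb.e j) :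
    membersBelow r (j + 1) = membersBelow r j := by
  ext X
  refine and_congr Iff.rfl (and_congr Iff.rfl (and_congr ?_ ?_))
  · refine forall₂_congr fun p _ => forall₂_congr fun i hi => ?_
    have : i ≠ j := fun h => hj p (h ▸ hi)
    omega
  · refine forall₂_congr fun p i => forall_congr' fun hi => ?_
    have h1 : i ≠ j := fun h => hj p (h ▸ hi)
    have h2 : i < j + 1 ↔ i < j := by omega
    rw [h2]

theorem members_twos (w : ℕ) : Row.members (fun _ : Fin w => Symb.two) = Set.univ := by
  ext X; simp [Row.mem_members]

/-- The program has no separate routine for binomial coefficients: it obtains them by counting the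
members of the row of `2`s. -/
theorem cardOf_twos (w k : ℕ) : Row.cardOf (fun _ : Fin w => Symb.two) k = w.choose k := by
  have h1 : ((Finset.univ : Finset (Fin w)).powersetCard k).card = w.choose k := by simp
  rw [Row.cardOf, members_twos, ← h1, ← Set.ncard_coe_finset]
  congr 1
  ext X
  simp only [Set.mem_univ, true_and, Set.mem_ofPred_eq, Finset.mem_coe,
    Finset.mem_powersetCard_univ]

end

/-! ### Programs for vectors of counts -/

namespace Lisp

/-- The numbers `f 0, …, f w`. -/
def vec (w : ℕ) (f : ℕ → ℕ) : Val := encList (fun k => encNat (f k)) (List.range (w + 1))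

/-- Putting a zero in front multiplies the polynomial by `x`. The entry pushed beyond index `w` is
harmless, since `zip` stops with its first list. -/
theorem cons_nil_vec (w : ℕ) (f : ℕ → ℕ) : Val.cons .nil (vec w f) =
    encList (fun k => encNat (shifted f k)) (List.range (w + 1) ++ [w + 1]) := by
  rw [← List.range_succ, List.range_succ_eq_map, encList, encList_map]
  congr 1

theorem tail_vec (w : ℕ) (f : ℕ → ℕ) :
    (vec w f).tail = encFamily encNat fun k : Fin w => f (k + 1) := by
  rw [vec, List.range_succ_eq_map, encList, Val.tail_cons, encList_map, encFamily,
    List.ofFn_eq_map, encList_map, ← List.map_val_finRange, encList_map]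

namespace Code

variable {w h : ℕ}

/-- Apply `f` entry by entry; `f` sees `(a, (b, nil))`. -/
def zip (f : Code) : Code :=
  recur nil (tail (tail id)) (cons (comp f (cons (head id) (cons (head (head (tail id))) nil)))
    (tail (tail id)))

theorem sem_zip {f : Code} {α : Type*} {a b c : α → Val} (l l' : List α)
    (hf : ∀ k ∈ l, f.sem (.cons (a k) (.cons (b k) .nil)) = c k) :
    (zip f).sem (.cons (encList a l) (encList b (l ++ l'))) = encList c l := by
  induction l with
  | nil => rfl
  | cons k l ih =>
    change _ = Val.cons (c k) (encList c l)
    rw [← hf k List.mem_cons_self, ← ih fun j hj => hf j (List.mem_cons_of_mem _ hj)]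
    rfl

theorem cost_zip {f : Code} {α : Type*} {a b : α → Val} {B : ℕ} (l l' : List α)
    (hf : ∀ k ∈ l, f.cost (.cons (a k) (.cons (b k) .nil)) ≤ B) :
    (zip f).cost (.cons (encList a l) (encList b (l ++ l'))) ≤ (l.length + 1) * (B + 50) := by
  refine (cost_recur_le a (fun m s => s = encList b (m ++ l') ∧ ∀ k ∈ m, k ∈ l) 1 (B + 20)
    (fun s _ => le_rfl) ?_ l _ ⟨rfl, fun _ hk => hk⟩).trans (by nlinarith)
  rintro k m s ⟨rfl, hm⟩
  refine ⟨⟨rfl, fun j hj => hm j (List.mem_cons_of_mem _ hj)⟩, ?_⟩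
  have := hf k (hm k List.mem_cons_self)
  change 3 + (_ + f.cost (.cons (a k) (.cons (b k) .nil)) + 1 + 3 + 1) ≤ _
  have h1 : ∀ v, (cons (head id) (cons (head (head (tail id))) nil)).cost v = 9 := fun _ => rfl
  rw [h1]
  omega

/-- The vector `k ↦ a k + b (k - 1)`, from `(a, b)`. -/
def shiftAdd : Code := comp (zip add) (cons (head id) (cons nil (tail id)))

theorem sem_vadd (f g : ℕ → ℕ) :
    (zip add).sem (.cons (vec w f) (vec w g)) = vec w (fun k => f k + g k) := by
  have := sem_zip (f := add) (a := fun k => encNat (f k)) (b := fun k => encNat (g k))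
    (c := fun k => encNat (f k + g k)) (List.range (w + 1)) []
    fun k _ => sem_add (f k) (g k) false
  rwa [List.append_nil] at this

theorem sem_shiftAdd (f g : ℕ → ℕ) :
    shiftAdd.sem (.cons (vec w f) (vec w g)) = vec w (fun k => f k + shifted g k) := by
  refine Eq.trans ?_ (sem_zip (f := add) (a := fun k => encNat (f k))
    (b := fun k => encNat (shifted g k)) (c := fun k => encNat (f k + shifted g k))
    (List.range (w + 1)) [w + 1] fun k _ => sem_add (f k) (shifted g k) false)
  rw [← cons_nil_vec]
  rfl

theorem sem_vsub (f g : ℕ → ℕ) (hfg : ∀ k, g k ≤ f k) :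
    (zip sub).sem (.cons (vec w f) (vec w g)) = vec w (fun k => f k - g k) := by
  have := sem_zip (f := sub) (a := fun k => encNat (f k)) (b := fun k => encNat (g k))
    (c := fun k => encNat (f k - g k)) (List.range (w + 1)) []
    fun k _ => sem_sub (f k) (g k) false (hfg k)
  rwa [List.append_nil] at this

/-- There are `w + 1` additions. The allowance of `w + 2` bits covers counts, which are at most
`2^w`, and sums of two of them, which occur as second arguments when a bubble is counted. -/
theorem cost_vadd_append : ∃ C, ∀ {w : ℕ} (f g : ℕ → ℕ) (l' : List ℕ),
    (∀ k, (f k).size ≤ w + 2) → (∀ k, (g k).size ≤ w + 2) →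
      (zip add).cost (.cons (vec w f)
        (encList (fun k => encNat (g k)) (List.range (w + 1) ++ l'))) ≤ C * (w + 1) ^ 2 := by
  obtain ⟨C, hC⟩ := cost_add
  refine ⟨2 * (5 * C + 50), fun {w} f g l' hf hg => ?_⟩
  refine (cost_zip (B := 5 * C * (w + 1)) (List.range (w + 1)) l' fun k _ => ?_).trans ?_
  · refine (hC (f k) (g k) .nil).trans ?_
    have := hf k
    have := hg k
    calc C * ((f k).size + (g k).size + 1) ≤ C * (5 * (w + 1)) := Nat.mul_le_mul_left _ (by omega)
      _ = _ := by ring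
  · rw [List.length_range]
    calc (w + 1 + 1) * (5 * C * (w + 1) + 50) ≤ (2 * (w + 1)) * ((5 * C + 50) * (w + 1)) :=
        Nat.mul_le_mul (by omega) (by rw [Nat.add_mul]; omega)
      _ = _ := by ring

theorem cost_vadd : ∃ C, ∀ {w : ℕ} (f g : ℕ → ℕ),
    (∀ k, (f k).size ≤ w + 2) → (∀ k, (g k).size ≤ w + 2) →
      (zip add).cost (.cons (vec w f) (vec w g)) ≤ C * (w + 1) ^ 2 := by
  obtain ⟨C, hC⟩ := cost_vadd_append
  refine ⟨C, fun {w} f g hf hg => ?_⟩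
  have := hC f g [] hf hg
  rwa [List.append_nil] at this

theorem cost_shiftAdd : ∃ C, ∀ {w : ℕ} (f g : ℕ → ℕ),
    (∀ k, (f k).size ≤ w + 2) → (∀ k, (g k).size ≤ w + 2) →
      shiftAdd.cost (.cons (vec w f) (vec w g)) ≤ C * (w + 1) ^ 2 := by
  obtain ⟨C, hC⟩ := cost_vadd_append
  refine ⟨C + 10, fun {w} f g hf hg => ?_⟩
  have h1 := hC f (shifted g) [w + 1] hf fun k => by
    cases k with
    | zero => simp [shifted]
    | succ k => exact hg k
  rw [← cons_nil_vec] at h1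
  have h2 : 1 ≤ (w + 1) ^ 2 := Nat.one_le_pow _ _ (by omega)
  change 2 + (1 + 2 + 1) + 1 + (zip add).cost (.cons (vec w f) (.cons .nil (vec w g))) + 1 ≤ _
  rw [Nat.add_mul]
  omega

theorem cost_vsub : ∃ C, ∀ {w : ℕ} (f g : ℕ → ℕ), (∀ k, (f k).size ≤ w + 2) →
    (zip sub).cost (.cons (vec w f) (vec w g)) ≤ C * (w + 1) ^ 2 := by
  obtain ⟨C, hC⟩ := cost_sub
  refine ⟨2 * (3 * C + 50), fun {w} f g hf => ?_⟩
  have := cost_zip (f := sub) (a := fun k => encNat (f k)) (b := fun k => encNat (g k))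
    (B := 3 * C * (w + 1)) (List.range (w + 1)) [] fun k _ => by
      refine (hC (f k) _).trans ?_
      have := hf k
      calc C * ((f k).size + 1) ≤ C * (3 * (w + 1)) := Nat.mul_le_mul_left _ (by omega)
        _ = _ := by ring
  rw [List.append_nil, List.length_range] at this
  refine this.trans ?_
  nlinarith

/-! #### The numbers `Card(r, k)` -/

/-- The step of `plain`: `(symbol, (p, zeros))` becomes the new vector `p`. -/
def plainStep : Code :=
  ite (head (head id)) (head (tail id)) (ite (head id)
    (comp shiftAdd (cons (ite (tail (head id)) (head (tail id)) (tail (tail id)))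
      (head (tail id)))) (head (tail id)))

/-- `(r, (p, zeros))`: count the sets compatible with the symbols `0`, `1`, `2`. -/
def plain : Code := recur (head id) (cons plainStep (tail (tail id))) (tail (tail id))

theorem sem_plainStep (r : Row w) (D : Finset (Fin w)) {q : Fin w} (hq : q ∉ D) :
    plainStep.sem (.cons (encSymb (r q)) (.cons (vec w (cnt (plainMembers r D)))
      (vec w fun _ => 0))) = vec w (cnt (plainMembers r (insert q D))) := by
  cases hr : r q with
  | zero =>
    rw [plainMembers_insert_of_ne (by rw [hr]; exact Symb.noConfusion)
      (by rw [hr]; exact Symb.noConfusion)]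
    rfl
  | one =>
    rw [funext (cnt_plainMembers_insert_one hq hr), ← sem_shiftAdd]
    rfl
  | two =>
    rw [funext (cnt_plainMembers_insert_two hq hr), ← sem_shiftAdd]
    rfl
  | e j =>
    rw [plainMembers_insert_of_ne (by rw [hr]; exact Symb.noConfusion)
      (by rw [hr]; exact Symb.noConfusion)]
    rfl

/-- `D` is the set of positions already read. That the remaining list is free of repetitions and
disjoint from `D` lets each symbol enter the count once. -/
theorem sem_plain_list (r : Row w) (L : List (Fin w)) : ∀ D : Finset (Fin w), L.Nodup →
    (∀ q ∈ L, q ∉ D) → plain.sem (.cons (rowOn r L) (.cons (vec w (cnt (plainMembers r D)))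
      (vec w fun _ => 0))) = vec w (cnt (plainMembers r (D ∪ L.toFinset))) := by
  induction L with
  | nil => intro D _ _; simp [rowOn, encList, plain, recur_nil, sem, Val.head]
  | cons q L ih =>
    intro D hL hD
    rw [List.nodup_cons] at hL
    rw [List.toFinset_cons, Finset.union_insert, ← Finset.insert_union, ← ih (insert q D) hL.2 ?_,
      ← sem_plainStep r D (hD q List.mem_cons_self)]
    · rfl
    · intro p hp hpD
      rcases Finset.mem_insert.1 hpD with rfl | hpD
      · exact hL.1 hp
      · exact hD p (List.mem_cons_of_mem _ hp) hpD

theorem sem_plain (r : Row w) : plain.sem (.cons (encRow r) (.cons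
    (vec w fun k => if k = 0 then 1 else 0) (vec w fun _ => 0))) =
      vec w (cnt (membersBelow r 0)) := by
  rw [← plainMembers_univ, ← cnt_singleton_empty (w := w), ← plainMembers_empty r, encRow_eq,
    sem_plain_list r _ ∅ (List.nodup_finRange w) (fun _ _ => Finset.notMem_empty _)]
  simp

theorem cost_plain : ∃ C, ∀ {w : ℕ} (r : Row w), plain.cost (.cons (encRow r) (.cons
    (vec w fun k => if k = 0 then 1 else 0) (vec w fun _ => 0))) ≤ C * (w + 1) ^ 3 := by
  obtain ⟨C, hC⟩ := cost_shiftAdd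
  refine ⟨C + 100, fun {w} r => ?_⟩
  rw [← cnt_singleton_empty (w := w), ← plainMembers_empty r, encRow_eq]
  have hs : ∀ D k, (cnt (plainMembers r D) k).size ≤ w + 2 := fun D k =>
    (size_cnt_le _ k).trans (by omega)
  refine (cost_recur_le (fun p => encSymb (r p)) (fun l s => ∃ D : Finset (Fin w),
    s = .cons (vec w (cnt (plainMembers r D))) (vec w fun _ => 0) ∧ l.Nodup ∧ ∀ q ∈ l, q ∉ D) 2
    (C * (w + 1) ^ 2 + 60) (fun s _ => le_rfl) ?_ (List.finRange w) _
    ⟨∅, rfl, List.nodup_finRange w, fun _ _ => Finset.notMem_empty _⟩).trans ?_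
  · rintro q l s ⟨D, rfl, hl, hD⟩
    rw [List.nodup_cons] at hl
    refine ⟨⟨insert q D, ?_, hl.2, ?_⟩, ?_⟩
    · rw [← sem_plainStep r D (hD q List.mem_cons_self)]; rfl
    · intro p hp hpD
      rcases Finset.mem_insert.1 hpD with rfl | hpD
      · exact hl.1 hp
      · exact hD p (List.mem_cons_of_mem _ hp) hpD
    · have key : plainStep.cost (.cons (encSymb (r q)) (.cons (vec w (cnt (plainMembers r D)))
          (vec w fun _ => 0))) ≤ C * (w + 1) ^ 2 + 40 := by
        cases hr : r q with
        | zero => exact (Nat.le_of_ble_eq_true rfl : _ ≤ 40).trans (Nat.le_add_left _ _)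
        | one =>
          have := hC (w := w) (fun _ => 0) (cnt (plainMembers r D)) (by simp) (hs D)
          change 3 + (2 + (((3 + 3 + 1) + 3 + 1) + shiftAdd.cost (.cons (vec w fun _ => 0)
            (vec w (cnt (plainMembers r D)))) + 1) + 1) + 1 ≤ _
          omega
        | two =>
          have := hC (w := w) (cnt (plainMembers r D)) (cnt (plainMembers r D)) (hs D) (hs D)
          change 3 + (2 + (((3 + 3 + 1) + 3 + 1) + shiftAdd.cost (.cons
            (vec w (cnt (plainMembers r D))) (vec w (cnt (plainMembers r D)))) + 1) + 1) + 1 ≤ _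
          omega
        | e j => exact (Nat.le_of_ble_eq_true rfl : _ ≤ 40).trans (Nat.le_add_left _ _)
      change (plainStep.cost (.cons (encSymb (r q)) (.cons (vec w (cnt (plainMembers r D)))
          (vec w fun _ => 0))) + 3 + 1) + 3 ≤ _
      omega
  · rw [List.length_finRange]
    have h1 : w * (C * (w + 1) ^ 2) + C * (w + 1) ^ 2 = C * (w + 1) ^ 3 := by ring
    have h2 : w + 1 ≤ (w + 1) ^ 3 := Nat.le_self_pow (by omega) _
    nlinarith

/-- `(positions, (b, p))`: count the sets that moreover meet the given wildcard. -/
def wild : Code :=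
  recur (head id) (cons (comp shiftAdd (cons (head (tail id)) (comp (zip add) (tail id))))
    (tail (tail id))) (tail (tail id))

theorem sem_wild_list (r : Row w) (j : ℕ) (L : List (Fin w)) : ∀ D : Finset (Fin w), L.Nodup →
    (∀ q ∈ L, q ∉ D ∧ r q = Symb.e j) → wild.sem (.cons (blanks L)
      (.cons (vec w (cnt (membersWithin r j D))) (vec w (cnt (membersBelow r j))))) =
        vec w (cnt (membersWithin r j (D ∪ L.toFinset))) := by
  induction L with
  | nil => intro D _ _; simp [blanks, encList, wild, recur_nil, sem, Val.head]
  | cons q L ih =>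
    intro D hL hD
    rw [List.nodup_cons] at hL
    rw [List.toFinset_cons, Finset.union_insert, ← Finset.insert_union, ← ih (insert q D) hL.2 ?_,
      funext (cnt_membersWithin_insert (hD q List.mem_cons_self).1 (hD q List.mem_cons_self).2),
      ← sem_shiftAdd, ← sem_vadd]
    · rfl
    · intro p hp
      refine ⟨fun hpD => ?_, (hD p (List.mem_cons_of_mem _ hp)).2⟩
      rcases Finset.mem_insert.1 hpD with rfl | hpD
      · exact hL.1 hp
      · exact (hD p (List.mem_cons_of_mem _ hp)).1 hpD

/-- Each position of the bubble costs two vector additions, quadratic in `w` each, and a bubble has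
at most `w` positions. -/
theorem cost_wild_list : ∃ C, ∀ {w : ℕ} (r : Row w) (j : ℕ) (L : List (Fin w)), L.Nodup →
    (∀ q ∈ L, r q = Symb.e j) → wild.cost (.cons (blanks L)
      (.cons (vec w fun _ => 0) (vec w (cnt (membersBelow r j))))) ≤ C * (w + 1) ^ 3 := by
  obtain ⟨C₁, h₁⟩ := cost_shiftAdd
  obtain ⟨C₂, h₂⟩ := cost_vadd
  refine ⟨C₁ + C₂ + 100, fun {w} r j L hL hj => ?_⟩
  have e0 : (vec w fun _ => 0) = vec w (cnt (membersWithin r j ∅)) := by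
    rw [membersWithin_empty, cnt_empty]
  rw [e0]
  refine (cost_recur_le (fun _ : Fin w => Val.nil) (fun l s => ∃ D : Finset (Fin w),
    s = .cons (vec w (cnt (membersWithin r j D))) (vec w (cnt (membersBelow r j))) ∧
      l.Nodup ∧ ∀ q ∈ l, q ∉ D ∧ r q = Symb.e j) 2
    (C₁ * (w + 1) ^ 2 + C₂ * (w + 1) ^ 2 + 40) (fun s _ => le_rfl) ?_ L _
    ⟨∅, rfl, hL, fun q hq => ⟨Finset.notMem_empty _, hj q hq⟩⟩).trans ?_
  · rintro q l s ⟨D, rfl, hl, hD⟩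
    rw [List.nodup_cons] at hl
    have hq := hD q List.mem_cons_self
    refine ⟨⟨insert q D, ?_, hl.2, ?_⟩, ?_⟩
    · rw [funext (cnt_membersWithin_insert hq.1 hq.2), ← sem_shiftAdd, ← sem_vadd]; rfl
    · intro p hp
      refine ⟨fun hpD => ?_, (hD p (List.mem_cons_of_mem _ hp)).2⟩
      rcases Finset.mem_insert.1 hpD with rfl | hpD
      · exact hl.1 hp
      · exact (hD p (List.mem_cons_of_mem _ hp)).1 hpD
    · have e1 := h₂ (w := w) (cnt (membersWithin r j D)) (cnt (membersBelow r j))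
        (fun k => (size_cnt_le _ k).trans (by omega)) (fun k => (size_cnt_le _ k).trans (by omega))
      have e2 := h₁ (w := w) (cnt (membersWithin r j D))
        (fun k => cnt (membersWithin r j D) k + cnt (membersBelow r j) k)
        (fun k => (size_cnt_le _ k).trans (by omega)) (fun k => by
          have a1 := cnt_le (membersWithin r j D) k
          have a2 := cnt_le (membersBelow r j) k
          rw [Nat.size_le, pow_add]
          have : 0 < 2 ^ w := by positivity
          omega)
      rw [← sem_vadd] at e2
      change ((3 + (2 + (zip add).cost (.cons (vec w (cnt (membersWithin r j D)))
        (vec w (cnt (membersBelow r j)))) + 1) + 1) + shiftAdd.cost (.cons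
        (vec w (cnt (membersWithin r j D))) ((zip add).sem (.cons
        (vec w (cnt (membersWithin r j D))) (vec w (cnt (membersBelow r j)))))) + 1 + 3 + 1) + 3 ≤ _
      omega
  · have h1 : w * (C₁ * (w + 1) ^ 2 + C₂ * (w + 1) ^ 2) + (C₁ * (w + 1) ^ 2 + C₂ * (w + 1) ^ 2) =
      C₁ * (w + 1) ^ 3 + C₂ * (w + 1) ^ 3 := by ring
    have h2 : w + 1 ≤ (w + 1) ^ 3 := Nat.le_self_pow (by omega) _
    have h3 : L.length ≤ w := by simpa using hL.length_le_card
    have h4 := Nat.mul_le_mul_right (C₁ * (w + 1) ^ 2 + C₂ * (w + 1) ^ 2) h3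
    nlinarith

/-- The step of `wilds`: `(positions, (zeros, p))` becomes the new vector `p`. -/
def wildStep : Code := ite (head id) wild (tail (tail id))

/-- An index that does not occur in the row imposes no condition, so the vector must stay as it is.
The branch is necessary because `wild` would return the zero vector for an empty bubble. -/
theorem sem_wildStep (r : Row w) (j : ℕ) : wildStep.sem (.cons
    (blanks ((List.finRange w).filter fun p => decide (r p = Symb.e j)))
    (.cons (vec w fun _ => 0) (vec w (cnt (membersBelow r j))))) =
      vec w (cnt (membersBelow r (j + 1))) := by
  by_cases hj : ∃ p, r p = Symb.e j
  · have h1 : (List.finRange w).filter (fun p => decide (r p = Symb.e j)) ≠ [] := by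
      obtain ⟨p, hp⟩ := hj
      exact List.ne_nil_of_mem (a := p) (by simp [hp])
    have h2 := sem_wild_list r j ((List.finRange w).filter fun p => decide (r p = Symb.e j)) ∅
      ((List.nodup_finRange w).filter _) (fun q hq => ⟨Finset.notMem_empty _, by simpa using hq⟩)
    rw [membersWithin_empty, cnt_empty, membersWithin_eq_membersBelow_succ (fun p hp => by simp [hp])
      hj] at h2
    rw [← h2]
    generalize (List.finRange w).filter (fun p => decide (r p = Symb.e j)) = l at h1 ⊢
    cases l with
    | nil => exact (h1 rfl).elim
    | cons p l => rfl
  · push Not at hj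
    have h1 : (List.finRange w).filter (fun p => decide (r p = Symb.e j)) = [] := by
      simp [hj]
    rw [h1, membersBelow_succ_eq hj]
    rfl

/-- `(facets, (p, (r, zeros)))`: count the sets compatible with all wildcards. -/
def wilds : Code :=
  recur (head id) (cons (comp wildStep (cons (comp occ (cons (head (tail (tail id)))
    (head (head id)))) (cons (tail (tail (tail id))) (head (tail id))))) (tail (tail id)))
    (tail (tail id))

theorem sem_wilds_list (F : Fin h → Finset (Fin w)) (r : Row w) (l : List (Fin h)) : ∀ j : ℕ,
    l.map Fin.val = List.range' j l.length → wilds.sem (.cons (encList (encFacet F) l)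
      (.cons (vec w (cnt (membersBelow r j))) (.cons (encRow r) (vec w fun _ => 0)))) =
        vec w (cnt (membersBelow r (j + l.length))) := by
  induction l with
  | nil => intro j _; rfl
  | cons i l ih =>
    intro j hj
    rw [List.map_cons, List.length_cons, List.range'_succ, List.cons.injEq] at hj
    obtain ⟨rfl, hl⟩ := hj
    have h1 : (i : ℕ) + (i :: l).length = i + 1 + l.length := by
      rw [List.length_cons]; omega
    rw [h1, ← ih _ hl, ← sem_wildStep, ← sem_occ, ← encRow_eq]
    rfl

theorem sem_wilds (F : Fin h → Finset (Fin w)) {r : Row w} (hr : r.WildcardsLT h) :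
    wilds.sem (.cons (encList (encFacet F) (List.finRange h)) (.cons
      (vec w (cnt (membersBelow r 0))) (.cons (encRow r) (vec w fun _ => 0)))) =
        vec w r.cardOf := by
  rw [sem_wilds_list F r (List.finRange h) 0, List.length_finRange, Nat.zero_add,
    membersBelow_eq_members hr, cardOf_eq_cnt]
  rw [List.map_val_finRange, List.length_finRange, List.range_eq_range']

/-- The bound treats each of the `h` indices as if its bubble had `w` positions; this crude estimate
still fits into the total. -/
theorem cost_wilds : ∃ C, ∀ {w h : ℕ} (F : Fin h → Finset (Fin w)) (r : Row w), h ≤ 2 ^ w →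
    wilds.cost (.cons (encList (encFacet F) (List.finRange h)) (.cons
      (vec w (cnt (membersBelow r 0))) (.cons (encRow r) (vec w fun _ => 0)))) ≤
        C * ((h + 1) * (w + 1) ^ 3) := by
  obtain ⟨C₁, h₁⟩ := cost_occ
  obtain ⟨C₂, h₂⟩ := cost_wild_list
  refine ⟨C₁ + C₂ + 100, fun {w h} F r hh => ?_⟩
  refine (cost_recur_le (encFacet F) (fun l s => ∃ j, l.map Fin.val = List.range' j l.length ∧
    s = .cons (vec w (cnt (membersBelow r j))) (.cons (encRow r) (vec w fun _ => 0)))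
    2 (C₁ * (w + 1) ^ 2 + C₂ * (w + 1) ^ 3 + 60) (fun s _ => le_rfl) ?_ (List.finRange h) _
    ⟨0, by rw [List.map_val_finRange, List.length_finRange, List.range_eq_range'], rfl⟩).trans ?_
  · rintro i l s ⟨j, hj, rfl⟩
    rw [List.map_cons, List.length_cons, List.range'_succ, List.cons.injEq] at hj
    obtain ⟨rfl, hl⟩ := hj
    refine ⟨⟨i + 1, hl, ?_⟩, ?_⟩
    · rw [← sem_wildStep, ← sem_occ, ← encRow_eq]; rfl
    · have e1 := h₁ r i (Nat.size_le.2 (i.2.trans_le hh))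
      have e2 := h₂ r i ((List.finRange w).filter fun p => decide (r p = Symb.e i))
        ((List.nodup_finRange w).filter _) (fun q hq => by simpa using hq)
      have e3 := cost_ite_le (head id) wild (tail (tail id)) (.cons
        (blanks ((List.finRange w).filter fun p => decide (r p = Symb.e i)))
        (.cons (vec w fun _ => 0) (vec w (cnt (membersBelow r i)))))
      rw [← sem_occ, ← encRow_eq] at e2 e3
      change wildStep.cost _ ≤ 2 + wild.cost _ + 3 + 1 at e3
      change (((4 + 3 + 1) + occ.cost (.cons (encRow r) (encNat i)) + 1 + (4 + 3 + 1) + 1) +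
        wildStep.cost (.cons (occ.sem (.cons (encRow r) (encNat i)))
        (.cons (vec w fun _ => 0) (vec w (cnt (membersBelow r i))))) + 1 + 3 + 1) + 3 ≤ _
      omega
  · rw [List.length_finRange]
    have m1 : (w + 1) ^ 2 ≤ (w + 1) ^ 3 := Nat.pow_le_pow_right (by omega) (by omega)
    have m2 : 1 ≤ (w + 1) ^ 3 := Nat.one_le_pow _ _ (by omega)
    have m3 := Nat.mul_le_mul_left (h * C₁) m1
    have m4 := Nat.mul_le_mul_left h m2
    nlinarith

/-- The vector `0, …, 0`, from `(r, nil)`. -/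
def zeros : Code := recur (cons nil nil) (tail id) (cons nil (tail (tail id)))

theorem sem_zeros (r : Row w) : zeros.sem (.cons (encRow r) .nil) = vec w fun _ => 0 := by
  have h1 : ∀ {α : Type} (enc : α → Val) (l : List α), zeros.sem (.cons (encList enc l) .nil) =
      encList (fun _ => encNat 0) (List.range (l.length + 1)) := by
    intro α enc l
    rw [encNat_zero]
    induction l with
    | nil => rfl
    | cons a l ih =>
      rw [List.length_cons, List.range_succ_eq_map]
      change _ = Val.cons .nil (encList _ (List.map _ _))
      rw [encList_map, ← ih]
      rfl
  rw [encRow_eq, rowOn, h1, List.length_finRange]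
  rfl

theorem encNat_one : encNat 1 = .cons (.cons .nil .nil) .nil := by
  rw [encNat_of_ne_zero one_ne_zero, show Nat.div2 1 = 0 from rfl, encNat_zero]
  rfl

/-- The step of `cardRow`: the input is `(zeros, (r, facets))`. -/
def cardRowStep : Code :=
  comp wilds (cons (tail (tail id)) (cons (comp plain (cons (head (tail id))
    (cons (cons (cons tt nil) (tail (head id))) (head id)))) (cons (head (tail id)) (head id))))

/-- `(r, facets)`: the vector `Card(r, 0), …, Card(r, w)`. -/
def cardRow : Code := comp cardRowStep (cons (comp zeros (cons (head id) nil)) id)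

/-- The initial vector `1, 0, …, 0` belongs to the family whose only member is the empty set; it is
made by replacing the first entry of the zero vector. -/
theorem cons_one_tail_zeros (w : ℕ) : Val.cons (encNat 1) (vec w fun _ => 0).tail =
    vec w fun k => if k = 0 then 1 else 0 := by
  rw [vec, vec, List.range_succ_eq_map, encList, encList, Val.tail_cons, encList_map, encList_map]
  rfl

theorem sem_cardRow (F : Fin h → Finset (Fin w)) {r : Row w} (hr : r.WildcardsLT h) :
    cardRow.sem (.cons (encRow r) (encList (encFacet F) (List.finRange h))) =
      vec w r.cardOf := by
  rw [← sem_wilds F hr, ← sem_plain, ← cons_one_tail_zeros, ← sem_zeros r, encNat_one]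
  rfl

theorem cost_cardRow : ∃ C, ∀ {w h : ℕ} (F : Fin h → Finset (Fin w)) (r : Row w), h ≤ 2 ^ w →
    cardRow.cost (.cons (encRow r) (encList (encFacet F) (List.finRange h))) ≤
      C * ((h + 1) * (w + 1) ^ 3) := by
  obtain ⟨C₁, h₁⟩ := cost_plain
  obtain ⟨C₂, h₂⟩ := cost_wilds
  refine ⟨C₁ + C₂ + 200, fun {w h} F r hh => ?_⟩
  have e1 := h₁ r
  have e2 := h₂ F r hh
  have e3 : zeros.cost (.cons (encRow r) .nil) ≤ 3 + 8 + w * (10 + 26) := by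
    have := cost_recur_le (b := cons nil nil) (p := tail id) (q := cons nil (tail (tail id)))
      (fun p => encSymb (r p)) (fun _ _ => True) 3 10
      (fun s _ => le_rfl) (fun a l s _ => ⟨trivial, by
        exact cost_add_cost_le _ rfl _ rfl (by decide) _ _⟩) (List.finRange w) .nil trivial
    rw [List.length_finRange] at this
    rw [encRow_eq]
    exact this
  rw [← sem_plain, ← cons_one_tail_zeros, ← sem_zeros r, encNat_one] at e2
  rw [← cons_one_tail_zeros, ← sem_zeros r, encNat_one] at e1
  change ((2 + 1 + 1) + zeros.cost (.cons (encRow r) .nil) + 1 + 1 + 1) +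
    ((3 + (((3 + ((5 + 3 + 1) + 2 + 1) + 1) + plain.cost (.cons (encRow r) (.cons
      (.cons (.cons (.cons .nil .nil) .nil) (zeros.sem (.cons (encRow r) .nil)).tail)
      (zeros.sem (.cons (encRow r) .nil)))) + 1) + (3 + 2 + 1) + 1) + 1) +
    wilds.cost (.cons (encList (encFacet F) (List.finRange h)) (.cons (plain.sem (.cons (encRow r)
      (.cons (.cons (.cons (.cons .nil .nil) .nil) (zeros.sem (.cons (encRow r) .nil)).tail)
      (zeros.sem (.cons (encRow r) .nil))))) (.cons (encRow r)
      (zeros.sem (.cons (encRow r) .nil))))) + 1) + 1 ≤ _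
  have m1 : (w + 1) ^ 3 ≤ (h + 1) * (w + 1) ^ 3 := Nat.le_mul_of_pos_left _ (by omega)
  have m2 : w + 1 ≤ (w + 1) ^ 3 := Nat.le_self_pow (by omega) _
  have m3 := Nat.mul_le_mul_left C₁ m1
  rw [Nat.add_mul, Nat.add_mul]
  omega

end Code

end Lisp

/-! ### The complete method and its running time -/

namespace Lisp

namespace Code

variable {w h : ℕ}

/-- The row `2, …, 2`, from `(set, nil)`. -/
def twosRow : Code := recur nil (tail id) (cons (cons nil tt) (tail (tail id)))

theorem sem_twosRow (X : Finset (Fin w)) :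
    twosRow.sem (.cons (encSet X) .nil) = encRow (fun _ : Fin w => Symb.two) := by
  rw [encSet_eq, encRow_eq]
  induction List.finRange w with
  | nil => rfl
  | cons p L ih => exact congrArg (Val.cons (encSymb Symb.two)) ih

theorem cost_twosRow (X : Finset (Fin w)) :
    twosRow.cost (.cons (encSet X) .nil) ≤ 100 * (w + 1) := by
  rw [encSet_eq]
  refine (cost_recur_le (fun p => encBool (decide (p ∈ X))) (fun _ _ => True) 1 20
    (fun s _ => le_rfl) (fun a l s _ => ⟨trivial, ?_⟩) (List.finRange w) _ trivial).trans ?_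
  · exact cost_add_cost_le _ rfl _ rfl (by decide) _ _
  · rw [List.length_finRange]; omega

/-- `(rows, facets)`: the vectors `Card(r, ·)` of the rows. -/
def cardRows : Code :=
  recur nil (tail id) (cons (comp cardRow (cons (head id) (head (tail id)))) (tail (tail id)))

theorem sem_cardRows (F : Fin h → Finset (Fin w)) (rows : List (Row w))
    (hr : ∀ r ∈ rows, r.WildcardsLT h) :
    cardRows.sem (.cons (encList encRow rows) (encList (encFacet F) (List.finRange h))) =
      encList (fun r => vec w r.cardOf) rows := by
  induction rows with
  | nil => rfl
  | cons r rows ih =>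
    change _ = Val.cons (vec w r.cardOf) (encList _ rows)
    rw [← ih fun s hs => hr s (List.mem_cons_of_mem _ hs),
      ← sem_cardRow F (hr r List.mem_cons_self)]
    rfl

theorem cost_cardRows : ∃ C, ∀ {w h : ℕ} (F : Fin h → Finset (Fin w)) (rows : List (Row w)),
    h ≤ 2 ^ w → cardRows.cost (.cons (encList encRow rows)
      (encList (encFacet F) (List.finRange h))) ≤
        C * ((rows.length + 1) * ((h + 1) * (w + 1) ^ 3)) := by
  obtain ⟨C, hC⟩ := cost_cardRow
  refine ⟨C + 100, fun {w h} F rows hh => ?_⟩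
  refine (cost_recur_le encRow (fun _ s => s = encList (encFacet F) (List.finRange h)) 1
    (C * ((h + 1) * (w + 1) ^ 3) + 30) (fun s _ => le_rfl) ?_ rows _ rfl).trans ?_
  · rintro r l s rfl
    refine ⟨rfl, ?_⟩
    have := hC F r hh
    change 2 + ((2 + 3 + 1) + cardRow.cost (.cons (encRow r)
      (encList (encFacet F) (List.finRange h))) + 1 + 3 + 1) ≤ _
    omega
  · have m2 : 1 ≤ (h + 1) * (w + 1) ^ 3 := Nat.succ_le_of_lt (by positivity)
    generalize (h + 1) * (w + 1) ^ 3 = M at *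
    have m4 : rows.length ≤ rows.length * M := Nat.le_mul_of_pos_right _ (by omega)
    have e1 : rows.length * (C * M + 30 + 26) = C * (rows.length * M) + 56 * rows.length := by ring
    have e2 : (C + 100) * ((rows.length + 1) * M) =
      C * (rows.length * M) + C * M + 100 * (rows.length * M) + 100 * M := by ring
    rw [e1, e2]
    omega

/-- `(lists, nil)`: the tails of the lists. -/
def tails : Code := recur nil (tail id) (cons (tail (head id)) (tail (tail id)))

theorem sem_tails {α : Type*} (enc : α → Val) (l : List α) :
    tails.sem (.cons (encList enc l) .nil) = encList (fun a => (enc a).tail) l := by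
  induction l with
  | nil => rfl
  | cons a l ih => exact congrArg (Val.cons (enc a).tail) ih

theorem cost_tails {α : Type*} (enc : α → Val) (l : List α) :
    tails.cost (.cons (encList enc l) .nil) ≤ 100 * (l.length + 1) := by
  refine (cost_recur_le enc (fun _ _ => True) 1 20
    (fun s _ => le_rfl) (fun a l s _ => ⟨trivial, ?_⟩) l _ trivial).trans ?_
  · exact cost_add_cost_le _ rfl _ rfl (by decide) _ _
  · omega

/-- `(vectors, f)`: subtract the vectors from `f`. -/
def subtract : Code := recur id (comp (zip sub) (cons (tail id) (head id))) (tail (tail id))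

theorem sem_subtract (rows : List (Row w)) : ∀ f : ℕ → ℕ,
    (∀ k, (rows.map fun r => r.cardOf k).sum ≤ f k) →
      subtract.sem (.cons (encList (fun r => vec w r.cardOf) rows) (vec w f)) =
        vec w fun k => f k - (rows.map fun r => r.cardOf k).sum := by
  induction rows with
  | nil => intro f _; rfl
  | cons r rows ih =>
    intro f hf
    simp only [List.map_cons, List.sum_cons] at hf
    have h1 := ih (fun k => f k - r.cardOf k) fun k => by have := hf k; omega
    simp only [List.map_cons, List.sum_cons, ← Nat.sub_sub]
    rw [← h1, ← sem_vsub f r.cardOf fun k => by have := hf k; omega]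
    rfl

theorem cost_subtract : ∃ C, ∀ {w : ℕ} (rows : List (Row w)) (f : ℕ → ℕ),
    (∀ k, (rows.map fun r => r.cardOf k).sum ≤ f k) → (∀ k, f k ≤ 2 ^ w) →
      subtract.cost (.cons (encList (fun r => vec w r.cardOf) rows) (vec w f)) ≤
        C * ((rows.length + 1) * (w + 1) ^ 2) := by
  obtain ⟨C, hC⟩ := cost_vsub
  refine ⟨C + 100, fun {w} rows f hf hw => ?_⟩
  refine (cost_recur_le (fun r : Row w => vec w r.cardOf) (fun l s => ∃ g : ℕ → ℕ,
    s = vec w g ∧ (∀ k, (l.map fun r => r.cardOf k).sum ≤ g k) ∧ ∀ k, g k ≤ 2 ^ w) 1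
    (C * (w + 1) ^ 2 + 30) (fun s _ => le_rfl) ?_ rows _ ⟨f, rfl, hf, hw⟩).trans ?_
  · rintro r l s ⟨g, rfl, hg, hw⟩
    simp only [List.map_cons, List.sum_cons] at hg
    refine ⟨⟨fun k => g k - r.cardOf k, ?_, fun k => Nat.le_sub_of_add_le' (hg k),
      fun k => (Nat.sub_le _ _).trans (hw k)⟩, ?_⟩
    · rw [← sem_vsub g r.cardOf fun k => by have := hg k; omega]; rfl
    · have := hC (w := w) g r.cardOf fun k => Nat.size_le.2 ((hw k).trans_lt
        (Nat.pow_lt_pow_right (by omega) (by omega)))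
      change (2 + 2 + 1) + (zip sub).cost (.cons (vec w g) (vec w r.cardOf)) + 1 + 3 ≤ _
      omega
  · have m2 : 1 ≤ (w + 1) ^ 2 := Nat.one_le_pow _ _ (by omega)
    generalize (w + 1) ^ 2 = M at *
    have m4 : rows.length ≤ rows.length * M := Nat.le_mul_of_pos_right _ (by omega)
    have e1 : rows.length * (C * M + 30 + 26) = C * (rows.length * M) + 56 * rows.length := by ring
    have e2 : (C + 100) * ((rows.length + 1) * M) =
      C * (rows.length * M) + C * M + 100 * (rows.length * M) + 100 * M := by ring
    rw [e1, e2]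
    omega

/-- `(cards, (rows, (facets, twos)))`: assemble the output. -/
def output : Code :=
  cons (head (tail id)) (cons (comp tails (cons (head id) nil))
    (tail (comp subtract (cons (head id) (comp cardRow (cons (tail (tail (tail id)))
      (head (tail (tail id)))))))))

/-- `(rows, (facets, twos))`: count, and assemble the output. -/
def countRows : Code := comp output (cons (comp cardRows (cons (head id) (head (tail id)))) id)

/-- `(facets, twos)`: run the `e`-algorithm, count, and assemble the output. -/
def runRows : Code :=
  comp countRows (cons (comp imposeLoop (cons (head id) (cons (cons (tail id) nil) (head id)))) id)

/-- The method, for the list of the facets. -/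
def main : Code :=
  comp runRows (cons (comp number (cons id nil)) (comp twosRow (cons (head id) nil)))

section

variable {S : LowerSet (Finset (Fin w))} {F H : Fin h → Finset (Fin w)}

/-- This is what `sub` requires: subtracting the counts of the rows from the binomial coefficients
never becomes negative. -/
theorem sum_cardOf_le (hS : ∀ X, IsTransversal H X ↔ X ∉ S) (k : ℕ) :
    ((eRows H).map fun r => r.cardOf k).sum ≤ Row.cardOf (fun _ : Fin w => Symb.two) k := by
  rw [cardOf_twos, ← transversalNumber_eq_sum, ← faceNumber_add_transversalNumber hS k]
  omega

theorem head_encFamily_encSet (hh : 0 < h) :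
    (encFamily encSet F).head = encSet (F ⟨0, hh⟩) := by
  cases h with
  | zero => exact (lt_irrefl 0 hh).elim
  | succ h => rw [encFamily, List.ofFn_succ]; rfl

/-- A facet must exist, because the length `w` of the initial row is read off the first incidence
vector. -/
theorem sem_main (hh : 0 < h) (hH : ∀ i p, p ∈ H i ↔ p ∉ F i)
    (hS : ∀ X, IsTransversal H X ↔ X ∉ S) :
    main.sem (encFamily encSet F) = encResult S (eRows H) := by
  have h1 : main.sem (encFamily encSet F) = runRows.sem
      (.cons (encList (encFacet F) (List.finRange h)) (encRow fun _ : Fin w => Symb.two)) := by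
    rw [← sem_twosRow (F ⟨0, hh⟩), ← sem_number, ← head_encFamily_encSet]; rfl
  have h2 : runRows.sem
      (.cons (encList (encFacet F) (List.finRange h)) (encRow fun _ : Fin w => Symb.two)) =
      countRows.sem (.cons (encList encRow (eRows H)) (.cons
        (encList (encFacet F) (List.finRange h)) (encRow fun _ : Fin w => Symb.two))) := by
    rw [eRows_eq, ← sem_imposeLoop hH]; rfl
  have h3 : countRows.sem (.cons (encList encRow (eRows H)) (.cons
        (encList (encFacet F) (List.finRange h)) (encRow fun _ : Fin w => Symb.two))) =
      output.sem (.cons (encList (fun r => vec w r.cardOf) (eRows H))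
        (.cons (encList encRow (eRows H)) (.cons
        (encList (encFacet F) (List.finRange h)) (encRow fun _ : Fin w => Symb.two)))) := by
    rw [← sem_cardRows F (eRows H) wildcardsLT_of_mem_eRows]; rfl
  have h4 : encFamily encNat (fun k : Fin w => faceNumber S (k + 1)) =
      (subtract.sem (.cons (encList (fun r => vec w r.cardOf) (eRows H)) (cardRow.sem
        (.cons (encRow fun _ : Fin w => Symb.two)
          (encList (encFacet F) (List.finRange h)))))).tail := by
    rw [sem_cardRow F (by simp [Row.WildcardsLT]), sem_subtract _ _ (sum_cardOf_le hS), tail_vec]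
    congr 1
    funext k
    rw [cardOf_twos, ← transversalNumber_eq_sum, ← faceNumber_add_transversalNumber hS]
    omega
  have h5 : encList (fun r : Row w => encFamily encNat fun k : Fin w => r.cardOf (k + 1))
      (eRows H) = tails.sem (.cons (encList (fun r => vec w r.cardOf) (eRows H)) .nil) := by
    rw [sem_tails]
    exact encList_congr fun r _ => (tail_vec w r.cardOf).symm
  rw [h1, h2, h3, encResult, h4, h5]
  rfl

end

theorem cost_output_eq (a b c d : Val) :
    output.cost (.cons a (.cons b (.cons c d))) = tails.cost (.cons a .nil) +
      cardRow.cost (.cons d c) + subtract.cost (.cons a (cardRow.sem (.cons d c))) + 25 := by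
  have : output.cost (.cons a (.cons b (.cons c d))) = 3 + ((4 + tails.cost (.cons a .nil) + 1) +
      (((2 + ((4 + 4 + 1) + cardRow.cost (.cons d c) + 1) + 1) +
        subtract.cost (.cons a (cardRow.sem (.cons d c))) + 1) + 1) + 1) + 1 := rfl
  omega

theorem cost_countRows_eq (a b c : Val) :
    countRows.cost (.cons a (.cons b c)) = cardRows.cost (.cons a b) +
      output.cost (.cons (cardRows.sem (.cons a b)) (.cons a (.cons b c))) + 10 := by
  have : countRows.cost (.cons a (.cons b c)) = (((2 + 3 + 1) + cardRows.cost (.cons a b) + 1) +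
      1 + 1) + output.cost (.cons (cardRows.sem (.cons a b)) (.cons a (.cons b c))) + 1 := rfl
  omega

theorem cost_runRows_eq (a b : Val) :
    runRows.cost (.cons a b) = imposeLoop.cost (.cons a (.cons (.cons b .nil) a)) +
      countRows.cost (.cons (imposeLoop.sem (.cons a (.cons (.cons b .nil) a))) (.cons a b)) +
        14 := by
  have : runRows.cost (.cons a b) = ((2 + (4 + 2 + 1) + 1) +
      imposeLoop.cost (.cons a (.cons (.cons b .nil) a)) + 1 + 1 + 1) +
      countRows.cost (.cons (imposeLoop.sem (.cons a (.cons (.cons b .nil) a))) (.cons a b)) +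
        1 := rfl
  omega

theorem cost_main_eq (v : Val) :
    main.cost v = number.cost (.cons v .nil) + twosRow.cost (.cons v.head .nil) +
      runRows.cost (.cons (number.sem (.cons v .nil)) (twosRow.sem (.cons v.head .nil))) + 11 := by
  have : main.cost v = ((3 + number.cost (.cons v .nil) + 1) +
      (4 + twosRow.cost (.cons v.head .nil) + 1) + 1) +
      runRows.cost (.cons (number.sem (.cons v .nil)) (twosRow.sem (.cons v.head .nil))) + 1 := rfl
  omega

/-- The condition `Finset.univ ∉ S` makes `Finset.univ` a transversal, so the initial row is
feasible. This starts the invariant of `cost_imposeLoop`, without which the number of intermediate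
rows would not be controlled by the final one. -/
theorem cost_main : ∃ C, ∀ {w h : ℕ} {S : LowerSet (Finset (Fin w))}
    {F H : Fin h → Finset (Fin w)}, 0 < h → h ≤ 2 ^ w → (∀ i p, p ∈ H i ↔ p ∉ F i) →
      (∀ X, IsTransversal H X ↔ X ∉ S) → Finset.univ ∉ S →
        main.cost (encFamily encSet F) ≤
          C * ((h + 1) * (((eRows H).length + 1) * ((h + 1) * (w + 1) ^ 3))) := by
  obtain ⟨C₁, h₁⟩ := cost_number
  obtain ⟨C₂, h₂⟩ := cost_imposeLoop
  obtain ⟨C₃, h₃⟩ := cost_cardRows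
  obtain ⟨C₄, h₄⟩ := cost_cardRow
  obtain ⟨C₅, h₅⟩ := cost_subtract
  refine ⟨C₁ + C₂ + C₃ + C₄ + C₅ + 1000, fun {w h S F H} hh hw hH hS hU => ?_⟩
  have hf : ∀ r ∈ [fun _ : Fin w => Symb.two], Feasible H r := by
    intro r hr
    rw [List.mem_singleton] at hr
    subst hr
    intro i
    obtain ⟨p, hp⟩ := (hS Finset.univ).2 hU i
    exact ⟨p, (Finset.mem_inter.1 hp).2, Symb.noConfusion⟩
  have e1 := h₁ F hw
  have e2 := h₂ hH hw (List.finRange h) [fun _ => Symb.two] pending_init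
    (by simp [Row.WildcardsLT]) hf
  have e3 := h₃ F (eRows H) hw
  have e4 := h₄ F (fun _ => Symb.two) hw
  have e5 := h₅ (eRows H) _ (sum_cardOf_le hS) (fun k => by
    rw [cardOf_eq_cnt]; exact cnt_le _ k)
  have e6 := cost_twosRow (F ⟨0, hh⟩)
  have e7 := cost_tails (fun r : Row w => vec w r.cardOf) (eRows H)
  rw [List.length_finRange, ← eRows_eq] at e2
  have e8 := sem_imposeLoop hH (List.finRange h) [fun _ : Fin w => Symb.two]
  rw [← eRows_eq] at e8
  simp only [encList] at e2 e8
  rw [cost_main_eq, head_encFamily_encSet hh, sem_number, sem_twosRow, cost_runRows_eq, e8,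
    cost_countRows_eq, sem_cardRows F (eRows H) wildcardsLT_of_mem_eRows, cost_output_eq,
    sem_cardRow F (by simp [Row.WildcardsLT])]
  generalize (eRows H).length = R at *
  have b1 : 1 ≤ (h + 1) * (w + 1) ^ 3 := Nat.succ_le_of_lt (by positivity)
  have b2 : w + 1 ≤ (w + 1) ^ 3 := Nat.le_self_pow (by decide) _
  have b3 : (w + 1) ^ 2 ≤ (w + 1) ^ 3 := Nat.pow_le_pow_right (by omega) (by decide)
  have b4 : (w + 1) ^ 3 ≤ (h + 1) * (w + 1) ^ 3 := Nat.le_mul_of_pos_left _ (by omega)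
  have b5 : (h + 1) * (w + 1) ≤ (h + 1) * (w + 1) ^ 3 := Nat.mul_le_mul_left _ b2
  have b6 := Nat.mul_le_mul_left (R + 1) (b3.trans b4)
  generalize (h + 1) * (w + 1) ^ 3 = X at *
  have b7 : X ≤ (R + 1) * X := Nat.le_mul_of_pos_left _ (by omega)
  have b8 : R + 1 ≤ (R + 1) * X := Nat.le_mul_of_pos_right _ b1
  have b9 : (R + 1) * X ≤ (h + 1) * ((R + 1) * X) := Nat.le_mul_of_pos_left _ (by omega)
  generalize (h + 1) * ((R + 1) * X) = M at *
  have a1 := e1.trans (Nat.mul_le_mul_left C₁ (b5.trans (b7.trans b9)))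
  have a3 := e3.trans (Nat.mul_le_mul_left C₃ b9)
  have a4 := e4.trans (Nat.mul_le_mul_left C₄ (b7.trans b9))
  have a5 := e5.trans (Nat.mul_le_mul_left C₅ (b6.trans b9))
  rw [Nat.add_mul, Nat.add_mul, Nat.add_mul, Nat.add_mul, Nat.add_mul]
  omega

end Code

end Lisp

/-! ### The bound in its final form -/

/-- Polynomial bookkeeping: shifts by one are absorbed by the constant. -/
theorem cast_mul_le_of_le_shifted {C R h w t : ℕ} (hR : 1 ≤ R) (hh : 1 ≤ h) (hw : 2 ≤ w)
    (ht : t ≤ C * ((h + 1) * ((R + 1) * ((h + 1) * (w + 1) ^ 3)))) :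
    ((t + 2 : ℕ) : ℝ) ≤
      (256 * (C + 2) : ℕ) * (R : ℝ) * (h : ℝ) ^ 2 * (w : ℝ) ^ 3 * Real.log w ^ 2 := by
  -- The factor 64 is `2 · 2 · 2 · 2^3`, from doubling `h` twice, `R` once and `w` three times. The
  -- two additional steps are absorbed by the summand 2 in `C + 2`.
  have h1 : t + 2 ≤ 64 * (C + 2) * (R * h ^ 2 * w ^ 3) := by
    have a : (h + 1) * ((R + 1) * ((h + 1) * (w + 1) ^ 3)) ≤
        (2 * h) * ((2 * R) * ((2 * h) * (2 * w) ^ 3)) := by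
      gcongr <;> omega
    have b : (2 * h) * ((2 * R) * ((2 * h) * (2 * w) ^ 3)) = 64 * (R * h ^ 2 * w ^ 3) := by ring
    rw [b] at a
    have c : 1 ≤ R * h ^ 2 * w ^ 3 := Nat.succ_le_of_lt (by positivity)
    have d := ht.trans (Nat.mul_le_mul_left C a)
    generalize R * h ^ 2 * w ^ 3 = M at *
    have e : 64 * (C + 2) * M = C * (64 * M) + 128 * M := by ring
    omega
  -- Since `log 2 > 1/2`, the logarithmic factor costs at most a factor 4, whence `256 = 4 · 64`.
  have h2 : (1 : ℝ) ≤ 4 * Real.log w ^ 2 := by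
    have : Real.log 2 ≤ Real.log w := Real.log_le_log (by norm_num) (by exact_mod_cast hw)
    have := Real.log_two_gt_d9
    nlinarith
  have h3 : ((t + 2 : ℕ) : ℝ) ≤ ((64 * (C + 2) * (R * h ^ 2 * w ^ 3) : ℕ) : ℝ) :=
    Nat.cast_le.2 h1
  refine h3.trans ((le_mul_of_one_le_right (Nat.cast_nonneg _) h2).trans (le_of_eq ?_))
  push_cast
  ring

/-- Facets are listed without repetition, so there are at most as many as subsets. This keeps the
indices of facets and wildcards within `w` bits. -/
theorem le_two_pow_of_injective {w h : ℕ} {F : Fin h → Finset (Fin w)}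
    (hF : Function.Injective F) : h ≤ 2 ^ w := by
  simpa using Fintype.card_le_of_injective F hF

theorem theorem1 :
    ∃ (P : Lisp.Program) (C : ℝ),
      ∀ (w h : ℕ) (S : LowerSet (Finset (Fin w))) (F : Fin h → Finset (Fin w)),
        1 ≤ h → IsFacetList S F →
        ∀ (H : Fin h → Finset (Fin w)) (rows : List (Row w)),
          (∀ i, H i = Finset.univ \ F i) → rows = eRows H →
          -- the final rows partition the transversal hypergraph, the complement of `S`
          ((∀ r ∈ rows, r.members.Nonempty) ∧
            rows.Pairwise (fun r s => Disjoint r.members s.members) ∧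
            (∀ X, (∃ r ∈ rows, X ∈ r.members) ↔ IsTransversal H X) ∧
            (∀ X, IsTransversal H X ↔ X ∉ S)) ∧
          -- the face numbers come from the numbers `Card(r,k)`
          (∀ k, transversalNumber H k = (rows.map fun r => r.cardOf k).sum ∧
            (faceNumber S k : ℤ) = (w.choose k : ℤ) - (transversalNumber H k : ℤ)) ∧
          -- the method computes all this, in the stated time
          ∃ t : ℕ, Lisp.Computes P (Lisp.encFamily Lisp.encSet F) (encResult S rows) t ∧
            (2 ≤ w → Finset.univ ∉ S →
              (t : ℝ) ≤ C * (rows.length : ℝ) * (h : ℝ) ^ 2 * (w : ℝ) ^ 3 * Real.log w ^ 2) := by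
  obtain ⟨C, hC⟩ := Lisp.Code.cost_main
  refine ⟨Lisp.Code.main.program, (256 * (C + 2) : ℕ), ?_⟩
  rintro w h S F hh hF H _ hH rfl
  have hH' : ∀ i p, p ∈ H i ↔ p ∉ F i := fun i p => by simp [hH i]
  have hS := isTransversal_iff_not_mem hF hH
  refine ⟨⟨fun r _ => ⟨_, r.support_mem_members⟩, pairwise_eRows H,
    fun X => exists_mem_eRows_iff, hS⟩, fun k => ⟨transversalNumber_eq_sum H k, ?_⟩, ?_⟩
  · have := faceNumber_add_transversalNumber hS k
    omega
  · refine ⟨Lisp.Code.main.cost (Lisp.encFamily Lisp.encSet F) + 2, ?_, fun hw hU => ?_⟩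
    · rw [← Lisp.Code.sem_main hh hH' hS]
      exact Lisp.Code.computes_program _ _
    · have hR : 1 ≤ (eRows H).length := by
        obtain ⟨r, hr, -⟩ := exists_mem_eRows_iff.2 ((hS Finset.univ).2 hU)
        exact List.length_pos_of_mem hr
      exact cast_mul_le_of_le_shifted hR hh hw
        (hC hh (le_two_pow_of_injective hF.1) hH' hS hU)
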